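/- **Setting.** A clustering $C$ of a finite set $X$ is a partition of $X$; write $C(x,y)=1$ if $x\neq y$ lie in the same cluster and $C(x,y)=0$ if they lie in different clusters. For a graph $G=(X,E)$ put $d_E(x,y)=0$ if $xy$ is an edge and $d_E(x,y)=1$ otherwise. The correlation loss of $C$ is $$L_{d_E}(C)=|\{(x,y):x\ne y,\ C(x,y)=1,\ d_E(x,y)=1\}|+|\{(x,y):x\ne y,\ C(x,y)=0,\ d_E(x,y)=0\}|.$$ Let $\mathcal F_M$ be the set of clusterings of $X$ all of whose clusters have at most $M$ points. A clustering is *optimal* if it minimizes $L_{d_E}$ over $\mathcal F_M$. The distance $d_E$ is *$(\alpha,\beta)$-informative* for $C$ if, for a uniformly random ordered pair $(x,y)$ of distinct points, $\mathbf P[d_E(x,y)>0\mid C(x,y)=1]\le\alpha$ and $\mathbf P[C(x,y)=1\mid d_E(x,y)=0]\ge\beta$ (a condition with an empty conditioning event counts as satisfied). A $C$-oracle answers queries of the form "are $x,y$ in the same cluster of $C$?". **Promise correlation clustering (PCC)** with parameters $M,\alpha,\beta$: the input is a graph $G=(X,E)$ together with a same-cluster $C^*$-oracle, under the promise that $C^*$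 is optimal and $d_E$ is $(\alpha,\beta)$-informative for $C^*$. The task is to output an optimal clustering of $G$ (any one, if there are several). Algorithms are deterministic, and "polynomial time" means that the number of steps is at most a polynomial in $|X|$. **Exponential Time Hypothesis.** In 3-SAT the input is a 3CNF formula with $m$ clauses of exactly three literals each, its variables being numbered by integers below $3m$. ETH: no algorithm decides 3-SAT in time $2^{o(m)}$. ETH with explicit rate: for some $\delta>0$ no algorithm decides 3-SAT in time $O(2^{\delta m})$. **Query counts.** A number of queries is *$\Omega(|X|)$* on a class of inputs (pairs of a graph and an oracle) if the largest number of queries on inputs with $|X|=n$ is not $o(n)$, that is, if there are $c>0$ and infinitely many $n$ such that some input of the class with $|X|=n$ leads to at least $cn$ queries. **Theorem.** Let $M\ge 3$, and let $A$ be an algorithm with access to a same-cluster oracle that solves PCC with parameters $M$, $\alpha=0$, $\beta=\tfrac12$. 1. Assume ETH. If $A$ runs in polynomial time on all graphs and all $C$-oracles with $C\in\mathcal F_M$, then $A$ makes $\Omega(|X|)$ same-cluster queries on this class of inputs. 2. Assume ETH with explicit rate. If $A$ runs in polynomial time on the inputs that satisfy the promise, then $A$ makes $\Omega(|X|)$ same-cluster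 queries already on the inputs that satisfy the promise. -/

import Mathlib

open Filter Asymptotics

namespace PCC

/-! ### Algorithms

Algorithms are while-programs over binary trees, the usual "WHILE" model of computation: finitely
many variables hold binary trees, and one step builds, copies or takes apart a constant number of
cells, tests a variable, or asks the oracle. This model and multi-tape Turing machines simulate
each other with polynomial overhead. -/

/-- Binary trees, the data on which programs operate. -/
inductive Data : Type
  | nil : Data
  | cons (a b : Data) : Data

namespace Data

/-- First component; `nil` for `nil`. -/
def hd : Data → Data
  | nil => nil
  | cons a _ => a

/-- Second component; `nil` for `nil`. -/
def tl : Data → Data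
  | nil => nil
  | cons _ b => b

/-- Lists as right-nested trees. -/
def ofList : List Data → Data
  | [] => nil
  | a :: l => cons a (ofList l)

/-- Natural numbers in unary. -/
def ofNat : ℕ → Data
  | 0 => nil
  | k + 1 => cons nil (ofNat k)

/-- Bits. -/
def ofBool : Bool → Data
  | false => nil
  | true => cons nil nil

end Data

/-- The contents of the variables. -/
abbrev Store := ℕ → Data

/-- Expressions. -/
inductive Expr : Type
  | nil : Expr
  | var (x : ℕ) : Expr
  | cons (e f : Expr) : Expr
  | hd (e : Expr) : Expr
  | tl (e : Expr) : Expr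

/-- The value of an expression. -/
def Expr.eval (s : Store) : Expr → Data
  | .nil => Data.nil
  | .var x => s x
  | .cons e f => Data.cons (e.eval s) (f.eval s)
  | .hd e => (e.eval s).hd
  | .tl e => (e.eval s).tl

/-- Programs: assignment, oracle query (`query x e f` stores in `x` the answer to the query
`(e, f)`), composition, branching and looping (the guard is true when its value is not `nil`). -/
inductive Cmd : Type
  | assign (x : ℕ) (e : Expr) : Cmd
  | query (x : ℕ) (e f : Expr) : Cmd
  | seq (c d : Cmd) : Cmd
  | branch (e : Expr) (c d : Cmd) : Cmd
  | loop (e : Expr) (c : Cmd) : Cmd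

/-- `Exec O c s s' t q`: with the oracle `O`, the program `c` started in the store `s` halts in the
store `s'` after `t` steps, having made `q` oracle queries. Assignments, queries and tests of a
guard are the steps; as the expressions are fixed by the program, each of them is a bounded number
of elementary operations. -/
inductive Exec (O : Data → Data → Bool) : Cmd → Store → Store → ℕ → ℕ → Prop
  | assign (x : ℕ) (e : Expr) (s : Store) :
      Exec O (.assign x e) s (Function.update s x (e.eval s)) 1 0
  | query (x : ℕ) (e f : Expr) (s : Store) :
      Exec O (.query x e f) s
        (Function.update s x (Data.ofBool (O (e.eval s) (f.eval s)))) 1 1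
  | seq {c d : Cmd} {s₁ s₂ s₃ : Store} {t t' q q' : ℕ}
      (h : Exec O c s₁ s₂ t q) (h' : Exec O d s₂ s₃ t' q') :
      Exec O (.seq c d) s₁ s₃ (t + t') (q + q')
  | branch_true {e : Expr} {c d : Cmd} {s s' : Store} {t q : ℕ}
      (he : e.eval s ≠ Data.nil) (h : Exec O c s s' t q) :
      Exec O (.branch e c d) s s' (t + 1) q
  | branch_false {e : Expr} {c d : Cmd} {s s' : Store} {t q : ℕ}
      (he : e.eval s = Data.nil) (h : Exec O d s s' t q) :
      Exec O (.branch e c d) s s' (t + 1) q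
  | loop_done {e : Expr} {c : Cmd} {s : Store} (he : e.eval s = Data.nil) :
      Exec O (.loop e c) s s 1 0
  | loop_step {e : Expr} {c : Cmd} {s₁ s₂ s₃ : Store} {t t' q q' : ℕ}
      (he : e.eval s₁ ≠ Data.nil) (h : Exec O c s₁ s₂ t q)
      (h' : Exec O (.loop e c) s₂ s₃ t' q') :
      Exec O (.loop e c) s₁ s₃ (t + t' + 1) (q + q')

/-- `Runs O P a b t q`: with the oracle `O`, the program `P` on input `a` halts with output `b`
after `t` steps and `q` queries. Variable `0` holds the input at the start and the output at the
end; all other variables start as `nil`. -/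
def Runs (O : Data → Data → Bool) (P : Cmd) (a b : Data) (t q : ℕ) : Prop :=
  ∃ s : Store, Exec O P (Function.update (fun _ => Data.nil) 0 a) s t q ∧ s 0 = b

/-! ### 3-SAT and the Exponential Time Hypothesis -/

/-- A literal: the index of a variable, and `true` for the variable, `false` for its negation. -/
abbrev Literal := ℕ × Bool

/-- A clause with exactly three literals. -/
abbrev Clause := Literal × Literal × Literal

/-- A 3CNF formula; the number `m` of clauses is the length of the list. -/
abbrev Formula := List Clause

namespace Formula

/-- Truth of a literal under an assignment. -/
def LitTrue (v : ℕ → Bool) (l : Literal) : Prop := v l.1 = l.2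

/-- Satisfiability. -/
def Satisfiable (φ : Formula) : Prop :=
  ∃ v : ℕ → Bool, ∀ c ∈ φ, LitTrue v c.1 ∨ LitTrue v c.2.1 ∨ LitTrue v c.2.2

/-- At most `3m` variables occur in `m` clauses; they are numbered by indices below `3m`, so that
the length of the input is bounded in terms of `m`. -/
def Numbered (φ : Formula) : Prop :=
  ∀ c ∈ φ, c.1.1 < 3 * φ.length ∧ c.2.1.1 < 3 * φ.length ∧ c.2.2.1 < 3 * φ.length

/-- Encoding of a literal. -/
def encodeLit (l : Literal) : Data := .cons (Data.ofNat l.1) (Data.ofBool l.2)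

/-- Encoding of a formula as the list of its clauses. -/
def encode (φ : Formula) : Data :=
  Data.ofList (φ.map fun c =>
    Data.ofList [encodeLit c.1, encodeLit c.2.1, encodeLit c.2.2])

end Formula

/-- The program `P`, making no queries, decides 3-SAT and takes at most `T m` steps on formulas with
`m` clauses. A formula is accepted when the output is not `nil`. -/
def DecidesThreeSATInTime (P : Cmd) (T : ℕ → ℝ) : Prop :=
  ∀ φ : Formula, φ.Numbered → ∃ (b : Data) (t : ℕ),
    Runs (fun _ _ => false) P φ.encode b t 0 ∧
      (b ≠ Data.nil ↔ φ.Satisfiable) ∧ (t : ℝ) ≤ T φ.length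

/-- The Exponential Time Hypothesis: no algorithm decides 3-SAT in time `2 ^ o(m)`, where `m` is the
number of clauses. -/
def ETH : Prop :=
  ¬ ∃ (P : Cmd) (f : ℕ → ℝ), f =o[atTop] (fun m : ℕ => (m : ℝ)) ∧
    DecidesThreeSATInTime P fun m => (2 : ℝ) ^ f m

/-- The Exponential Time Hypothesis with an explicit rate: for some `δ > 0` no algorithm decides
3-SAT in time `O(2 ^ (δ m))`. -/
def ETHWithRate : Prop :=
  ∃ δ : ℝ, 0 < δ ∧
    ¬ ∃ (P : Cmd) (K : ℝ), DecidesThreeSATInTime P fun m => K * (2 : ℝ) ^ (δ * m)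

/-! ### Promise correlation clustering

A clustering of `X` is an equivalence relation on `X`; its clusters are the equivalence classes. -/

/-- `C` belongs to the class of clusterings all of whose clusters have at most `M` elements. -/
def ClustersAtMost {X : Type} (M : ℕ) (C : Setoid X) : Prop :=
  ∀ x : X, {y | C x y}.ncard ≤ M

open Classical in
/-- `d_E(x, y) = 0` if there is an edge between `x` and `y`, and `d_E(x, y) = 1` otherwise. -/
noncomputable def edgeDist {X : Type} (G : SimpleGraph X) (x y : X) : ℝ :=
  if G.Adj x y then 0 else 1

/-- Number of ordered pairs of distinct points that are in the same cluster but not joined by an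
edge. -/
noncomputable def negLoss {X : Type} (G : SimpleGraph X) (C : Setoid X) : ℕ :=
  {p : X × X | p.1 ≠ p.2 ∧ C p.1 p.2 ∧ edgeDist G p.1 p.2 = 1}.ncard

/-- Number of ordered pairs of distinct points that are in different clusters but joined by an
edge. -/
noncomputable def posLoss {X : Type} (G : SimpleGraph X) (C : Setoid X) : ℕ :=
  {p : X × X | p.1 ≠ p.2 ∧ ¬ C p.1 p.2 ∧ edgeDist G p.1 p.2 = 0}.ncard

/-- Correlation loss. -/
noncomputable def loss {X : Type} (G : SimpleGraph X) (C : Setoid X) : ℕ :=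
  negLoss G C + posLoss G C

/-- `C` minimizes the correlation loss among the clusterings with clusters of at most `M` points. -/
def IsOptimal {X : Type} (M : ℕ) (G : SimpleGraph X) (C : Setoid X) : Prop :=
  ClustersAtMost M C ∧ ∀ C' : Setoid X, ClustersAtMost M C' → loss G C ≤ loss G C'

/-- `d` is `(α, β)`-informative with respect to `C` and `lam`: for a uniformly random ordered pair
of distinct points, `P[d > lam | same cluster] ≤ α` and `P[same cluster | d ≤ lam] ≥ β`, written
with the denominators cleared (no condition when the conditioning event is empty). -/
def IsInformative {X : Type} (d : X → X → ℝ) (C : Setoid X) (lam α β : ℝ) : Prop :=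
  ({p : X × X | p.1 ≠ p.2 ∧ C p.1 p.2 ∧ lam < d p.1 p.2}.ncard : ℝ) ≤
      α * ({p : X × X | p.1 ≠ p.2 ∧ C p.1 p.2}.ncard : ℝ) ∧
    β * ({p : X × X | p.1 ≠ p.2 ∧ d p.1 p.2 ≤ lam}.ncard : ℝ) ≤
      ({p : X × X | p.1 ≠ p.2 ∧ C p.1 p.2 ∧ d p.1 p.2 ≤ lam}.ncard : ℝ)

/-- Inputs of an algorithm with a same-cluster oracle: graphs on `n` vertices, with the clustering
by which the oracle answers. -/
abbrev InputClass := (n : ℕ) → SimpleGraph (Fin n) → Setoid (Fin n) → Prop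

/-- All graphs, with any clustering into clusters of at most `M` points as the oracle. -/
def allInputs (M : ℕ) : InputClass := fun _ _ C => ClustersAtMost M C

/-- The inputs that satisfy the promise: `C` is an optimal clustering and the distance `d_E` is
`(α, β)`-informative for `C`. As `d_E` has values `0` and `1`, every threshold in `[0, 1)` means the
same; it is taken to be `0`. -/
def promiseInputs (M : ℕ) (α β : ℝ) : InputClass := fun _ G C =>
  IsOptimal M G C ∧ IsInformative (edgeDist G) C 0 α β

open Classical in
/-- A binary relation on `n` points as an `n × n` matrix of bits, row by row. Graphs are given to
programs by their adjacency relation, clusterings by their same-cluster relation. -/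
noncomputable def encodeRel {n : ℕ} (r : Fin n → Fin n → Prop) : Data :=
  Data.ofList ((List.finRange n).map fun i =>
    Data.ofList ((List.finRange n).map fun j => Data.ofBool (decide (r i j))))

open Classical in
/-- The same-cluster oracle of `C`; points are given by their numbers. -/
noncomputable def sameClusterOracle {n : ℕ} (C : Setoid (Fin n)) (a b : Data) : Bool :=
  decide (∃ i j : Fin n, a = Data.ofNat i ∧ b = Data.ofNat j ∧ C i j)

/-- On the graph `G` and with the same-cluster oracle of `C`, the algorithm `A` halts with output
`b` after `t` steps and `q` same-cluster queries. -/
def RunsOn (A : Cmd) {n : ℕ} (G : SimpleGraph (Fin n)) (C : Setoid (Fin n))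
    (b : Data) (t q : ℕ) : Prop :=
  Runs (sameClusterOracle C) A (encodeRel G.Adj) b t q

/-- `A` solves promise correlation clustering: on every input that satisfies the promise it outputs
an optimal clustering. -/
def SolvesPCC (A : Cmd) (M : ℕ) (α β : ℝ) : Prop :=
  ∀ (n : ℕ) (G : SimpleGraph (Fin n)) (C : Setoid (Fin n)), promiseInputs M α β n G C →
    ∃ (C' : Setoid (Fin n)) (t q : ℕ), IsOptimal M G C' ∧
      RunsOn A G C (encodeRel fun x y => C' x y) t q

/-- `A` runs in polynomial time on the inputs in `S`. -/
def RunsInPolyTime (A : Cmd) (S : InputClass) : Prop :=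
  ∃ p : Polynomial ℕ, ∀ (n : ℕ) (G : SimpleGraph (Fin n)) (C : Setoid (Fin n)), S n G C →
    ∃ (b : Data) (t q : ℕ), RunsOn A G C b t q ∧ t ≤ p.eval n

/-- The number of queries that `A` makes on the inputs in `S` with `n` points is, in the worst case,
`Ω(n)`, that is, not `o(n)`: for some `c > 0` there are infinitely many `n` and, for each of them,
an input with `n` points on which `A` makes at least `c n` queries. -/
def MakesLinearlyManyQueries (A : Cmd) (S : InputClass) : Prop :=
  ∃ c : ℝ, 0 < c ∧ ∃ᶠ n : ℕ in atTop,
    ∃ (G : SimpleGraph (Fin n)) (C : Setoid (Fin n)), S n G C ∧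
      ∃ (b : Data) (t q : ℕ), RunsOn A G C b t q ∧ c * (n : ℝ) ≤ (q : ℝ)

end PCC

namespace PCC

/-! ### Executions -/

/-! An algorithm `A` for PCC becomes an algorithm for 3-SAT once its oracle is replaced by
exhaustive search over the answers: `q` queries have `2 ^ q` strings of answers, and a formula with
`m` clauses is turned into a graph with `210 M m` vertices. Sublinearly many queries would thus
contradict the hypothesis on 3-SAT.

The graph varies the reduction of 3-SAT to three-dimensional matching. It is `M`-partite, the parts
being the ranks, so a clique with `M` points has one point of each rank. An occurrence `k` of a
literal has two tips in rank 0. Its variable group takes either tip 0 with the partner of `k`, or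
tip 1 with the partner of the next occurrence of the same variable. Around the cycle of these
occurrences all choices agree (`same_iff_of_var_eq`), and the tip left free tells the truth value.
The three free tips of a clause go to its three clause groups, the first of which accepts only the
tip of a true literal. The ranks from 2 on are copies of the groups. Partitions into `M`-cliques
("perfect" ones) therefore exist for satisfiable formulas, and each of them yields a satisfying
assignment (`exists_isPerfect`, `accepts_of_isPerfect`). If there is a perfect partition, then the
optimal clusterings are exactly the perfect ones (`IsPerfect.isOptimal`, `IsPerfect.of_isOptimal`).
Padding by 68 separate `M`-cliques for each occurrence makes at least half of the edges lie inside
clusters, as `β = 1/2` demands (`ncard_edges`).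

The search proceeds in rounds. In round `i` every string of `i` bits is used as the oracle's answers
in a clocked simulation of `A` (`exists_simulation`), and the assignment read off from the output is
tested on the formula. Acceptance is thus never wrong, and for a satisfiable formula the string of
the true answers is accepted when its round comes. The search continues while some string is too
short for `A` although the answers used are consistent with a clustering in the class
(`consistent_iff`).

In part 1 such a clustering is a legitimate oracle, and with it `A` really makes more queries than
the string has bits. The number of rounds is at most one more than the largest number of queries,
and the program need not know that number. In part 2 nothing is known off the promise, so the rounds
must be cut off at a computable bound. The cutoff is `m / d` plus a constant, where `d` depends on
the rate in the hypothesis. -/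

/-- Executions are deterministic. -/
theorem Exec.det {O : Data → Data → Bool} {c : Cmd} {s s₁ : Store} {t q : ℕ}
    (h : Exec O c s s₁ t q) :
    ∀ {s₂ : Store} {t' q' : ℕ}, Exec O c s s₂ t' q' → s₁ = s₂ ∧ t = t' ∧ q = q' := by
  induction h with
  | assign x e s => intro _ _ _ h'; cases h'; simp
  | query x e f s => intro _ _ _ h'; cases h'; simp
  | seq _ _ ih₁ ih₂ =>
    intro _ _ _ h'
    cases h' with
    | seq h₁ h₂ =>
      obtain ⟨rfl, rfl, rfl⟩ := ih₁ h₁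
      obtain ⟨rfl, rfl, rfl⟩ := ih₂ h₂
      simp
  | branch_true he _ ih =>
    intro _ _ _ h'
    cases h' with
    | branch_true _ h₁ => obtain ⟨rfl, rfl, rfl⟩ := ih h₁; simp
    | branch_false he' _ => exact absurd he' he
  | branch_false he _ ih =>
    intro _ _ _ h'
    cases h' with
    | branch_true he' _ => exact absurd he he'
    | branch_false _ h₁ => obtain ⟨rfl, rfl, rfl⟩ := ih h₁; simp
  | loop_done he =>
    intro _ _ _ h'
    cases h' with
    | loop_done _ => simp
    | loop_step he' _ _ => exact absurd he he'
  | loop_step he _ _ ih₁ ih₂ =>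
    intro _ _ _ h'
    cases h' with
    | loop_done he' => exact absurd he' he
    | loop_step _ h₁ h₂ =>
      obtain ⟨rfl, rfl, rfl⟩ := ih₁ h₁
      obtain ⟨rfl, rfl, rfl⟩ := ih₂ h₂
      simp

theorem Exec.queries_le {O : Data → Data → Bool} {c : Cmd} {s s₁ : Store} {t q : ℕ}
    (h : Exec O c s s₁ t q) : q ≤ t := by
  induction h <;> omega

/-- Renaming of variables by a shift. -/
def Expr.shift (d : ℕ) : Expr → Expr
  | .nil => .nil
  | .var x => .var (x + d)
  | .cons e f => .cons (e.shift d) (f.shift d)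
  | .hd e => .hd (e.shift d)
  | .tl e => .tl (e.shift d)

/-- Renaming of variables by a shift. -/
def Cmd.shift (d : ℕ) : Cmd → Cmd
  | .assign x e => .assign (x + d) (e.shift d)
  | .query x e f => .query (x + d) (e.shift d) (f.shift d)
  | .seq c c' => .seq (c.shift d) (c'.shift d)
  | .branch e c c' => .branch (e.shift d) (c.shift d) (c'.shift d)
  | .loop e c => .loop (e.shift d) (c.shift d)

theorem Expr.eval_shift (d : ℕ) (r s : Store) (h : ∀ x, r (x + d) = s x) (e : Expr) :
    (e.shift d).eval r = e.eval s := by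
  induction e <;> simp_all [Expr.shift, Expr.eval]

/-- This makes subroutines possible: a shifted program never touches the variables below `d`, where
the caller keeps its own values. -/
theorem Exec.shift {O : Data → Data → Bool} {c : Cmd} {s s' : Store} {t q : ℕ}
    (h : Exec O c s s' t q) (d : ℕ) :
    ∀ r : Store, (∀ x, r (x + d) = s x) → ∃ r', Exec O (c.shift d) r r' t q ∧
      (∀ x, r' (x + d) = s' x) ∧ ∀ x < d, r' x = r x := by
  induction h with
  | assign x e s =>
    intro r hr
    refine ⟨_, .assign _ _ _, fun y => ?_, fun y hy => ?_⟩
    · simp [Function.update_apply, Expr.eval_shift d r s hr, hr]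
    · rw [Function.update_of_ne (by omega)]
  | query x e f s =>
    intro r hr
    refine ⟨_, .query _ _ _ _, fun y => ?_, fun y hy => ?_⟩
    · simp [Function.update_apply, Expr.eval_shift d r s hr, hr]
    · rw [Function.update_of_ne (by omega)]
  | seq _ _ ih₁ ih₂ =>
    intro r hr
    obtain ⟨r₁, h₁, e₁, f₁⟩ := ih₁ r hr
    obtain ⟨r₂, h₂, e₂, f₂⟩ := ih₂ r₁ e₁
    exact ⟨r₂, .seq h₁ h₂, e₂, fun x hx => (f₂ x hx).trans (f₁ x hx)⟩
  | branch_true he _ ih =>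
    intro r hr
    obtain ⟨r₁, h₁, e₁, f₁⟩ := ih r hr
    exact ⟨r₁, .branch_true (by rwa [Expr.eval_shift d r _ hr]) h₁, e₁, f₁⟩
  | branch_false he _ ih =>
    intro r hr
    obtain ⟨r₁, h₁, e₁, f₁⟩ := ih r hr
    exact ⟨r₁, .branch_false (by rwa [Expr.eval_shift d r _ hr]) h₁, e₁, f₁⟩
  | loop_done he =>
    intro r hr
    exact ⟨r, .loop_done (by rwa [Expr.eval_shift d r _ hr]), hr, fun _ _ => rfl⟩
  | loop_step he _ _ ih₁ ih₂ =>
    intro r hr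
    obtain ⟨r₁, h₁, e₁, f₁⟩ := ih₁ r hr
    obtain ⟨r₂, h₂, e₂, f₂⟩ := ih₂ r₁ e₁
    exact ⟨r₂, .loop_step (by rwa [Expr.eval_shift d r _ hr]) h₁ h₂, e₂,
      fun x hx => (f₂ x hx).trans (f₁ x hx)⟩

/-! ### Total correctness rules with time bounds -/

/-- The oracle that is not used. -/
abbrev noOracle : Data → Data → Bool := fun _ _ => false

/-- Without queries, `c` started in `s` halts after at most `T` steps in a store satisfying `P`. -/
def RunsTo (c : Cmd) (s : Store) (P : Store → Prop) (T : ℕ) : Prop :=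
  ∃ s' t, Exec noOracle c s s' t 0 ∧ P s' ∧ t ≤ T

namespace RunsTo

variable {c d : Cmd} {s : Store} {P Q : Store → Prop} {T U : ℕ}

theorem mono (h : RunsTo c s P T) (hP : ∀ s', P s' → Q s') (hT : T ≤ U) : RunsTo c s Q U := by
  obtain ⟨s', t, h, hp, ht⟩ := h
  exact ⟨s', t, h, hP _ hp, ht.trans hT⟩

theorem assign {x : ℕ} {e : Expr} (h : P (Function.update s x (e.eval s))) :
    RunsTo (.assign x e) s P 1 := ⟨_, _, .assign _ _ _, h, le_rfl⟩

theorem seq (h : RunsTo c s Q T) (h' : ∀ s', Q s' → RunsTo d s' P U) :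
    RunsTo (.seq c d) s P (T + U) := by
  obtain ⟨s₁, t, h, hp, ht⟩ := h
  obtain ⟨s₂, t', h', hp', ht'⟩ := h' _ hp
  exact ⟨s₂, _, .seq h h', hp', by omega⟩

theorem assign_seq {x : ℕ} {e : Expr} (h : RunsTo d (Function.update s x (e.eval s)) P U) :
    RunsTo (.seq (.assign x e) d) s P (1 + U) :=
  seq (Q := (· = Function.update s x (e.eval s))) (assign rfl) (by rintro _ rfl; exact h)

theorem branch_true {e : Expr} (he : e.eval s ≠ .nil) (h : RunsTo c s P T) :
    RunsTo (.branch e c d) s P (T + 1) := by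
  obtain ⟨s₁, t, h, hp, ht⟩ := h
  exact ⟨s₁, _, .branch_true he h, hp, by omega⟩

theorem branch_false {e : Expr} (he : e.eval s = .nil) (h : RunsTo d s P T) :
    RunsTo (.branch e c d) s P (T + 1) := by
  obtain ⟨s₁, t, h, hp, ht⟩ := h
  exact ⟨s₁, _, .branch_false he h, hp, by omega⟩

theorem loop_done {e : Expr} (he : e.eval s = .nil) (h : P s) :
    RunsTo (.loop e c) s P 1 := ⟨s, _, .loop_done he, h, le_rfl⟩

theorem loop_step {e : Expr} (he : e.eval s ≠ .nil) (h : RunsTo c s Q T)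
    (h' : ∀ s', Q s' → RunsTo (.loop e c) s' P U) : RunsTo (.loop e c) s P (T + U + 1) := by
  obtain ⟨s₁, t, h, hp, ht⟩ := h
  obtain ⟨s₂, t', h', hp', ht'⟩ := h' _ hp
  exact ⟨s₂, _, .loop_step he h h', hp', by omega⟩

end RunsTo

/-! ### Polynomial bounds -/

/-- `T` is bounded by a polynomial in `μ`. -/
def PolyBd {ι : Type*} (μ T : ι → ℕ) : Prop := ∃ k, ∀ a, T a ≤ (μ a + 2) ^ k

namespace PolyBd

variable {ι κ : Type*} {μ T U : ι → ℕ}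

theorem mono (h : PolyBd μ U) (hT : ∀ a, T a ≤ U a) : PolyBd μ T := by
  obtain ⟨k, h⟩ := h
  exact ⟨k, fun a => (hT a).trans (h a)⟩

/-- The base `μ a + 2` is at least 2 even where `μ` vanishes, so a large exponent absorbs any
constant. -/
theorem const (n : ℕ) : PolyBd μ (fun _ => n) :=
  ⟨n, fun a => (Nat.lt_pow_self (by omega)).le⟩

theorem self : PolyBd μ μ := ⟨1, fun a => by simp⟩

theorem add (h : PolyBd μ T) (h' : PolyBd μ U) : PolyBd μ (fun a => T a + U a) := by
  obtain ⟨k, h⟩ := h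
  obtain ⟨l, h'⟩ := h'
  refine ⟨max k l + 1, fun a => ?_⟩
  have h₁ := (h a).trans (Nat.pow_le_pow_right (by omega) (le_max_left k l))
  have h₂ := (h' a).trans (Nat.pow_le_pow_right (by omega) (le_max_right k l))
  rw [pow_succ]
  nlinarith [Nat.zero_le ((μ a + 2) ^ max k l * μ a)]

theorem mul (h : PolyBd μ T) (h' : PolyBd μ U) : PolyBd μ (fun a => T a * U a) := by
  obtain ⟨k, h⟩ := h
  obtain ⟨l, h'⟩ := h'
  exact ⟨k + l, fun a => by rw [pow_add]; exact Nat.mul_le_mul (h a) (h' a)⟩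

theorem pow (h : PolyBd μ T) (n : ℕ) : PolyBd μ (fun a => T a ^ n) := by
  obtain ⟨k, h⟩ := h
  exact ⟨k * n, fun a => by rw [pow_mul]; exact Nat.pow_le_pow_left (h a) n⟩

theorem comp {ν V : κ → ℕ} (f : ι → κ) (hV : PolyBd ν V) (hf : PolyBd μ (fun a => ν (f a))) :
    PolyBd μ (fun a => V (f a)) := by
  obtain ⟨k, hV⟩ := hV
  exact ((hf.add (const 2)).pow k).mono fun a => hV (f a)

end PolyBd

/-! ### Polynomial-time functions -/

/-- Types whose elements are represented by data, with a size. -/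
class Enc (α : Type) where
  enc : α → Data
  sz : α → ℕ

open Enc

/-- Data whose size is disregarded. -/
structure Opaque where
  val : Data

instance : Enc Opaque := ⟨Opaque.val, fun _ => 0⟩
instance : Enc Unit := ⟨fun _ => .nil, fun _ => 0⟩
instance : Enc ℕ := ⟨Data.ofNat, fun n => n⟩
instance : Enc Bool := ⟨Data.ofBool, fun _ => 0⟩
instance {α β : Type} [Enc α] [Enc β] : Enc (α × β) :=
  ⟨fun p => .cons (enc p.1) (enc p.2), fun p => sz p.1 + sz p.2 + 1⟩
instance {α : Type} [Enc α] : Enc (List α) :=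
  ⟨fun l => Data.ofList (l.map enc), fun l => (l.map fun x => sz x + 1).sum⟩

section

variable {α β γ δ : Type} [Enc α] [Enc β] [Enc γ] [Enc δ]

theorem enc_opaque (x : Opaque) : enc x = x.val := rfl
theorem enc_nat (n : ℕ) : enc n = Data.ofNat n := rfl
theorem enc_bool (b : Bool) : enc b = Data.ofBool b := rfl
theorem enc_pair (p : α × β) : enc p = .cons (enc p.1) (enc p.2) := rfl
theorem enc_nil : enc ([] : List α) = .nil := rfl
theorem enc_cons (a : α) (l : List α) : enc (a :: l) = .cons (enc a) (enc l) := rfl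

theorem sz_nat (n : ℕ) : sz n = n := rfl
theorem sz_bool (b : Bool) : sz b = 0 := rfl
theorem sz_pair (p : α × β) : sz p = sz p.1 + sz p.2 + 1 := rfl
theorem sz_nil : sz ([] : List α) = 0 := rfl
theorem sz_cons (a : α) (l : List α) : sz (a :: l) = sz a + 1 + sz l := by simp [sz]
theorem sz_append (l l' : List α) : sz (l ++ l') = sz l + sz l' := by simp [sz]
theorem sz_reverse (l : List α) : sz l.reverse = sz l := by simp [sz, List.sum_reverse]
theorem length_le_sz (l : List α) : l.length ≤ sz l := by
  induction l with
  | nil => simp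
  | cons a l ih => simp only [List.length_cons, sz_cons]; omega
theorem sz_le_of_mem {x : α} {l : List α} (h : x ∈ l) : sz x ≤ sz l := by
  induction l with
  | nil => simp at h
  | cons a l ih =>
    rw [sz_cons]
    rcases List.mem_cons.1 h with rfl | h
    · omega
    · have := ih h; omega
theorem sz_list_le (l : List α) (B : ℕ) (h : ∀ x ∈ l, sz x ≤ B) : sz l ≤ l.length * (B + 1) := by
  induction l with
  | nil => simp [sz_nil]
  | cons a l ih =>
    have h₁ := h a (by simp)
    have h₂ := ih fun x hx => h x (by simp [hx])
    rw [sz_cons, List.length_cons]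
    nlinarith

/-- Functions computed without queries in polynomial time, by programs that do not rely on the
initial values of the auxiliary variables, and with values of polynomial size. -/
@[fun_prop]
def PT (f : α → β) : Prop := ∃ (c : Cmd) (T : α → ℕ),
  (∀ a s, s 0 = enc a → RunsTo c s (fun s' => s' 0 = enc (f a)) (T a)) ∧
    PolyBd sz T ∧ PolyBd sz (fun a => sz (f a))

/-- A program that ignores the initial values of its auxiliary variables becomes a subroutine with
input and output in variable `d`. -/
theorem call {c : Cmd} {T : ℕ} {a b : Data} (h : ∀ s : Store, s 0 = a →
    RunsTo c s (fun s' => s' 0 = b) T) (d : ℕ) (r : Store) (hr : r d = a) :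
    RunsTo (c.shift d) r (fun r' => r' d = b ∧ ∀ x < d, r' x = r x) T := by
  obtain ⟨s', t, h, hp, ht⟩ := h (fun x => r (x + d)) (by simpa using hr)
  obtain ⟨r', h', e, f⟩ := h.shift d r fun _ => rfl
  exact ⟨r', t, h', ⟨by rw [← hp, ← e, Nat.zero_add], f⟩, ht⟩

namespace PT

theorem ofExpr {f : α → β} (e : Expr) (he : ∀ a (s : Store), s 0 = enc a → e.eval s = enc (f a))
    (hf : PolyBd sz (fun a => sz (f a))) : PT f :=
  ⟨.assign 0 e, fun _ => 1, fun a s h => .assign (by simp [he a s h]), .const 1, hf⟩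

@[fun_prop]
theorem id : PT (fun a : α => a) := ofExpr (.var 0) (fun _ _ h => h) .self

-- The running time of `g` is measured in the size of `f a`; the size bound that is part of `PT`
-- turns this into a bound in the size of `a`.
@[fun_prop]
theorem comp {g : β → γ} {f : α → β} (hg : PT g) (hf : PT f) : PT (fun a => g (f a)) := by
  obtain ⟨c, T, h, hT, hS⟩ := hf
  obtain ⟨d, U, h', hU, hS'⟩ := hg
  exact ⟨.seq c d, fun a => T a + U (f a), fun a s hs => (h a s hs).seq fun s' hs' => h' _ s' hs',
    hT.add (hU.comp f hS), hS'.comp f hS⟩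

/-- A closed expression for given data. -/
def _root_.PCC.Data.toExpr : Data → Expr
  | .nil => .nil
  | .cons a b => .cons a.toExpr b.toExpr

theorem _root_.PCC.Data.eval_toExpr (a : Data) (s : Store) : a.toExpr.eval s = a := by
  induction a <;> simp_all [Data.toExpr, Expr.eval]

@[fun_prop]
theorem const (b : β) : PT (fun _ : α => b) :=
  ofExpr (enc b).toExpr (fun _ _ _ => Data.eval_toExpr _ _) (.const _)

@[fun_prop]
theorem pair {f : α → β} {g : α → γ} (hf : PT f) (hg : PT g) : PT (fun a => (f a, g a)) := by
  obtain ⟨c, T, h, hT, hS⟩ := hf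
  obtain ⟨d, U, h', hU, hS'⟩ := hg
  refine ⟨.seq (.assign 1 (.var 0)) (.seq (c.shift 1) (.seq (.assign 2 (.var 0))
    (.seq (d.shift 2) (.assign 0 (.cons (.var 1) (.var 2)))))),
    fun a => 1 + (T a + (1 + (U a + 1))), fun a s hs => ?_,
    (PolyBd.const 1).add (hT.add ((PolyBd.const 1).add (hU.add (.const 1)))),
    (hS.add hS').add (.const 1)⟩
  refine .assign_seq (.seq (call (h a) 1 _ (by simpa [Expr.eval] using hs)) ?_)
  rintro s₁ ⟨h₁, e₁⟩
  have e₁' : s₁ 0 = enc a := by rw [e₁ 0 (by omega)]; simpa using hs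
  refine .assign_seq (.seq (call (h' a) 2 _ (by simpa [Expr.eval] using e₁')) ?_)
  rintro s₂ ⟨h₂, e₂⟩
  refine .assign ?_
  have : s₂ 1 = s₁ 1 := by rw [e₂ 1 (by omega)]; simp
  simp [Expr.eval, h₂, this, h₁, enc_pair]

@[fun_prop]
theorem fst : PT (fun p : α × β => p.1) :=
  ofExpr (.hd (.var 0)) (fun a s h => by simp [Expr.eval, h, enc_pair, Data.hd])
    (PolyBd.self.mono fun a => by rw [sz_pair]; omega)

@[fun_prop]
theorem snd : PT (fun p : α × β => p.2) :=
  ofExpr (.tl (.var 0)) (fun a s h => by simp [Expr.eval, h, enc_pair, Data.tl])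
    (PolyBd.self.mono fun a => by rw [sz_pair]; omega)

theorem _root_.PCC.ofBool_ne_nil (b : Bool) : Data.ofBool b ≠ .nil ↔ b = true := by
  cases b <;> simp [Data.ofBool]

@[fun_prop]
theorem cond {b : α → Bool} {f g : α → β} (hb : PT b) (hf : PT f) (hg : PT g) :
    PT (fun a => bif b a then f a else g a) := by
  obtain ⟨c, T, h, hT, -⟩ := hb
  obtain ⟨c₁, T₁, h₁, hT₁, hS₁⟩ := hf
  obtain ⟨c₂, T₂, h₂, hT₂, hS₂⟩ := hg
  refine ⟨.seq (.assign 1 (.var 0)) (.seq (c.shift 1) (.branch (.var 1) c₁ c₂)),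
    fun a => 1 + (T a + (T₁ a + T₂ a + 1)), fun a s hs => ?_,
    (PolyBd.const 1).add (hT.add ((hT₁.add hT₂).add (.const 1))),
    (hS₁.add hS₂).mono fun a => by dsimp only; cases b a <;> simp⟩
  refine .assign_seq (.seq (call (h a) 1 _ (by simpa [Expr.eval] using hs)) ?_)
  rintro s₁ ⟨e₁, e₀⟩
  have e₀' : s₁ 0 = enc a := by rw [e₀ 0 (by omega)]; simpa using hs
  cases hb : b a
  · refine (RunsTo.branch_false ?_ (h₂ a s₁ e₀')).mono (fun s' h => by simpa [hb] using h)
      (by omega)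
    simp [Expr.eval, e₁, hb, enc_bool, Data.ofBool]
  · refine (RunsTo.branch_true ?_ (h₁ a s₁ e₀')).mono (fun s' h => by simpa [hb] using h)
      (by omega)
    simp [Expr.eval, e₁, hb, enc_bool, Data.ofBool]

theorem polyBd {f : α → β} (hf : PT f) : PolyBd sz (fun a => sz (f a)) := by
  obtain ⟨_, _, _, _, h⟩ := hf; exact h

/-- Folds with values of polynomial size. -/
theorem foldl_of_bound {f : α → β → γ → β} {i : α → β} {l : α → List γ}
    (hf : PT (fun p : α × β × γ => f p.1 p.2.1 p.2.2)) (hi : PT i) (hl : PT l) (B : α → ℕ)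
    (hB : PolyBd sz B) (h : ∀ a l', l' <+: l a → sz (l'.foldl (f a) (i a)) ≤ B a) :
    PT (fun a => (l a).foldl (f a) (i a)) := by
  obtain ⟨c, T, hc, hT, -⟩ := hf
  obtain ⟨ci, Ti, hci, hTi, hSi⟩ := hi
  obtain ⟨cl, Tl, hcl, hTl, hSl⟩ := hl
  obtain ⟨k, hk⟩ := hT
  -- `D a` bounds one pass of the loop: the call of `c` on the triple of the parameter, the
  -- accumulated value and a list element, then three assignments and the test of the guard.
  let D : α → ℕ := fun a => (sz a + (B a + sz (l a) + 1) + 1 + 2) ^ k + 4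
  have hD : PolyBd sz D :=
    (((((PolyBd.self.add ((hB.add hSl).add (.const 1))).add (.const 1)).add (.const 2)).pow k).add
      (.const 4))
  refine ⟨.seq (.assign 1 (.var 0)) (.seq (cl.shift 1) (.seq (.assign 2 (.var 0))
    (.seq (ci.shift 2) (.seq (.loop (.var 1)
      (.seq (.assign 3 (.cons (.var 0) (.cons (.var 2) (.hd (.var 1)))))
        (.seq (c.shift 3) (.seq (.assign 2 (.var 3)) (.assign 1 (.tl (.var 1)))))))
      (.assign 0 (.var 2)))))),
    fun a => 1 + (Tl a + (1 + (Ti a + (sz (l a) * D a + 1 + 1)))), fun a s hs => ?_,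
    (PolyBd.const 1).add (hTl.add ((PolyBd.const 1).add
      (hTi.add (((hSl.mul hD).add (.const 1)).add (.const 1))))),
    hB.mono fun a => h a _ List.prefix_rfl⟩
  refine .assign_seq (.seq (call (hcl a) 1 _ (by simpa [Expr.eval] using hs)) ?_)
  rintro s₁ ⟨h₁, e₁⟩
  have e₁' : s₁ 0 = enc a := by rw [e₁ 0 (by omega)]; simpa using hs
  refine .assign_seq (.seq (call (hci a) 2 _ (by simpa [Expr.eval] using e₁')) ?_)
  rintro s₂ ⟨h₂, e₂⟩
  have e₂' : s₂ 0 = enc a := by rw [e₂ 0 (by omega)]; simpa using e₁'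
  have e₂'' : s₂ 1 = enc (l a) := by rw [e₂ 1 (by omega)]; simpa using h₁
  -- Loop invariant: variable 1 holds the unprocessed rest of the list, variable 2 the fold over the
  -- processed prefix.
  have key : ∀ (rest pre : List γ), pre ++ rest = l a → ∀ r : Store, r 0 = enc a →
      r 1 = enc rest → r 2 = enc (pre.foldl (f a) (i a)) →
      RunsTo (.loop (.var 1)
      (.seq (.assign 3 (.cons (.var 0) (.cons (.var 2) (.hd (.var 1)))))
        (.seq (c.shift 3) (.seq (.assign 2 (.var 3)) (.assign 1 (.tl (.var 1))))))) r
        (fun r' => r' 2 = enc ((l a).foldl (f a) (i a))) (rest.length * D a + 1) := by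
    intro rest
    induction rest with
    | nil =>
      intro pre hp r r0 r1 r2
      refine (RunsTo.loop_done (by simp [Expr.eval, r1, enc_nil]) ?_).mono (fun _ h => h) (by simp)
      rw [r2, ← hp, List.append_nil]
    | cons x rest ih =>
      intro pre hp r r0 r1 r2
      have hx : sz x ≤ sz (l a) := sz_le_of_mem (by rw [← hp]; simp)
      have hpre := h a pre ⟨_, hp⟩
      have htime : T (a, pre.foldl (f a) (i a), x) + 4 ≤ D a := by
        refine Nat.add_le_add_right ((hk _).trans (Nat.pow_le_pow_left ?_ k)) 4
        simp only [sz_pair]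
        omega
      refine (RunsTo.loop_step (by simp [Expr.eval, r1, enc_cons])
        (Q := fun r' => r' 0 = enc a ∧ r' 1 = enc rest ∧
          r' 2 = enc ((pre ++ [x]).foldl (f a) (i a)))
        (T := 1 + (T (a, pre.foldl (f a) (i a), x) + (1 + 1)))
        (.assign_seq (.seq (call (hc (a, pre.foldl (f a) (i a), x)) 3 _ ?_) ?_))
        (U := rest.length * D a + 1) ?_).mono
        (fun _ h => h) ?_ (U := (x :: rest).length * D a + 1)
      · simp [Expr.eval, r0, r1, r2, enc_pair, enc_cons, Data.hd]
      · rintro r₁ ⟨g₁, g₂⟩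
        have g0 : r₁ 0 = r 0 := by rw [g₂ 0 (by omega)]; simp
        have g1 : r₁ 1 = r 1 := by rw [g₂ 1 (by omega)]; simp
        refine .assign_seq (.assign ?_)
        simp [Expr.eval, g0, g1, r0, r1, g₁, enc_cons, Data.tl]
      · rintro r' ⟨q0, q1, q2⟩
        exact ih (pre ++ [x]) (by simpa using hp) r' q0 q1 q2
      · rw [List.length_cons, Nat.succ_mul]
        omega
  refine ((key (l a) [] rfl s₂ e₂' e₂'' (by simpa using h₂)).seq (U := 1) fun s₃ h₃ =>
    .assign (by simpa [Expr.eval] using h₃)).mono (fun _ h => h) ?_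
  have := Nat.mul_le_mul_right (D a) (length_le_sz (l a))
  omega

/-- Folds in which every step adds a polynomial amount to the size. -/
theorem foldl {f : α → β → γ → β} {i : α → β} {l : α → List γ}
    (hf : PT (fun p : α × β × γ => f p.1 p.2.1 p.2.2)) (hi : PT i) (hl : PT l)
    (U : α × γ → ℕ) (hU : PolyBd sz U) (hfU : ∀ a b c, sz (f a b c) ≤ sz b + U (a, c)) :
    PT (fun a => (l a).foldl (f a) (i a)) := by
  obtain ⟨k, hU⟩ := hU
  have h : ∀ a b c, sz (f a b c) ≤ sz b + (sz a + sz c + 3) ^ k := fun a b c =>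
    (hfU a b c).trans (Nat.add_le_add_left (hU (a, c)) _)
  have hSi : PolyBd sz (fun a => sz (i a)) := by obtain ⟨_, _, _, _, h⟩ := hi; exact h
  have hSl : PolyBd sz (fun a => sz (l a)) := by obtain ⟨_, _, _, _, h⟩ := hl; exact h
  refine foldl_of_bound hf hi hl (fun a => sz (i a) + sz (l a) * (sz a + sz (l a) + 3) ^ k)
    (hSi.add (hSl.mul (((PolyBd.self.add hSl).add (.const 3)).pow k))) fun a l' hl' => ?_
  have key : ∀ l' : List γ, (∀ x ∈ l', sz x ≤ sz (l a)) → ∀ b, sz (l'.foldl (f a) b) ≤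
      sz b + l'.length * (sz a + sz (l a) + 3) ^ k := by
    intro l'
    induction l' with
    | nil => simp
    | cons x l' ih =>
      intro hx b
      rw [List.foldl_cons, List.length_cons, Nat.succ_mul]
      have h₁ := ih (fun y hy => hx y (by simp [hy])) (f a b x)
      have h₂ := h a b x
      have h₃ : (sz a + sz x + 3) ^ k ≤ (sz a + sz (l a) + 3) ^ k :=
        Nat.pow_le_pow_left (by have := hx x (by simp); omega) k
      omega
  refine (key l' (fun x hx => sz_le_of_mem (hl'.subset hx)) _).trans ?_
  have := Nat.mul_le_mul_right ((sz a + sz (l a) + 3) ^ k)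
    (hl'.length_le.trans (length_le_sz (l a)))
  omega

end PT

end

section

variable {α β γ δ : Type} [Enc α] [Enc β] [Enc γ] [Enc δ]

namespace PT

/-! ### Booleans -/

@[fun_prop]
theorem and {f g : α → Bool} (hf : PT f) (hg : PT g) : PT (fun a => f a && g a) := by
  have h : PT (fun a => bif f a then g a else false) := by fun_prop
  convert h using 2 with a
  cases f a <;> simp

@[fun_prop]
theorem or {f g : α → Bool} (hf : PT f) (hg : PT g) : PT (fun a => f a || g a) := by
  have h : PT (fun a => bif f a then true else g a) := by fun_prop
  convert h using 2 with a
  cases f a <;> simp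

@[fun_prop]
theorem not {f : α → Bool} (hf : PT f) : PT (fun a => !(f a)) := by
  have h : PT (fun a => bif f a then false else true) := by fun_prop
  convert h using 2 with a
  cases f a <;> simp

@[fun_prop]
theorem beq_bool {f g : α → Bool} (hf : PT f) (hg : PT g) : PT (fun a => f a == g a) := by
  have h : PT (fun a => bif f a then g a else !(g a)) := by fun_prop
  convert h using 2 with a
  cases f a <;> cases g a <;> rfl

/-! ### Lists -/

@[fun_prop]
theorem cons {f : α → β} {g : α → List β} (hf : PT f) (hg : PT g) : PT (fun a => f a :: g a) := by
  have h : PT (fun p : β × List β => p.1 :: p.2) :=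
    ofExpr (.var 0) (fun _ _ h => h) (PolyBd.self.mono fun a => by
      rw [sz_cons, sz_pair]; omega)
  exact h.comp (hf.pair hg)

@[fun_prop]
theorem tail {f : α → List β} (hf : PT f) : PT (fun a => (f a).tail) := by
  have h : PT (fun l : List β => l.tail) :=
    ofExpr (.tl (.var 0)) (fun l s h => by
      cases l <;> simp [Expr.eval, h, enc_nil, enc_cons, Data.tl])
      (PolyBd.self.mono fun l => by
        cases l
        · simp
        · rw [sz_cons, List.tail_cons]; omega)
  exact h.comp hf

/-- On the empty list `hd` returns `nil`, which is the default only if the default is encoded by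
`nil`. -/
theorem headD {f : α → List β} (d : β) (hd : enc d = .nil) (hf : PT f) :
    PT (fun a => (f a).headD d) := by
  have h : PT (fun l : List β => l.headD d) :=
    ofExpr (.hd (.var 0)) (fun l s h => by
      cases l <;> simp [Expr.eval, h, enc_nil, enc_cons, Data.hd, hd])
      ((PolyBd.self.add (.const (sz d))).mono fun l => by
        cases l
        · simp
        · rw [sz_cons, List.headD_cons]; omega)
  exact h.comp hf

@[fun_prop]
theorem reverse {f : α → List β} (hf : PT f) : PT (fun a => (f a).reverse) := by
  have h : PT (fun l : List β => l.foldl (fun acc x => x :: acc) []) :=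
    foldl (f := fun _ acc x => x :: acc) (by fun_prop) (by fun_prop) (by fun_prop)
      _ (PolyBd.self.add (.const 1)) fun a b c => by rw [sz_cons, sz_pair]; dsimp only; omega
  have e : (fun l : List β => l.reverse) = fun l => l.foldl (fun acc x => x :: acc) [] := by
    funext l; simp
  exact comp (g := fun l : List β => l.reverse) (e ▸ h) hf

@[fun_prop]
theorem append {f g : α → List β} (hf : PT f) (hg : PT g) : PT (fun a => f a ++ g a) := by
  have h : PT (fun p : List β × List β => p.1.reverse.foldl (fun acc x => x :: acc) p.2) :=
    foldl (f := fun _ acc x => x :: acc) (by fun_prop) (by fun_prop) (by fun_prop)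
      _ (PolyBd.self.add (.const 1)) fun a b c => by rw [sz_cons, sz_pair]; dsimp only; omega
  have e : (fun p : List β × List β => p.1 ++ p.2) =
      fun p => p.1.reverse.foldl (fun acc x => x :: acc) p.2 := by
    funext p; simp
  exact comp (g := fun p : List β × List β => p.1 ++ p.2) (e ▸ h) (hf.pair hg)

@[fun_prop]
theorem map {f : α → β → γ} {l : α → List β} (hf : PT (fun p : α × β => f p.1 p.2)) (hl : PT l) :
    PT (fun a => (l a).map (f a)) := by
  have h : PT (fun a => ((l a).foldl (fun acc x => f a x :: acc) []).reverse) := by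
    refine reverse (foldl (f := fun a acc x => f a x :: acc) ?_ (by fun_prop) hl
      _ (hf.polyBd.add (.const 1)) fun a b c => by rw [sz_cons]; dsimp only; omega)
    exact cons (hf.comp (f := fun p : α × List γ × β => (p.1, p.2.2)) (by fun_prop)) (by fun_prop)
  convert h using 2 with a
  suffices ∀ acc, (l a).foldl (fun acc x => f a x :: acc) acc = ((l a).map (f a)).reverse ++ acc by
    simp [this]
  generalize l a = l
  induction l with
  | nil => simp
  | cons x l ih => intro acc; simp [ih]

@[fun_prop]
theorem flatMap {f : α → β → List γ} {l : α → List β} (hf : PT (fun p : α × β => f p.1 p.2))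
    (hl : PT l) : PT (fun a => (l a).flatMap (f a)) := by
  have h : PT (fun a => (l a).foldl (fun acc x => acc ++ f a x) []) := by
    refine foldl (f := fun a acc x => acc ++ f a x) ?_ (by fun_prop) hl
      _ hf.polyBd fun a b c => by rw [sz_append]
    exact append (by fun_prop) (hf.comp (f := fun p : α × List γ × β => (p.1, p.2.2)) (by fun_prop))
  convert h using 2 with a
  simp [List.flatMap_eq_foldl]

@[fun_prop]
theorem any {f : α → β → Bool} {l : α → List β} (hf : PT (fun p : α × β => f p.1 p.2))
    (hl : PT l) : PT (fun a => (l a).any (f a)) := by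
  have h : PT (fun a => (l a).foldl (fun acc x => acc || f a x) false) := by
    refine foldl (f := fun a acc x => acc || f a x) ?_ (by fun_prop) hl
      _ (.const 0) fun a b c => by simp [sz_bool]
    exact or (by fun_prop) (hf.comp (f := fun p : α × Bool × β => (p.1, p.2.2)) (by fun_prop))
  convert h using 2 with a
  suffices ∀ b, (b || (l a).any (f a)) = (l a).foldl (fun acc x => acc || f a x) b by
    simpa using this false
  generalize l a = l
  induction l with
  | nil => simp
  | cons x l ih => intro b; rw [List.foldl_cons, ← ih, List.any_cons, Bool.or_assoc]

@[fun_prop]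
theorem all {f : α → β → Bool} {l : α → List β} (hf : PT (fun p : α × β => f p.1 p.2))
    (hl : PT l) : PT (fun a => (l a).all (f a)) := by
  have h : PT (fun a => !((l a).any fun x => !(f a x))) := by fun_prop
  convert h using 2 with a
  simp [List.all_eq_not_any_not]

@[fun_prop]
theorem filter {f : α → β → Bool} {l : α → List β} (hf : PT (fun p : α × β => f p.1 p.2))
    (hl : PT l) : PT (fun a => (l a).filter (f a)) := by
  have h : PT (fun a => (l a).flatMap fun x => bif f a x then [x] else []) := by fun_prop
  convert h using 2 with a
  generalize l a = l
  induction l with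
  | nil => simp
  | cons x l ih => rw [List.filter_cons, List.flatMap_cons, ← ih]; cases f a x <;> simp

/-! ### Natural numbers -/

@[fun_prop]
theorem length {f : α → List β} (hf : PT f) : PT (fun a => (f a).length) := by
  have hs : PT (fun n : ℕ => n + 1) :=
    ofExpr (.cons .nil (.var 0)) (fun n s h => by simp [Expr.eval, h, enc_nat, Data.ofNat])
      (PolyBd.self.add (.const 1))
  have h : PT (fun l : List β => l.foldl (fun n _ => n + 1) 0) :=
    foldl (f := fun _ n _ => n + 1) (hs.comp (by fun_prop)) (by fun_prop) (by fun_prop)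
      _ (.const 1) fun a b c => by simp [sz_nat]
  have e : (fun l : List β => l.length) = fun l => l.foldl (fun n _ => n + 1) 0 := by
    funext l; simp
  exact comp (g := fun l : List β => l.length) (e ▸ h) hf

theorem _root_.PCC.enc_replicate (n : ℕ) : enc (List.replicate n ()) = Data.ofNat n := by
  induction n with
  | zero => rfl
  | succ n ih => rw [List.replicate_succ, enc_cons, ih]; rfl

theorem _root_.PCC.sz_replicate (n : ℕ) : sz (List.replicate n ()) = n := by
  induction n with
  | zero => rfl
  | succ n ih => rw [List.replicate_succ, sz_cons, ih, Nat.add_comm]; rfl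

@[fun_prop]
theorem replicate {f : α → ℕ} (hf : PT f) : PT (fun a => List.replicate (f a) ()) := by
  have h : PT (fun n : ℕ => List.replicate n ()) :=
    ofExpr (.var 0) (fun n s h => by simp [Expr.eval, h, enc_nat, enc_replicate])
      (PolyBd.self.mono fun n => by rw [sz_replicate]; exact le_rfl)
  exact h.comp hf

@[fun_prop]
theorem add {f g : α → ℕ} (hf : PT f) (hg : PT g) : PT (fun a => f a + g a) := by
  have h : PT (fun a => (List.replicate (f a) () ++ List.replicate (g a) ()).length) := by fun_prop
  simpa using h

@[fun_prop]
theorem mul {f g : α → ℕ} (hf : PT f) (hg : PT g) : PT (fun a => f a * g a) := by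
  have h : PT (fun a => ((List.replicate (f a) ()).flatMap
    fun _ => List.replicate (g a) ()).length) := by fun_prop
  simpa using h

@[fun_prop]
theorem pow {f : α → ℕ} (hf : PT f) (n : ℕ) : PT (fun a => f a ^ n) := by
  induction n with
  | zero => simpa using const 1
  | succ n ih => simpa only [pow_succ] using ih.mul hf

/-- The first component is a unary counter in the form of a list of units; the second one collects
its past values. -/
theorem _root_.PCC.foldl_range (L : List Unit) :
    L.foldl (fun (p : List Unit × List ℕ) _ => (() :: p.1, p.1.length :: p.2)) ([], []) =
      (List.replicate L.length (), (List.range L.length).reverse) := by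
  induction L using List.reverseRecOn with
  | nil => rfl
  | append_singleton L x ih =>
    rw [List.foldl_append, ih]
    simp [List.range_succ, List.replicate_succ]

@[fun_prop]
theorem range {f : α → ℕ} (hf : PT f) : PT (fun a => List.range (f a)) := by
  have h : PT (fun n : ℕ => ((List.replicate n ()).foldl
      (fun (p : List Unit × List ℕ) _ => (() :: p.1, p.1.length :: p.2)) ([], [])).2.reverse) := by
    refine reverse (snd.comp (foldl_of_bound
      (f := fun _ (p : List Unit × List ℕ) _ => (() :: p.1, p.1.length :: p.2))
      (by fun_prop) (by fun_prop) (by fun_prop) (fun n => n + n * (n + 1) + 1)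
      ((PolyBd.self.add (PolyBd.self.mul (PolyBd.self.add (.const 1)))).add (.const 1))
      fun n l' hl' => ?_))
    have hn : l'.length ≤ n := by simpa using hl'.length_le
    rw [foldl_range, sz_pair, sz_replicate, sz_reverse]
    have := sz_list_le (List.range l'.length) n fun x hx => by
      have := List.mem_range.1 hx
      rw [sz_nat]
      omega
    rw [List.length_range] at this
    have := Nat.mul_le_mul_right (n + 1) hn
    omega
  have e : (fun n : ℕ => List.range n) = fun n => ((List.replicate n ()).foldl
      (fun (p : List Unit × List ℕ) _ => (() :: p.1, p.1.length :: p.2)) ([], [])).2.reverse := by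
    funext n
    simp [foldl_range]
  exact comp (g := fun n => List.range n) (e ▸ h) hf

@[fun_prop]
theorem sub {f g : α → ℕ} (hf : PT f) (hg : PT g) : PT (fun a => f a - g a) := by
  have h : PT (fun p : ℕ × ℕ => ((List.range p.2).foldl (fun (l : List _) _ => l.tail)
      (List.replicate p.1 ())).length) := by
    refine length (foldl (f := fun _ (l : List _) _ => l.tail) (by fun_prop) (by fun_prop) (by fun_prop)
      _ (.const 0) fun a b c => ?_)
    cases b
    · simp
    · rw [sz_cons, List.tail_cons]; omega
  have e : (fun p : ℕ × ℕ => p.1 - p.2) = fun p => ((List.range p.2).foldl (fun (l : List _) _ => l.tail)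
      (List.replicate p.1 ())).length := by
    funext ⟨m, n⟩
    dsimp only
    induction n with
    | zero => simp
    | succ n ih => rw [List.range_succ, List.foldl_append]; simp [← ih, Nat.sub_sub]
  exact comp (g := fun p : ℕ × ℕ => p.1 - p.2) (e ▸ h) (hf.pair hg)

theorem isEmpty {f : α → List β} (hf : PT f) : PT (fun a => (f a).isEmpty) := by
  have h : PT (fun a => !((f a).any fun _ => true)) := by fun_prop
  convert h using 2 with a
  cases f a <;> simp

@[fun_prop]
theorem decide_le {f g : α → ℕ} (hf : PT f) (hg : PT g) : PT (fun a => decide (f a ≤ g a)) := by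
  have h : PT (fun a => (List.replicate (f a - g a) ()).isEmpty) := isEmpty (by fun_prop)
  convert h using 2 with a
  rw [Bool.eq_iff_iff]
  simp [Nat.sub_eq_zero_iff_le]

@[fun_prop]
theorem decide_lt {f g : α → ℕ} (hf : PT f) (hg : PT g) : PT (fun a => decide (f a < g a)) := by
  have h : PT (fun a => decide (f a + 1 ≤ g a)) := by fun_prop
  exact h

@[fun_prop]
theorem decide_eq {f g : α → ℕ} (hf : PT f) (hg : PT g) : PT (fun a => decide (f a = g a)) := by
  have h : PT (fun a => decide (f a ≤ g a) && decide (g a ≤ f a)) := by fun_prop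
  convert h using 2 with a
  rw [Bool.eq_iff_iff]
  simp [le_antisymm_iff]

/-- For division: the quotient `x / y` is the number of `j < x` with `(j + 1) * y ≤ x`, which are
the `j` below the quotient. -/
theorem _root_.PCC.length_filter_range_lt (n c : ℕ) :
    ((List.range n).filter fun j => decide (j < c)).length = min n c := by
  induction n with
  | zero => simp
  | succ n ih =>
    rw [List.range_succ, List.filter_append, List.length_append, ih]
    by_cases h : n < c
    · simp [h]; omega
    · simp [h]; omega

@[fun_prop]
theorem div {f g : α → ℕ} (hf : PT f) (hg : PT g) : PT (fun a => f a / g a) := by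
  have h : PT (fun a => bif decide (g a = 0) then 0 else
    ((List.range (f a)).filter fun j => decide ((j + 1) * g a ≤ f a)).length) := by fun_prop
  convert h using 2 with a
  rcases Nat.eq_zero_or_pos (g a) with h | h
  · simp [h]
  · rw [decide_eq_false (by omega), cond_false]
    have : ∀ j, ((j + 1) * g a ≤ f a) ↔ j < f a / g a := fun j => by
      rw [← Nat.le_div_iff_mul_le h, Nat.succ_le_iff]
    simp only [this, length_filter_range_lt, min_eq_right (Nat.div_le_self (f a) (g a))]

@[fun_prop]
theorem mod {f g : α → ℕ} (hf : PT f) (hg : PT g) : PT (fun a => f a % g a) := by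
  have h : PT (fun a => f a - g a * (f a / g a)) := by fun_prop
  convert h using 2 with a
  rw [Nat.mod_eq_sub_mul_div]

theorem _root_.PCC.tail_iterate_headD {β : Type} (l : List β) (d : β) (i : ℕ) :
    ((List.range i).foldl (fun (l : List _) _ => l.tail) l).headD d = l.getD i d := by
  have : (List.range i).foldl (fun (l : List _) _ => l.tail) l = l.drop i := by
    induction i with
    | zero => simp
    | succ n ih => rw [List.range_succ, List.foldl_append, ih]; simp
  rw [this]
  simp [List.headD_eq_head?_getD, List.getD_eq_getElem?_getD]

theorem getD {f : α → List β} {g : α → ℕ} (d : β) (hd : enc d = .nil) (hf : PT f) (hg : PT g) :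
    PT (fun a => (f a).getD (g a) d) := by
  have h : PT (fun p : List β × ℕ => ((List.range p.2).foldl (fun (l : List _) _ => l.tail) p.1).headD d) := by
    refine headD d hd (foldl (f := fun _ (l : List _) _ => l.tail) (by fun_prop) (by fun_prop) (by fun_prop)
      _ (.const 0) fun a b c => ?_)
    cases b
    · simp
    · rw [sz_cons, List.tail_cons]; omega
  simp only [tail_iterate_headD] at h
  exact h.comp (hf.pair hg)

/-! ### Data without size -/

-- A program can double a tree in each step, so trees built in polynomial time may be exponentially
-- large. Opaque data count with size 0 and are only copied, taken apart and tested for `nil`, which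
-- is why polynomial bounds survive.
@[fun_prop]
theorem opaque_hd {f : α → Opaque} (hf : PT f) : PT (fun a => Opaque.mk (f a).val.hd) := by
  have h : PT (fun x : Opaque => Opaque.mk x.val.hd) :=
    ofExpr (.hd (.var 0)) (fun x s h => by simp [Expr.eval, h, enc_opaque]) (.const 0)
  exact h.comp hf

@[fun_prop]
theorem opaque_tl {f : α → Opaque} (hf : PT f) : PT (fun a => Opaque.mk (f a).val.tl) := by
  have h : PT (fun x : Opaque => Opaque.mk x.val.tl) :=
    ofExpr (.tl (.var 0)) (fun x s h => by simp [Expr.eval, h, enc_opaque]) (.const 0)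
  exact h.comp hf

/-- Whether data is `nil`. -/
def _root_.PCC.Data.isNil : Data → Bool
  | .nil => true
  | .cons _ _ => false

@[fun_prop]
theorem isNil {f : α → Opaque} (hf : PT f) : PT (fun a => (f a).val.isNil) := by
  have h : PT (fun x : Opaque => x.val.isNil) := by
    refine ⟨.branch (.var 0) (.assign 0 .nil) (.assign 0 (.cons .nil .nil)), fun _ => 2,
      fun x s h => ?_, .const 2, .const 0⟩
    rcases hx : x.val with _ | ⟨a, b⟩
    · exact .branch_false (by simp [Expr.eval, h, enc_opaque, hx]) (.assign (by
        simp [Expr.eval, enc_bool, hx, Data.isNil, Data.ofBool]))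
    · exact .branch_true (by simp [Expr.eval, h, enc_opaque, hx]) (.assign (by
        simp [Expr.eval, enc_bool, hx, Data.isNil, Data.ofBool]))
  exact h.comp hf

end PT

end

/-! ### Locality of executions -/

/-- All variables of an expression are below its bound. -/
def Expr.bd : Expr → ℕ
  | .nil => 0
  | .var x => x + 1
  | .cons e f => max e.bd f.bd
  | .hd e => e.bd
  | .tl e => e.bd

/-- All variables of a program are below its bound. -/
def Cmd.bd : Cmd → ℕ
  | .assign x e => max (x + 1) e.bd
  | .query x e f => max (x + 1) (max e.bd f.bd)
  | .seq c d => max c.bd d.bd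
  | .branch e c d => max e.bd (max c.bd d.bd)
  | .loop e c => max e.bd c.bd

theorem Expr.eval_congr {w : ℕ} {r s : Store} (h : ∀ x < w, r x = s x) (e : Expr)
    (he : e.bd ≤ w) : e.eval r = e.eval s := by
  induction e with
  | nil => rfl
  | var x => exact h x he
  | cons e f ih₁ ih₂ =>
    rw [Expr.bd, max_le_iff] at he
    rw [Expr.eval, Expr.eval, ih₁ he.1, ih₂ he.2]
  | hd e ih => rw [Expr.eval, Expr.eval, ih he]
  | tl e ih => rw [Expr.eval, Expr.eval, ih he]

theorem update_congr {w : ℕ} {r s : Store} (h : ∀ x < w, r x = s x) (y : ℕ) (a : Data) :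
    ∀ x < w, Function.update r y a x = Function.update s y a x := fun x hx => by
  simp only [Function.update_apply, h x hx]

/-- A program sees finitely many variables only; hence clearing these is as good as starting in the
initial store. -/
theorem Exec.congr {O : Data → Data → Bool} {c : Cmd} {s s' : Store} {t q : ℕ}
    (h : Exec O c s s' t q) (w : ℕ) :
    c.bd ≤ w → ∀ r : Store, (∀ x < w, r x = s x) → ∃ r', Exec O c r r' t q ∧
      ∀ x < w, r' x = s' x := by
  induction h with
  | assign x e s =>
    intro hc r hr
    simp only [Cmd.bd, max_le_iff] at hc
    refine ⟨_, .assign _ _ _, ?_⟩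
    rw [Expr.eval_congr hr e hc.2]
    exact update_congr hr _ _
  | query x e f s =>
    intro hc r hr
    simp only [Cmd.bd, max_le_iff] at hc
    refine ⟨_, .query _ _ _ _, ?_⟩
    rw [Expr.eval_congr hr e hc.2.1, Expr.eval_congr hr f hc.2.2]
    exact update_congr hr _ _
  | seq _ _ ih₁ ih₂ =>
    intro hc r hr
    simp only [Cmd.bd, max_le_iff] at hc
    obtain ⟨r₁, h₁, e₁⟩ := ih₁ hc.1 r hr
    obtain ⟨r₂, h₂, e₂⟩ := ih₂ hc.2 r₁ e₁
    exact ⟨r₂, .seq h₁ h₂, e₂⟩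
  | branch_true he _ ih =>
    intro hc r hr
    simp only [Cmd.bd, max_le_iff] at hc
    obtain ⟨r₁, h₁, e₁⟩ := ih hc.2.1 r hr
    exact ⟨r₁, .branch_true (by rwa [Expr.eval_congr hr _ hc.1]) h₁, e₁⟩
  | branch_false he _ ih =>
    intro hc r hr
    simp only [Cmd.bd, max_le_iff] at hc
    obtain ⟨r₁, h₁, e₁⟩ := ih hc.2.2 r hr
    exact ⟨r₁, .branch_false (by rwa [Expr.eval_congr hr _ hc.1]) h₁, e₁⟩
  | loop_done he =>
    intro hc r hr
    simp only [Cmd.bd, max_le_iff] at hc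
    exact ⟨r, .loop_done (by rwa [Expr.eval_congr hr _ hc.1]), hr⟩
  | loop_step he _ _ ih₁ ih₂ =>
    intro hc r hr
    have hc' := hc
    simp only [Cmd.bd, max_le_iff] at hc
    obtain ⟨r₁, h₁, e₁⟩ := ih₁ hc.2 r hr
    obtain ⟨r₂, h₂, e₂⟩ := ih₂ hc' r₁ e₁
    exact ⟨r₂, .loop_step (by rwa [Expr.eval_congr hr _ hc.1]) h₁ h₂, e₂⟩

/-- The initial store on input `a`. -/
def initStore (a : Data) : Store := Function.update (fun _ => Data.nil) 0 a

/-- The program that makes the variables `1, ..., w` equal to `nil`. -/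
def clear : ℕ → Cmd
  | 0 => .assign 0 (.var 0)
  | w + 1 => .seq (clear w) (.assign (w + 1) .nil)

theorem clear_runs (w : ℕ) (s : Store) :
    RunsTo (clear w) s (fun s' => ∀ x ≤ w, s' x = initStore (s 0) x) (w + 1) := by
  induction w with
  | zero =>
    refine .assign fun x hx => ?_
    obtain rfl := Nat.le_zero.1 hx
    simp [initStore, Expr.eval]
  | succ w ih =>
    refine ih.seq fun s' h => .assign fun x hx => ?_
    rcases Nat.lt_or_ge x (w + 1) with hx' | hx'
    · rw [Function.update_of_ne (by omega), h x (by omega)]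
    · obtain rfl : x = w + 1 := by omega
      simp [initStore, Expr.eval]

/-- Programs started with all auxiliary variables equal to `nil`. -/
theorem PT.of_runs {α β : Type} [Enc α] [Enc β] {f : α → β} (c : Cmd) (T : α → ℕ)
    (h : ∀ a, RunsTo c (initStore (enc a)) (fun s' => s' 0 = enc (f a)) (T a))
    (hT : PolyBd sz T) (hf : PolyBd sz (fun a => sz (f a))) : PT f := by
  refine ⟨.seq (clear c.bd) c, fun a => c.bd + 1 + T a, fun a s hs =>
    (clear_runs c.bd s).seq fun s' hs' => ?_, (PolyBd.const _).add hT, hf⟩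
  obtain ⟨s₁, t, h₁, h₂, ht⟩ := h a
  rw [hs] at hs'
  obtain ⟨r, hr, e⟩ := h₁.congr (c.bd + 1) (by omega) s' fun x hx => hs' x (by omega)
  exact ⟨r, t, hr, (e 0 (by omega)).trans h₂, ht⟩

/-! ### Simulation with guessed answers and a clock -/

/-- Sets the guard of a loop: it is that of the original loop as long as the clock has not run
down. -/
def guardCmd (e : Expr) : Cmd := .branch (.var 0) (.assign 4 (e.shift 5)) (.assign 4 .nil)

/-- The simulation of a program without queries. Variable `0` is a clock that every iteration of a
loop decreases, variable `1` holds the guessed answers, variable `2` tells whether they have been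
exhausted, and variable `3` is the history of the answered queries. -/
def trans : Cmd → Cmd
  | .assign x e => .assign (x + 5) (e.shift 5)
  | .query x e f => .branch (.var 1)
      (.seq (.assign 3 (.cons (.cons (.cons (e.shift 5) (f.shift 5)) (.hd (.var 1))) (.var 3)))
        (.seq (.assign (x + 5) (.hd (.var 1))) (.assign 1 (.tl (.var 1)))))
      (.seq (.assign 2 (.cons .nil .nil)) (.assign (x + 5) .nil))
  | .seq c d => .seq (trans c) (trans d)
  | .branch e c d => .branch (e.shift 5) (trans c) (trans d)
  | .loop e c => .seq (guardCmd e)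
      (.loop (.var 4) (.seq (trans c) (.seq (.assign 0 (.tl (.var 0))) (guardCmd e))))

/-- Answered queries. -/
abbrev History := List ((Opaque × Opaque) × Bool)

/-- The auxiliary data of the simulation. -/
structure Sim where
  clock : ℕ
  bits : List Bool
  out : Bool
  hist : History

namespace Sim

/-- The auxiliary variables represent `σ`. -/
def Holds (σ : Sim) (r : Store) : Prop :=
  r 0 = enc σ.clock ∧ r 1 = enc σ.bits ∧ r 2 = enc σ.out ∧ r 3 = enc σ.hist

/-- `σ'` is reached from `σ` by answering the queries `h`. -/
def Next (σ σ' : Sim) (h : History) : Prop :=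
  σ'.clock ≤ σ.clock ∧ σ'.hist = h ++ σ.hist ∧ σ.bits = h.reverse.map Prod.snd ++ σ'.bits ∧
    (σ.out = true → σ'.out = true)

theorem Next.refl (σ : Sim) : σ.Next σ [] := ⟨le_rfl, rfl, rfl, fun h => h⟩

theorem Next.trans {σ₁ σ₂ σ₃ : Sim} {h h' : History} (H : σ₁.Next σ₂ h) (H' : σ₂.Next σ₃ h') :
    σ₁.Next σ₃ (h' ++ h) :=
  ⟨H'.1.trans H.1, by rw [H'.2.1, H.2.1, List.append_assoc],
    by rw [H.2.2.1, H'.2.2.1]; simp, fun h => H'.2.2.2 (H.2.2.2 h)⟩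

/-- The clock is decreased. -/
def tick (σ : Sim) : Sim := { σ with clock := σ.clock - 1 }

theorem Next.tick (σ : Sim) : σ.Next σ.tick [] := ⟨Nat.sub_le _ _, rfl, rfl, fun h => h⟩

theorem Holds.update {σ : Sim} {r : Store} (h : σ.Holds r) (x : ℕ) (a : Data) :
    σ.Holds (Function.update r (x + 4) a) := by
  simpa [Holds] using h

theorem Holds.tick {σ : Sim} {r : Store} (h : σ.Holds r) :
    σ.tick.Holds (Function.update r 0 (Data.tl (r 0))) := by
  refine ⟨?_, by simpa [Sim.tick] using h.2⟩
  rw [Function.update_self, h.1]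
  simp only [Sim.tick, enc_nat]
  cases σ.clock <;> rfl

end Sim

theorem Exec.seq_inv {O : Data → Data → Bool} {c d : Cmd} {s s' : Store} {t q : ℕ}
    (h : Exec O (.seq c d) s s' t q) : ∃ s₁ t₁ t₂ q₁ q₂, Exec O c s s₁ t₁ q₁ ∧
      Exec O d s₁ s' t₂ q₂ ∧ t = t₁ + t₂ ∧ q = q₁ + q₂ := by
  cases h with
  | seq h₁ h₂ => exact ⟨_, _, _, _, _, h₁, h₂, rfl, rfl⟩

theorem guardCmd_exec {σ : Sim} {r : Store} (h : σ.Holds r) (e : Expr) :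
    Exec noOracle (guardCmd e) r
      (Function.update r 4 (if σ.clock = 0 then .nil else (e.shift 5).eval r)) 2 0 := by
  have h0 := h.1
  split_ifs with hc
  · exact .branch_false (by rw [Expr.eval, h0, hc]; rfl) (.assign _ _ _)
  · refine .branch_true ?_ (.assign _ _ _)
    obtain ⟨k, hk⟩ := Nat.exists_eq_succ_of_ne_zero hc
    rw [Expr.eval, h0, hk]
    simp [enc_nat, Data.ofNat]

theorem trans_loop_done {σ : Sim} {r : Store} (h : σ.Holds r) {e : Expr} {c : Cmd}
    (he : σ.clock = 0 ∨ (e.shift 5).eval r = .nil) :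
    Exec noOracle (trans (.loop e c)) r (Function.update r 4 .nil) 3 0 := by
  have h₁ := guardCmd_exec h e
  have : (if σ.clock = 0 then Data.nil else (e.shift 5).eval r) = .nil := by
    rcases he with he | he <;> simp [he]
  rw [this] at h₁
  exact .seq h₁ (.loop_done (by simp [Expr.eval]))

theorem trans_loop_step {σ σ₁ : Sim} {r r₁ r' : Store} {t t' : ℕ} (h : σ.Holds r)
    (h₁ : σ₁.Holds r₁) {e : Expr} {c : Cmd} (hσ : σ.clock ≠ 0) (he : (e.shift 5).eval r ≠ .nil)
    (hc : Exec noOracle (trans c) (Function.update r 4 ((e.shift 5).eval r)) r₁ t 0)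
    (hl : Exec noOracle (trans (.loop e c)) (Function.update r₁ 0 (Data.tl (r₁ 0))) r' t' 0) :
    Exec noOracle (trans (.loop e c)) r r' (t + t' + 4) 0 := by
  have g := guardCmd_exec h e
  rw [if_neg hσ] at g
  obtain ⟨s₂, t₁, t₂, q₁, q₂, l₁, l₂, rfl, hq⟩ := hl.seq_inv
  have hg := guardCmd_exec h₁.tick e
  obtain ⟨rfl, rfl, rfl⟩ := l₁.det hg
  obtain rfl : q₂ = 0 := by omega
  have := Exec.seq g (.loop_step (by simpa [Expr.eval] using he)
    (.seq hc (.seq (.assign 0 (.tl (.var 0)) _) hg)) l₂)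
  rwa [show t + (2 + t₂) + 4 = 2 + (t + (1 + 2) + t₂ + 1) by omega]

/-- The simulation always halts, in time proportional to the decrease of the clock. -/
theorem trans_total (c : Cmd) : ∃ K, ∀ (r : Store) (σ : Sim), σ.Holds r → ∃ r' σ' t h,
    Exec noOracle (trans c) r r' t 0 ∧ σ'.Holds r' ∧ σ.Next σ' h ∧
      t + K * σ'.clock ≤ K * (1 + σ.clock) := by
  induction c with
  | assign x e =>
    refine ⟨1, fun r σ h => ⟨_, σ, _, [], .assign _ _ _, h.update _ _, .refl σ, by omega⟩⟩
  | query x e f =>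
    refine ⟨4, fun r σ h => ?_⟩
    obtain ⟨κ, bits, out, hist⟩ := σ
    obtain ⟨h0, h1, h2, h3⟩ := h
    simp only at h0 h1 h2 h3
    rcases bits with _ | ⟨b, bits⟩
    · refine ⟨_, ⟨κ, [], true, hist⟩, _, [],
        .branch_false (by rw [Expr.eval, h1]; rfl) (.seq (.assign _ _ _) (.assign _ _ _)),
        ⟨by simpa using h0, by simpa using h1, by simp [Expr.eval]; rfl, by simpa using h3⟩,
        ⟨le_rfl, rfl, rfl, fun _ => rfl⟩, by simp only; omega⟩
    · refine ⟨_, ⟨κ, bits, out, ((⟨(e.shift 5).eval r⟩, ⟨(f.shift 5).eval r⟩), b) :: hist⟩, _,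
        [((⟨(e.shift 5).eval r⟩, ⟨(f.shift 5).eval r⟩), b)],
        .branch_true (by rw [Expr.eval, h1, enc_cons]; simp)
          (.seq (.assign _ _ _) (.seq (.assign _ _ _) (.assign _ _ _))),
        ⟨by simpa using h0, by simp [Expr.eval, h1, enc_cons, Data.tl], by simpa using h2,
          by simp [Expr.eval, h1, h3, enc_cons, enc_pair, enc_opaque, Data.hd]⟩,
        ⟨le_rfl, rfl, rfl, fun h => h⟩, by simp only; omega⟩
  | seq c d ihc ihd =>
    obtain ⟨K, hK⟩ := ihc
    obtain ⟨L, hL⟩ := ihd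
    refine ⟨K + L, fun r σ h => ?_⟩
    obtain ⟨r₁, σ₁, t₁, h₁, e₁, H₁, N₁, T₁⟩ := hK r σ h
    obtain ⟨r₂, σ₂, t₂, h₂, e₂, H₂, N₂, T₂⟩ := hL r₁ σ₁ H₁
    refine ⟨r₂, σ₂, _, _, .seq e₁ e₂, H₂, N₁.trans N₂, ?_⟩
    have a₁ := Nat.mul_le_mul_left L N₁.1
    have a₂ := Nat.mul_le_mul_left K N₂.1
    nlinarith
  | branch e c d ihc ihd =>
    obtain ⟨K, hK⟩ := ihc
    obtain ⟨L, hL⟩ := ihd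
    refine ⟨K + L + 1, fun r σ h => ?_⟩
    by_cases he : (e.shift 5).eval r = .nil
    · obtain ⟨r₂, σ₂, t₂, h₂, e₂, H₂, N₂, T₂⟩ := hL r σ h
      refine ⟨r₂, σ₂, _, _, .branch_false he e₂, H₂, N₂, ?_⟩
      have a₂ := Nat.mul_le_mul_left (K + 1) N₂.1
      nlinarith
    · obtain ⟨r₂, σ₂, t₂, h₂, e₂, H₂, N₂, T₂⟩ := hK r σ h
      refine ⟨r₂, σ₂, _, _, .branch_true he e₂, H₂, N₂, ?_⟩
      have a₂ := Nat.mul_le_mul_left (L + 1) N₂.1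
      nlinarith
  | loop e c ih =>
    obtain ⟨K, hK⟩ := ih
    -- An iteration costs at most `K` times one plus the clock spent by the body, and 4 further
    -- steps. The tick pays for the extra one, unless the body has run the clock down to 0; then the
    -- former value `n ≥ 1` pays, whence the factor 2.
    refine ⟨2 * K + 4, fun r σ h => ?_⟩
    induction hn : σ.clock using Nat.strong_induction_on generalizing r σ with
    | _ n ih =>
    by_cases he : σ.clock = 0 ∨ (e.shift 5).eval r = .nil
    · exact ⟨_, σ, _, [], trans_loop_done h he, h.update _ _, .refl σ, by rw [hn]; nlinarith⟩
    · push Not at he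
      obtain ⟨r₁, σ₁, t₁, h₁, e₁, H₁, N₁, T₁⟩ := hK _ σ (h.update 0 ((e.shift 5).eval r))
      have hlt : σ₁.tick.clock < n := by
        have := N₁.1
        have := he.1
        simp only [Sim.tick]
        omega
      obtain ⟨r₂, σ₂, t₂, h₂, e₂, H₂, N₂, T₂⟩ := ih _ hlt _ _ H₁.tick rfl
      refine ⟨r₂, σ₂, _, _, trans_loop_step h H₁ he.1 he.2 e₁ e₂, H₂,
        (N₁.trans (.tick σ₁)).trans N₂, ?_⟩
      simp only [Sim.tick] at T₂
      rw [hn] at T₁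
      have hn0 : 1 ≤ n := by omega
      rcases Nat.eq_zero_or_pos σ₁.clock with h0 | h0
      · rw [h0] at T₁ T₂
        simp only [Nat.zero_sub, Nat.add_zero, mul_one, mul_zero] at T₁ T₂
        nlinarith [Nat.mul_le_mul_left K hn0]
      · have : 1 + (σ₁.clock - 1) = σ₁.clock := by omega
        rw [this] at T₂
        have : σ₁.clock ≤ n := hn ▸ N₁.1
        nlinarith [Nat.mul_le_mul_left K this]

/-! ### Comparison of the simulation with executions that use an oracle -/

/-- The recorded answers are those of the oracle `O`. -/
def Agrees (O : Data → Data → Bool) (h : History) : Prop :=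
  ∀ p ∈ h, p.2 = O p.1.1.val p.1.2.val

theorem agrees_append {O : Data → Data → Bool} {h h' : History} :
    Agrees O (h ++ h') ↔ Agrees O h ∧ Agrees O h' := by
  simp [Agrees, or_imp, forall_and]

/-- One of two lists is a prefix of the other one. -/
def Compat (l l' : List Bool) : Prop := ∃ x y, l ++ x = l' ++ y

/-- The simulation of `c` leads from the store `r` to the store `r'`. -/
def Halts (c : Cmd) (r r' : Store) : Prop := ∃ t, Exec noOracle (trans c) r r' t 0

/-- What a simulation `X` achieves from `σ` on, compared with an execution that makes the queries
answered by `l` and ends in the store `s'` after `t` steps. -/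
def Follows (O : Data → Data → Bool) (X : Store → Prop) (s' : Store) (t : ℕ) (l : List Bool)
    (σ : Sim) : Prop :=
  ∃ r' σ' h, X r' ∧ Sim.Holds σ' r' ∧ σ.Next σ' h ∧
    (Agrees O h →
      (σ'.out = false ∧ (∀ x, r' (x + 5) = s' x) ∧ h.length = l.length ∧ σ.clock ≤ σ'.clock + t) ∨
      (σ'.out = true ∧ σ'.bits = [] ∧ h.length < l.length)) ∧
    (Compat σ.bits l → Agrees O h ∧ h.reverse.map Prod.snd <+: l)

/-- `Follows` from all stores that represent the store `s`. -/
def FollowsFrom (O : Data → Data → Bool) (c : Cmd) (s s' : Store) (t : ℕ) (l : List Bool) : Prop :=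
  ∀ (r : Store) (σ : Sim), σ.Holds r → (∀ x, r (x + 5) = s x) → t ≤ σ.clock → σ.out = false →
    Follows O (Halts c r) s' t l σ

theorem halts_total (c : Cmd) (r : Store) (σ : Sim) (h : σ.Holds r) : ∃ r' σ' h,
    Halts c r r' ∧ Sim.Holds σ' r' ∧ σ.Next σ' h := by
  obtain ⟨K, hK⟩ := trans_total c
  obtain ⟨r', σ', t, h, e, H, N, -⟩ := hK r σ h
  exact ⟨r', σ', h, ⟨t, e⟩, H, N⟩

/-- After the first part there are three cases. If it is in step with the execution, the second part
takes over. If the guesses are exhausted, no bit is left, so nothing more is recorded and the flag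
stays raised. If a recorded answer is false, only termination is needed, as both implications in
`Follows` become vacuous. -/
theorem follows_seq {O : Data → Data → Bool} {X Y : Store → Prop} {d : Cmd} {s₁ s₂ : Store}
    {t t' : ℕ} {l l' : List Bool} {σ : Sim} (hc : Follows O X s₁ t l σ)
    (hXY : ∀ r₁ r₂, X r₁ → Halts d r₁ r₂ → Y r₂)
    (hd : FollowsFrom O d s₁ s₂ t' l') (ht : t + t' ≤ σ.clock) :
    Follows O Y s₂ (t + t') (l ++ l') σ := by
  obtain ⟨r₁, σ₁, h₁, e₁, H₁, N₁, A₁, C₁⟩ := hc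
  have hcompat : Compat σ.bits (l ++ l') → Compat σ.bits l := fun ⟨x, y, h⟩ =>
    ⟨x, l' ++ y, by rw [h, List.append_assoc]⟩
  by_cases hA : Agrees O h₁
  · rcases A₁ hA with ⟨o₁, R₁, L₁, K₁⟩ | ⟨o₁, B₁, L₁⟩
    · obtain ⟨r₂, σ₂, h₂, e₂, H₂, N₂, A₂, C₂⟩ := hd r₁ σ₁ H₁ R₁ (by omega) o₁
      refine ⟨r₂, σ₂, _, hXY _ _ e₁ e₂, H₂, N₁.trans N₂, fun hA' => ?_, fun hC => ?_⟩
      · rcases A₂ (agrees_append.1 hA').1 with ⟨o₂, R₂, L₂, K₂⟩ | ⟨o₂, B₂, L₂⟩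
        · exact .inl ⟨o₂, R₂, by simp; omega, by omega⟩
        · exact .inr ⟨o₂, B₂, by simp; omega⟩
      · have hl : h₁.reverse.map Prod.snd = l :=
          (C₁ (hcompat hC)).2.eq_of_length (by simpa using L₁)
        have hC' : Compat σ₁.bits l' := by
          obtain ⟨x, y, h⟩ := hC
          rw [N₁.2.2.1, hl] at h
          exact ⟨x, y, by simpa using h⟩
        obtain ⟨a, b⟩ := C₂ hC'
        refine ⟨agrees_append.2 ⟨a, hA⟩, ?_⟩
        rw [List.reverse_append, List.map_append, hl]
        exact (List.prefix_append_right_inj l).2 b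
    · obtain ⟨r₂, σ₂, h₂, e₂, H₂, N₂⟩ := halts_total d r₁ σ₁ H₁
      have hh : h₂ = [] ∧ σ₂.bits = [] := by
        have := N₂.2.2.1
        rw [B₁] at this
        simpa using this.symm
      obtain ⟨rfl, hb⟩ := hh
      refine ⟨r₂, σ₂, _, hXY _ _ e₁ e₂, H₂, N₁.trans N₂, fun hA' => .inr ?_, fun hC => ?_⟩
      · exact ⟨N₂.2.2.2 o₁, hb, by simp; omega⟩
      · exact ⟨hA, (C₁ (hcompat hC)).2.trans (List.prefix_append _ _)⟩
  · obtain ⟨r₂, σ₂, h₂, e₂, H₂, N₂⟩ := halts_total d r₁ σ₁ H₁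
    exact ⟨r₂, σ₂, _, hXY _ _ e₁ e₂, H₂, N₁.trans N₂,
      fun hA' => absurd (agrees_append.1 hA').2 hA, fun hC => absurd (C₁ (hcompat hC)).1 hA⟩

/-- The unit of clock spent by an iteration is matched by the step in which the original loop tests
its guard. -/
theorem Follows.tick {O : Data → Data → Bool} {X Y : Store → Prop} {s : Store} {t : ℕ}
    {l : List Bool} {σ : Sim} (h : Follows O X s t l σ)
    (hXY : ∀ r σ, X r → Sim.Holds σ r → Y (Function.update r 0 (Data.tl (r 0)))) :
    Follows O Y s (t + 1) l σ := by
  obtain ⟨r₁, σ₁, h₁, e₁, H₁, N₁, A₁, C₁⟩ := h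
  refine ⟨_, _, h₁, hXY _ _ e₁ H₁, H₁.tick, N₁.trans (.tick σ₁), fun hA => ?_, C₁⟩
  refine (A₁ hA).imp (fun ⟨a, b, c, d⟩ => ⟨a, fun x => ?_, c, ?_⟩) fun h => h
  · simp [b]
  · simp only [Sim.tick]
    omega

theorem Follows.time {O : Data → Data → Bool} {X Y : Store → Prop} {s : Store} {t t' : ℕ}
    {l : List Bool} {σ : Sim} (h : Follows O X s t l σ) (ht : t ≤ t') (hXY : ∀ r, X r → Y r) :
    Follows O Y s t' l σ := by
  obtain ⟨r₁, σ₁, h₁, e₁, H₁, N₁, A₁, C₁⟩ := h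
  exact ⟨r₁, σ₁, h₁, hXY _ e₁, H₁, N₁, fun hA => (A₁ hA).imp
    (fun ⟨a, b, c, d⟩ => ⟨a, b, c, by omega⟩) fun h => h, C₁⟩

theorem rel_update {r s : Store} (h : ∀ x, r (x + 5) = s x) (y : ℕ) (a : Data) (x : ℕ) :
    Function.update r (y + 5) a (x + 5) = Function.update s y a x := by
  simp [Function.update_apply, h]

/-- The simulation follows every execution with an oracle as long as the guessed answers are those
of the oracle. -/
theorem exists_followsFrom {O : Data → Data → Bool} {c : Cmd} {s s' : Store} {t q : ℕ}
    (h : Exec O c s s' t q) : ∃ l : List Bool, l.length = q ∧ FollowsFrom O c s s' t l := by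
  induction h with
  | assign x e s =>
    refine ⟨[], rfl, fun r σ H R ht ho => ⟨_, σ, [], ⟨_, .assign _ _ _⟩, H.update _ _, .refl σ,
      fun _ => .inl ⟨ho, fun y => ?_, rfl, by omega⟩, fun _ => ⟨by simp [Agrees], by simp⟩⟩⟩
    rw [Expr.eval_shift 5 r s R, rel_update R]
  | query x e f s =>
    refine ⟨[O (e.eval s) (f.eval s)], rfl, fun r σ H R ht ho => ?_⟩
    obtain ⟨κ, bits, out, hist⟩ := σ
    obtain ⟨h0, h1, h2, h3⟩ := H
    simp only at h0 h1 h2 h3 ho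
    subst ho
    rcases bits with _ | ⟨b, bits⟩
    · refine ⟨_, ⟨κ, [], true, hist⟩, [],
        ⟨_, .branch_false (by rw [Expr.eval, h1]; rfl) (.seq (.assign _ _ _) (.assign _ _ _))⟩,
        ⟨by simpa using h0, by simpa using h1, by simp [Expr.eval]; rfl, by simpa using h3⟩,
        ⟨le_rfl, rfl, rfl, fun _ => rfl⟩, fun _ => .inr ⟨rfl, rfl, by simp⟩,
        fun _ => ⟨by simp [Agrees], by simp⟩⟩
    · refine ⟨_, ⟨κ, bits, false, ((⟨(e.shift 5).eval r⟩, ⟨(f.shift 5).eval r⟩), b) :: hist⟩,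
        [((⟨(e.shift 5).eval r⟩, ⟨(f.shift 5).eval r⟩), b)],
        ⟨_, .branch_true (by rw [Expr.eval, h1, enc_cons]; simp)
          (.seq (.assign _ _ _) (.seq (.assign _ _ _) (.assign _ _ _)))⟩,
        ⟨by simpa using h0, by simp [Expr.eval, h1, enc_cons, Data.tl], by simpa using h2,
          by simp [Expr.eval, h1, h3, enc_cons, enc_pair, enc_opaque, Data.hd]⟩,
        ⟨le_rfl, rfl, rfl, fun h => h⟩, fun hA => .inl ⟨rfl, fun y => ?_, rfl, by simp only; omega⟩,
        fun ⟨x, y, hC⟩ => ?_⟩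
      · have hb : b = O (e.eval s) (f.eval s) := by
          simpa [Agrees, Expr.eval_shift 5 r s R] using hA
        rw [Function.update_of_ne (by omega), rel_update (s := s) (fun z => by simp [R])]
        simp [Expr.eval, h1, enc_cons, Data.hd, enc_bool, hb]
      · have hb : b = O (e.eval s) (f.eval s) := by
          simp only [List.cons_append, List.cons.injEq] at hC
          exact hC.1
        refine ⟨?_, by simp [hb]⟩
        simpa [Agrees, Expr.eval_shift 5 r s R] using hb
  | seq _ _ ih₁ ih₂ =>
    obtain ⟨l₁, rfl, F₁⟩ := ih₁
    obtain ⟨l₂, rfl, F₂⟩ := ih₂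
    exact ⟨l₁ ++ l₂, by simp, fun r σ H R ht ho => follows_seq (F₁ r σ H R (by omega) ho)
      (fun _ _ ⟨_, a⟩ ⟨_, b⟩ => ⟨_, .seq a b⟩) F₂ ht⟩
  | branch_true he _ ih =>
    obtain ⟨l, rfl, F⟩ := ih
    exact ⟨l, rfl, fun r σ H R ht ho => (F r σ H R (by omega) ho).time (by omega)
      fun _ ⟨_, a⟩ => ⟨_, .branch_true (by rwa [Expr.eval_shift 5 r _ R]) a⟩⟩
  | branch_false he _ ih =>
    obtain ⟨l, rfl, F⟩ := ih
    exact ⟨l, rfl, fun r σ H R ht ho => (F r σ H R (by omega) ho).time (by omega)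
      fun _ ⟨_, a⟩ => ⟨_, .branch_false (by rwa [Expr.eval_shift 5 r _ R]) a⟩⟩
  | loop_done he =>
    exact ⟨[], rfl, fun r σ H R ht ho => ⟨_, σ, [],
      ⟨_, trans_loop_done H (.inr (by rwa [Expr.eval_shift 5 r _ R]))⟩, H.update 0 _, .refl σ,
      fun _ => .inl ⟨ho, fun y => by simp [R], rfl, by omega⟩,
      fun _ => ⟨by simp [Agrees], by simp⟩⟩⟩
  | @loop_step e c s₁ s₂ s₃ t t' q q' he _ _ ih₁ ih₂ =>
    obtain ⟨l₁, rfl, F₁⟩ := ih₁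
    obtain ⟨l₂, rfl, F₂⟩ := ih₂
    refine ⟨l₁ ++ l₂, by simp, fun r σ H R ht ho => ?_⟩
    have he' : (e.shift 5).eval r ≠ .nil := by rwa [Expr.eval_shift 5 r _ R]
    have h₁ := F₁ _ σ (H.update 0 ((e.shift 5).eval r)) (fun x => by simp [R]) (by omega) ho
    -- The simulated body with its tick is described by its continuation: whatever the simulated
    -- loop reaches from `r₁`, it reaches from `r`.
    refine (follows_seq (Y := Halts (.loop e c) r) (h₁.tick
      (Y := fun r₁ => ∀ r₂, Halts (.loop e c) r₁ r₂ → Halts (.loop e c) r r₂) ?_)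
      (fun r₁ r₂ a b => a r₂ b) F₂ (by omega)).time (by omega) fun _ h => h
    rintro r₁ σ₁ ⟨t₁, e₁⟩ H₁ r₂ ⟨t₂, e₂⟩
    exact ⟨_, trans_loop_step H H₁ (by omega) he' e₁ e₂⟩

/-! ### The simulation as a polynomial-time function -/

theorem enc_opaque_injective : Function.Injective (enc : Opaque → Data) :=
  fun ⟨_⟩ ⟨_⟩ h => congrArg Opaque.mk h

theorem enc_bool_injective : Function.Injective (enc : Bool → Data) := by
  intro a b h
  cases a <;> cases b <;> simp_all [enc_bool, Data.ofBool]

theorem enc_pair_injective {α β : Type} [Enc α] [Enc β]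
    (hα : Function.Injective (enc : α → Data)) (hβ : Function.Injective (enc : β → Data)) :
    Function.Injective (enc : α × β → Data) := by
  rintro ⟨a, b⟩ ⟨a', b'⟩ h
  simp only [enc_pair, Data.cons.injEq] at h
  rw [hα h.1, hβ h.2]

theorem enc_list_injective {α : Type} [Enc α] (hα : Function.Injective (enc : α → Data)) :
    Function.Injective (enc : List α → Data) := by
  intro l
  induction l with
  | nil =>
    intro l' h
    cases l' with
    | nil => rfl
    | cons a l' => simp [enc_nil, enc_cons] at h
  | cons a l ih =>
    intro l' h
    cases l' with
    | nil => simp [enc_nil, enc_cons] at h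
    | cons b l' =>
      simp only [enc_cons, Data.cons.injEq] at h
      rw [hα h.1, ih h.2]

/-- The simulation of `A` as a function of the input, the clock and the guessed answers, with the
output, the exhaustion of the guesses and the history as values. -/
theorem exists_simulation (α : Type) [Enc α] (A : Cmd) :
    ∃ F : α × ℕ × List Bool → Opaque × Bool × History, PT F ∧
      ∀ (a : α) (κ : ℕ) (O : Data → Data → Bool) (b : Data) (t q : ℕ), Runs O A (enc a) b t q →
        t ≤ κ → ∃ l : List Bool, l.length = q ∧ ∀ β : List Bool,
          (Agrees O (F (a, κ, β)).2.2 →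
            ((F (a, κ, β)).2.1 = false ∧ (F (a, κ, β)).1.val = b ∧ q ≤ β.length) ∨
            ((F (a, κ, β)).2.1 = true ∧ β.length < q)) ∧
          (Compat β l → Agrees O (F (a, κ, β)).2.2) := by
  obtain ⟨K, hK⟩ := trans_total A
  let pre : Cmd := .seq (.assign 5 (.hd (.var 0))) (.seq (.assign 1 (.tl (.tl (.var 0))))
    (.assign 0 (.hd (.tl (.var 0)))))
  let r₀ : α × ℕ × List Bool → Store := fun x => Function.update (Function.update (Function.update
    (initStore (enc x)) 5 (enc x.1)) 1 (enc x.2.2)) 0 (enc x.2.1)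
  have hpre : ∀ x, Exec noOracle pre (initStore (enc x)) (r₀ x) 3 0 := fun x => by
    have := Exec.seq (O := noOracle) (.assign 5 (.hd (.var 0)) (initStore (enc x)))
      (.seq (.assign 1 (.tl (.tl (.var 0))) _) (.assign 0 (.hd (.tl (.var 0))) _))
    simpa [pre, r₀, Expr.eval, enc_pair, Data.hd, Data.tl, initStore] using this
  let σ₀ : α × ℕ × List Bool → Sim := fun x => ⟨x.2.1, x.2.2, false, []⟩
  have hσ₀ : ∀ x, (σ₀ x).Holds (r₀ x) := fun x => by
    simp [Sim.Holds, σ₀, r₀, initStore, enc_bool, Data.ofBool, enc_nil]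
  choose r₁ σ₁ t₁ h₁ e₁ H₁ N₁ T₁ using fun x => hK (r₀ x) (σ₀ x) (hσ₀ x)
  have hh : ∀ x, (σ₁ x).hist = h₁ x := fun x => by simpa [σ₀] using (N₁ x).2.1
  have hb : ∀ x, x.2.2 = (h₁ x).reverse.map Prod.snd ++ (σ₁ x).bits := fun x => (N₁ x).2.2.1
  refine ⟨fun x => (⟨r₁ x 5⟩, (σ₁ x).out, h₁ x), ?_, fun a κ O b t q hA ht => ?_⟩
  · refine PT.of_runs (.seq pre (.seq (trans A) (.assign 0 (.cons (.var 5)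
      (.cons (.var 2) (.var 3)))))) (fun x => 3 + (t₁ x + 1)) (fun x => ?_) ?_ ?_
    · refine ⟨_, _, .seq (hpre x) (.seq (e₁ x) (.assign _ _ _)), ?_, le_rfl⟩
      have := H₁ x
      simp [Expr.eval, enc_pair, enc_opaque, this.2.2.1, this.2.2.2, hh]
    · refine (((PolyBd.const 3).add (((PolyBd.const K).mul
        (PolyBd.self.add (.const 1))).add (.const 1)))).mono fun x => ?_
      have h₁ := T₁ x
      have h₂ : (σ₀ x).clock ≤ sz x := by
        simp only [sz_pair, σ₀, sz_nat]
        omega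
      have := Nat.mul_le_mul_left K (Nat.add_le_add_left h₂ 1)
      rw [Nat.add_comm (sz x) 1]
      omega
    · refine ((PolyBd.self.mul (.const 3)).add (.const 2)).mono fun x => ?_
      have h₁ : (h₁ x).length ≤ sz x := by
        have h₂ := congrArg List.length (hb x)
        have h₃ := length_le_sz x.2.2
        simp only [List.length_append, List.length_map, List.length_reverse] at h₂
        simp only [sz_pair]
        omega
      -- An entry has size 2, one for each of its two pairings, however large the queries are.
      have h₂ : sz (PCC.Sim.hist (σ₁ x)) ≤ (PCC.Sim.hist (σ₁ x)).length * (2 + 1) :=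
        sz_list_le _ _ fun p _ => by simp [sz]
      rw [hh] at h₂
      simp only [sz_pair, sz_bool, show sz (Opaque.mk (r₁ x 5)) = 0 from rfl] at h₁ h₂ ⊢
      omega
  · obtain ⟨s, hs, hs0⟩ := hA
    obtain ⟨l, hl, F⟩ := exists_followsFrom hs
    refine ⟨l, hl, fun β => ?_⟩
    obtain ⟨r', σ', h, ⟨t', e'⟩, H', N', A', C'⟩ := F (r₀ (a, κ, β)) (σ₀ (a, κ, β)) (hσ₀ _)
      (fun x => by
        rcases x with _ | x
        · simp [r₀]
        · simp [r₀, initStore]) ht rfl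
    -- By determinism this is the run chosen in the definition of the function; the flag and the
    -- history agree since their encodings in the final store do.
    obtain ⟨rfl, -, -⟩ := e'.det (e₁ (a, κ, β))
    have hout : σ'.out = (σ₁ (a, κ, β)).out :=
      enc_bool_injective (H'.2.2.1.symm.trans (H₁ (a, κ, β)).2.2.1)
    have hhist : h = h₁ (a, κ, β) := by
      have h₂ : σ'.hist = h := by simpa [σ₀] using N'.2.1
      rw [← hh, ← h₂]
      exact enc_list_injective (enc_pair_injective (enc_pair_injective enc_opaque_injective
        enc_opaque_injective) enc_bool_injective) (H'.2.2.2.symm.trans (H₁ (a, κ, β)).2.2.2)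
    have hlen : β.length = h.length + σ'.bits.length := by
      have := congrArg List.length N'.2.2.1
      simpa [σ₀] using this
    subst hhist
    refine ⟨fun hA => (A' hA).imp (fun ⟨a₁, a₂, a₃, a₄⟩ => ⟨hout.symm.trans a₁, ?_, by omega⟩)
      fun ⟨a₁, a₂, a₃⟩ => ⟨hout.symm.trans a₁, ?_⟩, fun hC => (C' hC).1⟩
    · rw [← hs0, ← a₂ 0]
    · rw [a₂] at hlen
      simp only [List.length_nil] at hlen
      omega

/-! ### Consistency of recorded answers -/

theorem ofNat_eq_iterate (n : ℕ) : Data.ofNat n = (Data.cons .nil)^[n] .nil := by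
  induction n with
  | zero => rfl
  | succ n ih => rw [Function.iterate_succ_apply', ← ih]; rfl

theorem ofNat_injective : Function.Injective Data.ofNat := by
  intro m
  induction m with
  | zero => intro n h; cases n <;> simp_all [Data.ofNat]
  | succ m ih =>
    intro n h
    cases n with
    | zero => simp [Data.ofNat] at h
    | succ n => simp only [Data.ofNat, Data.cons.injEq, true_and] at h; rw [ih h]

/-- One step in the evaluation of a unary number. -/
def unaryStep (p : Opaque × ℕ) : Opaque × ℕ :=
  bif p.1.val.isNil || !(Opaque.mk p.1.val.hd).val.isNil then p else (⟨p.1.val.tl⟩, p.2 + 1)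

/-- The number below `n` represented by the data, or `n` if there is none. -/
def unaryIdx (n : ℕ) (a : Opaque) : ℕ :=
  bif ((List.range n).foldl (fun p _ => unaryStep p) (a, 0)).1.val.isNil then
    ((List.range n).foldl (fun p _ => unaryStep p) (a, 0)).2 else n

/-- A step strips one successor or changes nothing, so the count and the remainder determine the
original data. If the remainder is `nil`, the data is the numeral of the count. -/
theorem foldl_unaryStep (l : List ℕ) (p : Opaque × ℕ) :
    ∃ d, (l.foldl (fun p _ => unaryStep p) p).2 = p.2 + d ∧
      p.1.val = (Data.cons .nil)^[d] (l.foldl (fun p _ => unaryStep p) p).1.val := by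
  induction l generalizing p with
  | nil => exact ⟨0, rfl, rfl⟩
  | cons x l ih =>
    obtain ⟨d, h₁, h₂⟩ := ih (unaryStep p)
    rw [List.foldl_cons]
    obtain ⟨⟨a⟩, c⟩ := p
    rcases a with _ | ⟨_ | ⟨u, v⟩, b⟩
    · exact ⟨d, h₁, h₂⟩
    · refine ⟨d + 1, by rw [h₁]; simp [unaryStep, Data.isNil, Data.hd]; omega, ?_⟩
      rw [Function.iterate_succ_apply', ← h₂]
      rfl
    · exact ⟨d, h₁, h₂⟩

theorem foldl_unaryStep_ofNat (l : List ℕ) (i c : ℕ) (h : i ≤ l.length) :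
    l.foldl (fun p _ => unaryStep p) (⟨Data.ofNat i⟩, c) = (⟨.nil⟩, c + i) := by
  induction l generalizing i c with
  | nil => obtain rfl := Nat.le_zero.1 h; rfl
  | cons x l ih =>
    rw [List.foldl_cons]
    rcases i with _ | i
    · exact ih 0 c (Nat.zero_le _)
    · rw [show c + (i + 1) = c + 1 + i by omega]
      exact ih i (c + 1) (by simpa using h)

theorem unaryIdx_ofNat {n i : ℕ} (h : i < n) : unaryIdx n ⟨Data.ofNat i⟩ = i := by
  rw [unaryIdx, foldl_unaryStep_ofNat _ _ _ (by simpa using h.le)]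
  simp [Data.isNil]

theorem eq_ofNat_of_unaryIdx {n : ℕ} {a : Opaque} (h : unaryIdx n a < n) :
    a.val = Data.ofNat (unaryIdx n a) := by
  obtain ⟨d, h₁, h₂⟩ := foldl_unaryStep (List.range n) (a, 0)
  unfold unaryIdx at h ⊢
  rcases hx : ((List.range n).foldl (fun p _ => unaryStep p) (a, 0)).1.val with _ | ⟨u, v⟩
  · rw [hx] at h₂
    rw [h₁, ofNat_eq_iterate]
    simpa [Data.isNil] using h₂
  · rw [hx] at h
    simp [Data.isNil] at h

@[fun_prop]
theorem PT.unaryIdx {α : Type} [Enc α] {f : α → ℕ} {g : α → Opaque} (hf : PT f) (hg : PT g) :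
    PT (fun a => unaryIdx (f a) (g a)) := by
  have h : PT (fun p : ℕ × Opaque => (List.range p.1).foldl
      (fun p _ => unaryStep p) (p.2, 0)) := by
    refine PT.foldl (f := fun _ p _ => unaryStep p) (by unfold unaryStep; fun_prop) (by fun_prop)
      (by fun_prop) _ (.const 1) fun a b c => ?_
    unfold unaryStep
    cases b.1.val.isNil || !(Opaque.mk b.1.val.hd).val.isNil
    · simp only [cond_false, sz_pair, sz_nat]
      exact (Nat.add_right_comm _ _ _ ▸ le_rfl)
    · simp
  have h' : PT (fun p : ℕ × Opaque => PCC.unaryIdx p.1 p.2) := by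
    unfold PCC.unaryIdx; fun_prop
  exact h'.comp (hf.pair hg)

theorem sameClusterOracle_unaryIdx {n : ℕ} (C : Setoid (Fin n)) {a b : Opaque}
    (ha : unaryIdx n a < n) (hb : unaryIdx n b < n) :
    sameClusterOracle C a.val b.val = true ↔ C ⟨unaryIdx n a, ha⟩ ⟨unaryIdx n b, hb⟩ := by
  simp only [sameClusterOracle, decide_eq_true_eq]
  constructor
  · rintro ⟨i, j, h₁, h₂, h₃⟩
    have e₁ : (⟨unaryIdx n a, ha⟩ : Fin n) = i :=
      Fin.ext (ofNat_injective ((eq_ofNat_of_unaryIdx ha).symm.trans h₁))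
    have e₂ : (⟨unaryIdx n b, hb⟩ : Fin n) = j :=
      Fin.ext (ofNat_injective ((eq_ofNat_of_unaryIdx hb).symm.trans h₂))
    rwa [e₁, e₂]
  · exact fun h => ⟨_, _, eq_ofNat_of_unaryIdx ha, eq_ofNat_of_unaryIdx hb, h⟩

theorem sameClusterOracle_eq_false {n : ℕ} (C : Setoid (Fin n)) {a b : Opaque}
    (h : ¬ (unaryIdx n a < n ∧ unaryIdx n b < n)) : sameClusterOracle C a.val b.val = false := by
  simp only [sameClusterOracle, decide_eq_false_iff_not]
  rintro ⟨i, j, h₁, h₂, -⟩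
  obtain ⟨a⟩ := a
  obtain ⟨b⟩ := b
  subst h₁ h₂
  exact h ⟨by rw [unaryIdx_ofNat i.2]; exact i.2, by rw [unaryIdx_ofNat j.2]; exact j.2⟩

/-- Replaces the label `b` by `a`. -/
def relabel (a b l : ℕ) : ℕ := bif decide (l = b) then a else l

/-- Labels of the points, pairs of labels of separated points, and a flag that is lowered when a
positive answer concerns something that is not a point. -/
abbrev Labels := List ℕ × List (ℕ × ℕ) × Bool

/-- Takes a recorded answer into account. -/
def record (n : ℕ) (S : Labels) (p : (Opaque × Opaque) × Bool) : Labels :=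
  bif decide (unaryIdx n p.1.1 < n) && decide (unaryIdx n p.1.2 < n) then
    bif p.2 then
      (S.1.map (relabel (S.1.getD (unaryIdx n p.1.1) 0) (S.1.getD (unaryIdx n p.1.2) 0)),
        S.2.1.map (fun q =>
          (relabel (S.1.getD (unaryIdx n p.1.1) 0) (S.1.getD (unaryIdx n p.1.2) 0) q.1,
            relabel (S.1.getD (unaryIdx n p.1.1) 0) (S.1.getD (unaryIdx n p.1.2) 0) q.2)),
        S.2.2)
    else (S.1, (S.1.getD (unaryIdx n p.1.1) 0, S.1.getD (unaryIdx n p.1.2) 0) :: S.2.1, S.2.2)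
  else (S.1, S.2.1, S.2.2 && !p.2)

/-- The result of all recorded answers. -/
def labels (n : ℕ) (h : History) : Labels := h.foldl (record n) (List.range n, [], true)

/-- Whether the recorded answers are those for a clustering with clusters of at most `M` of `n`
points. -/
def consistent (M n : ℕ) (h : History) : Bool :=
  (labels n h).2.2 && ((labels n h).2.1.all fun q => !(decide (q.1 = q.2))) &&
    (labels n h).1.all fun l =>
      decide (((labels n h).1.filter fun l' => decide (l' = l)).length ≤ M)

theorem relabel_le {a b l n : ℕ} (ha : a ≤ n) (hl : l ≤ n) : relabel a b l ≤ n := by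
  unfold relabel
  cases decide (l = b) <;> simpa

/-- Relabelling uses only labels already present or the default 0 of `getD`, so the labels stay
small; this gives the size bound for the fold in `PT.labels`. -/
theorem labels_bound (n : ℕ) (h : History) :
    (labels n h).1.length = n ∧ (∀ l ∈ (labels n h).1, l ≤ n) ∧
      (labels n h).2.1.length ≤ h.length ∧ ∀ q ∈ (labels n h).2.1, q.1 ≤ n ∧ q.2 ≤ n := by
  induction h using List.reverseRecOn with
  | nil => simp [labels]; intro l hl; omega
  | append_singleton h p ih =>
    rw [labels, List.foldl_append]
    rw [← labels]
    simp only [List.foldl_cons, List.foldl_nil, List.length_append, List.length_singleton]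
    revert ih
    generalize labels n h = S
    rintro ⟨h₁, h₂, h₃, h₄⟩
    have hD : ∀ i, S.1.getD i 0 ≤ n := fun i => by
      rw [List.getD_eq_getElem?_getD]
      rcases hi : S.1[i]? with _ | l
      · simp
      · exact h₂ l (List.mem_of_getElem? hi)
    unfold record
    cases decide (unaryIdx n p.1.1 < n) && decide (unaryIdx n p.1.2 < n)
    · exact ⟨h₁, h₂, Nat.le_succ_of_le h₃, h₄⟩
    cases p.2
    · refine ⟨h₁, h₂, by simpa using h₃, fun q hq => ?_⟩
      rcases List.mem_cons.1 hq with rfl | hq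
      · exact ⟨hD _, hD _⟩
      · exact h₄ q hq
    · refine ⟨by simpa using h₁, fun l hl => ?_, by simpa using Nat.le_succ_of_le h₃,
        fun q hq => ?_⟩
      · obtain ⟨l', hl', rfl⟩ := List.mem_map.1 hl
        exact relabel_le (hD _) (h₂ l' hl')
      · obtain ⟨q', hq', rfl⟩ := List.mem_map.1 hq
        exact ⟨relabel_le (hD _) (h₄ q' hq').1, relabel_le (hD _) (h₄ q' hq').2⟩

@[fun_prop]
theorem PT.labels : PT (fun p : ℕ × History => labels p.1 p.2) := by
  have hg : PT (fun p : List ℕ × ℕ => p.1.getD p.2 0) :=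
    PT.getD 0 rfl (by fun_prop) (by fun_prop)
  have hr : PT (fun p : ℕ × ℕ × ℕ => relabel p.1 p.2.1 p.2.2) := by unfold relabel; fun_prop
  have hg' : ∀ {α : Type} [Enc α] {f : α → List ℕ} {g : α → ℕ}, PT f → PT g →
      PT (fun a => (f a).getD (g a) 0) := fun hf hg' => hg.comp (hf.pair hg')
  have hr' : ∀ {α : Type} [Enc α] {f g h : α → ℕ}, PT f → PT g → PT h →
      PT (fun a => relabel (f a) (g a) (h a)) := fun hf hg hh => hr.comp (hf.pair (hg.pair hh))
  refine PT.foldl_of_bound (f := fun p : ℕ × History => record p.1) ?_ (by fun_prop) (by fun_prop)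
    (fun p => sz p * (sz p + 1) + (sz p * (2 * sz p + 1 + 1) + 1) + 1) ?_ fun p l' hl' => ?_
  · unfold record
    have hd₁ : PT (fun p : (ℕ × History) × Labels × (Opaque × Opaque) × Bool =>
        p.2.1.1.getD (PCC.unaryIdx p.1.1 p.2.2.1.1) 0) := hg' (by fun_prop) (by fun_prop)
    have hd₂ : PT (fun p : (ℕ × History) × Labels × (Opaque × Opaque) × Bool =>
        p.2.1.1.getD (PCC.unaryIdx p.1.1 p.2.2.1.2) 0) := hg' (by fun_prop) (by fun_prop)
    refine PT.cond (by fun_prop) (PT.cond (by fun_prop) (PT.pair (PT.map (hr' ?_ ?_ ?_)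
      (by fun_prop)) (PT.pair (PT.map (PT.pair (hr' ?_ ?_ ?_) (hr' ?_ ?_ ?_)) (by fun_prop))
      (by fun_prop))) (PT.pair (by fun_prop) (PT.pair (PT.cons (PT.pair hd₁ hd₂) (by fun_prop))
      (by fun_prop)))) (by fun_prop)
    any_goals first | exact hd₁.comp PT.fst | exact hd₂.comp PT.fst | fun_prop
  · exact (((PolyBd.self.mul (PolyBd.self.add (.const 1))).add ((PolyBd.self.mul
      ((((PolyBd.const 2).mul PolyBd.self).add (.const 1)).add (.const 1))).add (.const 1))).add
      (.const 1))
  · obtain ⟨h₁, h₂, h₃, h₄⟩ := labels_bound p.1 l'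
    have hp : p.1 ≤ sz p := by simp only [sz_pair, sz_nat]; omega
    have hl : l'.length ≤ sz p := by
      have a := hl'.length_le
      have b := length_le_sz p.2
      simp only [sz_pair]
      omega
    change sz (PCC.labels p.1 l') ≤ _
    have a₁ := sz_list_le (PCC.labels p.1 l').1 (sz p) fun x hx => (h₂ x hx).trans hp
    have a₂ := sz_list_le (PCC.labels p.1 l').2.1 (2 * sz p + 1) fun x hx => by
      have := h₄ x hx
      simp only [sz_pair x, sz_nat]
      omega
    have a₃ := Nat.mul_le_mul_right (sz p + 1) (h₁.le.trans hp)
    have a₄ := Nat.mul_le_mul_right (2 * sz p + 1 + 1) (h₃.trans hl)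
    rw [sz_pair (PCC.labels p.1 l'), sz_pair (PCC.labels p.1 l').2, sz_bool]
    omega

@[fun_prop]
theorem PT.consistent (M : ℕ) : PT (fun p : ℕ × History => consistent M p.1 p.2) := by
  unfold PCC.consistent
  fun_prop

/-! ### Correctness of the consistency test -/

theorem getD_ofFn {n : ℕ} (lab : Fin n → ℕ) {i : ℕ} (hi : i < n) :
    (List.ofFn lab).getD i 0 = lab ⟨i, hi⟩ := by
  simp [List.getD_eq_getElem?_getD, hi]

theorem length_filter_ofFn {n : ℕ} (lab : Fin n → ℕ) (l : ℕ) :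
    ((List.ofFn lab).filter fun l' => decide (l' = l)).length = {i | lab i = l}.ncard := by
  rw [List.ofFn_eq_map, List.filter_map, List.length_map, Set.ncard_eq_toFinset_card',
    Set.toFinset_ofPred, Fin.univ_def]
  rfl

theorem labels_append (n : ℕ) (h : History) (p : (Opaque × Opaque) × Bool) :
    labels n (h ++ [p]) = record n (labels n h) p := by
  rw [labels, List.foldl_append]
  rfl

theorem record_invalid {n : ℕ} {S : Labels} {p : (Opaque × Opaque) × Bool}
    (h : ¬ (unaryIdx n p.1.1 < n ∧ unaryIdx n p.1.2 < n)) :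
    record n S p = (S.1, S.2.1, S.2.2 && !p.2) := by
  have : (decide (unaryIdx n p.1.1 < n) && decide (unaryIdx n p.1.2 < n)) = false := by
    simpa using h
  rw [record, this, cond_false]

theorem record_valid {n : ℕ} (lab : Fin n → ℕ) (N : List (ℕ × ℕ)) (ok : Bool)
    {p : (Opaque × Opaque) × Bool} (h₁ : unaryIdx n p.1.1 < n) (h₂ : unaryIdx n p.1.2 < n) :
    record n (List.ofFn lab, N, ok) p = bif p.2 then
      (List.ofFn fun i => relabel (lab ⟨_, h₁⟩) (lab ⟨_, h₂⟩) (lab i),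
        N.map (fun q => (relabel (lab ⟨_, h₁⟩) (lab ⟨_, h₂⟩) q.1,
          relabel (lab ⟨_, h₁⟩) (lab ⟨_, h₂⟩) q.2)), ok)
      else (List.ofFn lab, (lab ⟨_, h₁⟩, lab ⟨_, h₂⟩) :: N, ok) := by
  have : (decide (unaryIdx n p.1.1 < n) && decide (unaryIdx n p.1.2 < n)) = true := by
    simp [h₁, h₂]
  rw [record, this, cond_true, getD_ofFn lab h₁, getD_ofFn lab h₂, List.map_ofFn]
  rfl

theorem relabel_eq_or (a b l : ℕ) : (l = b ∧ relabel a b l = a) ∨ (l ≠ b ∧ relabel a b l = l) := by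
  by_cases h : l = b <;> simp [relabel, h]

/-- The labels never join points that are not joined by a clustering that agrees with the
answers. -/
theorem labels_of_agrees {n : ℕ} (C : Setoid (Fin n)) (h : History)
    (hC : Agrees (sameClusterOracle C) h) :
    ∃ (lab : Fin n → ℕ) (N : List (ℕ × ℕ)), labels n h = (List.ofFn lab, N, true) ∧
      (∀ i j, lab i = lab j → C i j) ∧
      ∀ q ∈ N, ∃ i j, lab i = q.1 ∧ lab j = q.2 ∧ ¬ C i j := by
  induction h using List.reverseRecOn with
  | nil =>
    refine ⟨fun i => i, [], ?_, fun i j hij => ?_, by simp⟩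
    · rw [labels, List.foldl_nil, List.ofFn_eq_map]
      simp
    · obtain rfl := Fin.ext hij
      exact C.refl' i
  | append_singleton h p ih =>
    rw [agrees_append] at hC
    obtain ⟨lab, N, e, h₁, h₂⟩ := ih hC.1
    have hp : p.2 = sameClusterOracle C p.1.1.val p.1.2.val := hC.2 p (by simp)
    rw [labels_append, e]
    by_cases hv : unaryIdx n p.1.1 < n ∧ unaryIdx n p.1.2 < n
    · rw [record_valid lab N true hv.1 hv.2]
      have hCp := sameClusterOracle_unaryIdx C hv.1 hv.2
      rw [← hp] at hCp
      cases hb : p.2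
      · rw [hb] at hCp
        refine ⟨lab, _, rfl, h₁, fun q hq => ?_⟩
        rcases List.mem_cons.1 hq with rfl | hq
        · exact ⟨_, _, rfl, rfl, fun hc => by simpa using hCp.2 hc⟩
        · exact h₂ q hq
      · replace hCp := hCp.1 hb
        refine ⟨_, _, rfl, fun i j hij => ?_, fun q hq => ?_⟩
        · rcases relabel_eq_or (lab ⟨_, hv.1⟩) (lab ⟨_, hv.2⟩) (lab i) with ⟨a, a'⟩ | ⟨a, a'⟩ <;>
          rcases relabel_eq_or (lab ⟨_, hv.1⟩) (lab ⟨_, hv.2⟩) (lab j) with ⟨b, b'⟩ | ⟨b, b'⟩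
          · exact h₁ _ _ (a.trans b.symm)
          · rw [a', b'] at hij
            exact C.trans' (h₁ _ _ a) (C.trans' (C.symm' hCp) (h₁ _ _ hij))
          · rw [a', b'] at hij
            exact C.trans' (h₁ _ _ hij) (C.trans' hCp (h₁ _ _ b.symm))
          · rw [a', b'] at hij
            exact h₁ _ _ hij
        · obtain ⟨q', hq', rfl⟩ := List.mem_map.1 hq
          obtain ⟨i, j, e₁, e₂, hij⟩ := h₂ q' hq'
          exact ⟨i, j, by rw [e₁], by rw [e₂], hij⟩
    · rw [record_invalid hv, hp, sameClusterOracle_eq_false C hv]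
      exact ⟨lab, N, rfl, h₁, h₂⟩

/-- The labels contain the information of all answers. -/
theorem labels_spec (n : ℕ) (h : History) :
    ∃ (lab : Fin n → ℕ) (N : List (ℕ × ℕ)) (ok : Bool), labels n h = (List.ofFn lab, N, ok) ∧
      (ok = true → ∀ p ∈ h, (∀ (h₁ : unaryIdx n p.1.1 < n) (h₂ : unaryIdx n p.1.2 < n),
        bif p.2 then lab ⟨_, h₁⟩ = lab ⟨_, h₂⟩ else (lab ⟨_, h₁⟩, lab ⟨_, h₂⟩) ∈ N) ∧
        (¬ (unaryIdx n p.1.1 < n ∧ unaryIdx n p.1.2 < n) → p.2 = false)) := by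
  induction h using List.reverseRecOn with
  | nil =>
    refine ⟨fun i => i, [], true, ?_, by simp⟩
    rw [labels, List.foldl_nil, List.ofFn_eq_map]
    simp
  | append_singleton h p ih =>
    obtain ⟨lab, N, ok, e, H⟩ := ih
    rw [labels_append, e]
    by_cases hv : unaryIdx n p.1.1 < n ∧ unaryIdx n p.1.2 < n
    · rw [record_valid lab N ok hv.1 hv.2]
      cases hb : p.2
      · refine ⟨lab, _, ok, rfl, fun hok p' hp' => ?_⟩
        rcases List.mem_append.1 hp' with hp' | hp'
        · refine ⟨fun a b => ?_, (H hok p' hp').2⟩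
          have := (H hok p' hp').1 a b
          cases hb' : p'.2
          · rw [hb'] at this
            exact List.mem_cons_of_mem _ this
          · rw [hb'] at this
            exact this
        · obtain rfl := List.mem_singleton.1 hp'
          exact ⟨fun a b => by simp [hb], fun h => absurd hv h⟩
      · refine ⟨_, _, ok, rfl, fun hok p' hp' => ?_⟩
        rcases List.mem_append.1 hp' with hp' | hp'
        · refine ⟨fun a b => ?_, (H hok p' hp').2⟩
          have := (H hok p' hp').1 a b
          cases hb' : p'.2
          · rw [hb'] at this
            exact List.mem_map.2 ⟨_, this, rfl⟩
          · rw [hb'] at this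
            simp only [cond_true] at this ⊢
            rw [this]
        · obtain rfl := List.mem_singleton.1 hp'
          refine ⟨fun a b => ?_, fun h => absurd hv h⟩
          simp only [hb, cond_true, relabel]
          by_cases hab : lab ⟨_, a⟩ = lab ⟨_, b⟩ <;> simp [hab]
    · rw [record_invalid hv]
      refine ⟨lab, N, _, rfl, fun hok p' hp' => ?_⟩
      rw [Bool.and_eq_true] at hok
      rcases List.mem_append.1 hp' with hp' | hp'
      · exact H hok.1 p' hp'
      · obtain rfl := List.mem_singleton.1 hp'
        exact ⟨fun a b => absurd ⟨a, b⟩ hv, fun _ => by simpa using hok.2⟩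

/-- If the test succeeds, the classes of equal labels form a suitable clustering. Conversely, these
classes refine every clustering `C` that agrees with the answers, so they are no larger than its
clusters, and points separated by `C` have different labels. -/
theorem consistent_iff (M n : ℕ) (h : History) : consistent M n h = true ↔
    ∃ C : Setoid (Fin n), ClustersAtMost M C ∧ Agrees (sameClusterOracle C) h := by
  constructor
  · intro hc
    obtain ⟨lab, N, ok, e, H⟩ := labels_spec n h
    simp only [consistent, e, Bool.and_eq_true, List.all_eq_true, length_filter_ofFn,
      decide_eq_true_eq, Bool.not_eq_true', decide_eq_false_iff_not] at hc
    obtain ⟨⟨hok, hN⟩, hM⟩ := hc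
    refine ⟨Setoid.ker lab, fun i => ?_, fun p hp => ?_⟩
    · refine le_trans (le_of_eq ?_) (hM (lab i) (List.mem_ofFn.2 ⟨i, rfl⟩))
      congr 1
      ext j
      exact eq_comm
    · obtain ⟨h₁, h₂⟩ := H hok p hp
      by_cases hv : unaryIdx n p.1.1 < n ∧ unaryIdx n p.1.2 < n
      · have := h₁ hv.1 hv.2
        rw [Bool.eq_iff_iff, sameClusterOracle_unaryIdx _ hv.1 hv.2, Setoid.ker_def]
        cases hb : p.2
        · rw [hb] at this
          simpa using hN _ this
        · rw [hb] at this
          simpa using this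
      · rw [h₂ hv, sameClusterOracle_eq_false _ hv]
  · rintro ⟨C, hM, hC⟩
    obtain ⟨lab, N, e, h₁, h₂⟩ := labels_of_agrees C h hC
    simp only [consistent, e, Bool.and_eq_true, List.all_eq_true, length_filter_ofFn,
      decide_eq_true_eq, Bool.not_eq_true', decide_eq_false_iff_not, true_and]
    refine ⟨fun q hq heq => ?_, fun l hl => ?_⟩
    · obtain ⟨i, j, e₁, e₂, hij⟩ := h₂ q hq
      exact hij (h₁ i j (by rw [e₁, e₂, heq]))
    · obtain ⟨i, rfl⟩ := List.mem_ofFn.1 hl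
      exact (Set.ncard_le_ncard (fun j hj => h₁ _ _ (Eq.symm hj)) (Set.toFinite _)).trans (hM i)

section

/-! ### The reduction -/

/-- The variables and the signs of the occurrences of literals in a formula. -/
abbrev Occs := List ℕ × List Bool

namespace Occs

/-- The variable of an occurrence. -/
def var (I : Occs) (k : ℕ) : ℕ := I.1.getD k 0

/-- The sign of an occurrence. -/
def sgn (I : Occs) (k : ℕ) : Bool := I.2.getD k false

/-- The number of occurrences. -/
def num (I : Occs) : ℕ := I.1.length

/-- The cyclically next occurrence of the same variable. -/
def next (I : Occs) (k : ℕ) : ℕ :=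
  ((List.range I.num).filter (fun j => decide (k < j) && decide (I.var j = I.var k)) ++
    (List.range I.num).filter (fun j => decide (I.var j = I.var k))).headD 0

/-- The tip `(t, k)` is one of those that the clause group `k'` may choose. The groups of a clause
are numbered like its three occurrences, and the first of them has to choose a true literal. -/
def eligible (I : Occs) (k' k t : ℕ) : Bool :=
  decide (k' / 3 = k / 3) && (!(decide (k' % 3 = 0)) || (decide (t = 1) == I.sgn k))

/-- Adjacency of the tip `(t, k)` and the partner `(t', k')`. -/
def tipPartner (I : Occs) (t k t' k' : ℕ) : Bool :=
  (decide (t' = 0) && decide (t = 0) && decide (k' = k)) ||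
    (decide (t' = 0) && decide (t = 1) && decide (k' = I.next k)) ||
    (decide (t' = 1) && decide (t < 2) && I.eligible k' k t) ||
    (decide (2 ≤ t) && decide (t' = t) && decide (k' = k))

/-- Adjacency of the tip `(t, k)` and the group `(t', k')`. -/
def tipGroup (I : Occs) (t k t' k' : ℕ) : Bool :=
  (decide (t' = 0) && decide (t < 2) && decide (k' = k)) ||
    (decide (t' = 1) && decide (t < 2) && I.eligible k' k t) ||
    (decide (2 ≤ t) && decide (t' = t) && decide (k' = k))

/-- Adjacency of the partner `(t, k)` and the group `(t', k')`. -/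
def partnerGroup (I : Occs) (t k t' k' : ℕ) : Bool :=
  (decide (t' = t) && decide (k' = k)) ||
    (decide (t' = 0) && decide (t = 0) && decide (k = I.next k'))

/-- Adjacency of points of different ranks, the first one of smaller rank. Points of rank `0` are
tips, those of rank `1` partners, and the others are copies of groups. -/
def link (I : Occs) (u v : ℕ × ℕ × ℕ) : Bool :=
  bif decide (u.1 = 0) then
    bif decide (v.1 = 1) then I.tipPartner u.2.1 u.2.2 v.2.1 v.2.2
    else I.tipGroup u.2.1 u.2.2 v.2.1 v.2.2
  else bif decide (u.1 = 1) then I.partnerGroup u.2.1 u.2.2 v.2.1 v.2.2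
  else decide (u.2.1 = v.2.1) && decide (u.2.2 = v.2.2)

/-- Adjacency. -/
def adj (I : Occs) (u v : ℕ × ℕ × ℕ) : Bool :=
  (decide (u.1 < v.1) && I.link u v) || (decide (v.1 < u.1) && I.link v u)

/-- The coordinates of a vertex. -/
def coord (I : Occs) (i : ℕ) : ℕ × ℕ × ℕ :=
  (i / (70 * I.num), i % (70 * I.num) / I.num, i % (70 * I.num) % I.num)

/-- The adjacency matrix. -/
def matrix (M : ℕ) (I : Occs) : List (List Bool) :=
  (List.range (M * (70 * I.num))).map fun i =>
    (List.range (M * (70 * I.num))).map fun j => I.adj (I.coord i) (I.coord j)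

end Occs

/-- An entry of a matrix. -/
def Opaque.entry (b : Opaque) (i : ℕ) : Opaque :=
  ⟨((List.range i).foldl (fun (x : Opaque) _ => (⟨x.val.tl⟩ : Opaque)) b).val.hd⟩

/-- The truth value of an occurrence, read off from a clustering. -/
def truth (I : Occs) (b : Opaque) (k : ℕ) : Bool :=
  !((b.entry (140 * I.num + k)).entry k).val.isNil

/-- The assignment read off from a clustering. -/
def assignment (I : Occs) (b : Opaque) (x : ℕ) : Bool :=
  (List.range I.num).any fun k => decide (I.var k = x) && truth I b k

/-- The clauses as lists of literals. -/
def clauses (φ : Formula) : List (List Literal) := φ.map fun c => [c.1, c.2.1, c.2.2]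

/-- The occurrences of literals. -/
def occs (φ : List (List Literal)) : Occs :=
  (φ.flatMap fun c => c.map fun l => l.1, φ.flatMap fun c => c.map fun l => l.2)

/-- Whether the assignment read off from a clustering satisfies the formula. -/
def accepts (φ : List (List Literal)) (b : Opaque) : Bool :=
  φ.all fun c => c.any fun l => assignment (occs φ) b l.1 == l.2

/-! ### Polynomial-time computability of the reduction -/

section Poly

variable {α : Type} [Enc α]

@[fun_prop]
theorem PT.num {f : α → Occs} (hf : PT f) : PT (fun a => (f a).num) := by
  unfold Occs.num; fun_prop

@[fun_prop]
theorem PT.var {f : α → Occs} {g : α → ℕ} (hf : PT f) (hg : PT g) :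
    PT (fun a => (f a).var (g a)) :=
  PT.getD 0 rfl (by fun_prop) hg

@[fun_prop]
theorem PT.sgn {f : α → Occs} {g : α → ℕ} (hf : PT f) (hg : PT g) :
    PT (fun a => (f a).sgn (g a)) :=
  PT.getD false rfl (by fun_prop) hg

@[fun_prop]
theorem PT.next {f : α → Occs} {g : α → ℕ} (hf : PT f) (hg : PT g) :
    PT (fun a => (f a).next (g a)) :=
  PT.headD 0 rfl (by fun_prop)

@[fun_prop]
theorem PT.eligible : PT (fun p : Occs × ℕ × ℕ × ℕ => p.1.eligible p.2.1 p.2.2.1 p.2.2.2) := by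
  unfold Occs.eligible; fun_prop

theorem PT.link : PT (fun p : Occs × (ℕ × ℕ × ℕ) × (ℕ × ℕ × ℕ) => p.1.link p.2.1 p.2.2) := by
  have he : ∀ {α : Type} [Enc α] {I : α → Occs} {a b c : α → ℕ}, PT I → PT a → PT b → PT c →
      PT (fun x => (I x).eligible (a x) (b x) (c x)) := fun h₁ h₂ h₃ h₄ =>
    PT.eligible.comp (h₁.pair (h₂.pair (h₃.pair h₄)))
  have h₁ : PT (fun p : Occs × (ℕ × ℕ × ℕ) × (ℕ × ℕ × ℕ) =>
      p.1.eligible p.2.2.2.2 p.2.1.2.2 p.2.1.2.1) :=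
    he (by fun_prop) (by fun_prop) (by fun_prop) (by fun_prop)
  unfold Occs.link Occs.tipPartner Occs.tipGroup Occs.partnerGroup
  fun_prop

theorem PT.matrix (M : ℕ) : PT (Occs.matrix M) := by
  have hl : ∀ {α : Type} [Enc α] {I : α → Occs} {u v : α → ℕ × ℕ × ℕ}, PT I → PT u → PT v →
      PT (fun x => (I x).link (u x) (v x)) := fun h₁ h₂ h₃ =>
    PT.link.comp (h₁.pair (h₂.pair h₃))
  have hc : PT (fun p : Occs × ℕ => p.1.coord p.2) := by unfold Occs.coord; fun_prop
  have hc₁ : PT (fun p : (Occs × ℕ) × ℕ => p.1.1.coord p.1.2) := hc.comp PT.fst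
  have hc₂ : PT (fun p : (Occs × ℕ) × ℕ => p.1.1.coord p.2) :=
    hc.comp (f := fun p : (Occs × ℕ) × ℕ => (p.1.1, p.2)) (by fun_prop)
  have h₁ := hl (I := fun p : (Occs × ℕ) × ℕ => p.1.1) (by fun_prop) hc₁ hc₂
  have h₂ := hl (I := fun p : (Occs × ℕ) × ℕ => p.1.1) (by fun_prop) hc₂ hc₁
  unfold Occs.matrix Occs.adj
  fun_prop

@[fun_prop]
theorem PT.entry {f : α → Opaque} {g : α → ℕ} (hf : PT f) (hg : PT g) :
    PT (fun a => (f a).entry (g a)) := by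
  have h : PT (fun p : Opaque × ℕ => p.1.entry p.2) := by
    have : PT (fun p : Opaque × ℕ =>
        (List.range p.2).foldl (fun (x : Opaque) _ => (⟨x.val.tl⟩ : Opaque)) p.1) :=
      PT.foldl (f := fun _ (x : Opaque) _ => (⟨x.val.tl⟩ : Opaque)) (by fun_prop) (by fun_prop)
        (by fun_prop) _ (.const 0) fun a b c => le_rfl
    unfold Opaque.entry
    fun_prop
  exact h.comp (hf.pair hg)

theorem PT.occs : PT occs := by
  unfold PCC.occs; fun_prop

theorem PT.accepts : PT (fun p : List (List Literal) × Opaque => accepts p.1 p.2) := by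
  have h₁ : PT (fun p : (Occs × Opaque) × ℕ => assignment p.1.1 p.1.2 p.2) := by
    unfold assignment truth; fun_prop
  have h₂ : PT (fun p : ((List (List Literal) × Opaque) × List Literal) × Literal =>
      assignment (PCC.occs p.1.1.1) p.1.1.2 p.2.1) :=
    h₁.comp (f := fun p : ((List (List Literal) × Opaque) × List Literal) × Literal =>
      ((PCC.occs p.1.1.1, p.1.1.2), p.2.1))
      ((((PT.occs.comp (f := fun p : ((List (List Literal) × Opaque) × List Literal) × Literal =>
        p.1.1.1) (by fun_prop))).pair (by fun_prop)).pair (by fun_prop))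
  unfold PCC.accepts
  fun_prop

end Poly

/-! ### Encodings of formulas, graphs and clusterings -/

theorem encode_eq (φ : Formula) : φ.encode = enc (clauses φ) := by
  simp only [Formula.encode, clauses, enc, List.map_map]
  rfl

/-- The test evaluates the formula at an explicit assignment, so it is sound for arbitrary data `b`,
in particular for outputs that stem from wrong answers. -/
theorem satisfiable_of_accepts {φ : Formula} {b : Opaque} (h : accepts (clauses φ) b = true) :
    φ.Satisfiable := by
  refine ⟨assignment (occs (clauses φ)) b, fun c hc => ?_⟩
  simp only [accepts, List.all_eq_true] at h
  have := h [c.1, c.2.1, c.2.2] (List.mem_map.2 ⟨c, hc, rfl⟩)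
  simpa [Formula.LitTrue] using this

theorem entry_ofList (l : List Data) (i : ℕ) (hi : i < l.length) :
    (Opaque.mk (Data.ofList l)).entry i = ⟨l[i]⟩ := by
  have : ∀ i ≤ l.length, (List.range i).foldl (fun (x : Opaque) _ => (⟨x.val.tl⟩ : Opaque))
      ⟨Data.ofList l⟩ = ⟨Data.ofList (l.drop i)⟩ := by
    intro i
    induction i with
    | zero => intro _; simp
    | succ i ih =>
      intro hi
      rw [List.range_succ, List.foldl_append, ih (by omega), List.drop_eq_getElem_cons hi]
      rfl
  rw [Opaque.entry, this i hi.le, List.drop_eq_getElem_cons hi]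
  rfl

open Classical in
theorem entry_encodeRel {n : ℕ} (r : Fin n → Fin n → Prop) (i j : Fin n) :
    ((Opaque.mk (encodeRel r)).entry i).entry j = ⟨Data.ofBool (decide (r i j))⟩ := by
  rw [encodeRel, entry_ofList _ _ (by simp), List.getElem_map, entry_ofList _ _ (by simp)]
  simp

/-- The graph. -/
def Occs.graph (M : ℕ) (I : Occs) : SimpleGraph (Fin (M * (70 * I.num))) where
  Adj i j := I.adj (I.coord i) (I.coord j) = true
  symm := ⟨fun i j h => by rw [Occs.adj, Bool.or_comm]; exact h⟩
  loopless := ⟨fun i h => by simp [Occs.adj] at h⟩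

theorem encodeRel_graph (M : ℕ) (I : Occs) :
    encodeRel (I.graph M).Adj = enc (I.matrix M) := by
  have key (n : ℕ) (f : Fin n → Data) (g : ℕ → Data) (h : ∀ i : Fin n, f i = g i) :
      (List.finRange n).map f = (List.range n).map g := by
    apply List.ext_getElem <;> simp [h]
  rw [encodeRel, Occs.matrix]
  change _ = Data.ofList _
  rw [List.map_map]
  refine congrArg _ (key _ _ _ fun i => ?_)
  change _ = Data.ofList _
  rw [List.map_map]
  refine congrArg _ (key _ _ _ fun j => ?_)
  cases h : I.adj (I.coord i) (I.coord j) <;> simp [Occs.graph, enc_bool, h]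

end

section

/-! ### Partitions into cliques of the largest possible size -/

section Perfect

variable {X : Type} {M : ℕ} {G : SimpleGraph X} {C C' : Setoid X}

/-- A partition into cliques with `M` points each. -/
def IsPerfect (M : ℕ) (G : SimpleGraph X) (C : Setoid X) : Prop :=
  (∀ x : X, {y | C x y}.ncard = M) ∧ ∀ x y, C x y → x ≠ y → G.Adj x y

theorem edgeDist_eq_one (x y : X) : edgeDist G x y = 1 ↔ ¬ G.Adj x y := by
  by_cases h : G.Adj x y <;> simp [edgeDist, h]

theorem edgeDist_eq_zero (x y : X) : edgeDist G x y = 0 ↔ G.Adj x y := by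
  by_cases h : G.Adj x y <;> simp [edgeDist, h]

theorem edgeDist_pos (x y : X) : 0 < edgeDist G x y ↔ ¬ G.Adj x y := by
  by_cases h : G.Adj x y <;> simp [edgeDist, h]

theorem edgeDist_nonpos (x y : X) : edgeDist G x y ≤ 0 ↔ G.Adj x y := by
  by_cases h : G.Adj x y <;> simp [edgeDist, h]

variable [Fintype X]

/-- Number of ordered pairs of distinct points in the same cluster. -/
noncomputable def samePairs (C : Setoid X) : ℕ := {p : X × X | p.1 ≠ p.2 ∧ C p.1 p.2}.ncard

theorem samePairs_add_card (C : Setoid X) :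
    samePairs C + Fintype.card X = ∑ x : X, {y | C x y}.ncard := by
  classical
  have h₁ : {p : X × X | C p.1 p.2}.ncard = ∑ x : X, {y | C x y}.ncard := by
    simp only [Set.ncard_eq_toFinset_card', Set.toFinset_ofPred, Finset.card_filter,
      Fintype.sum_prod_type]
  have h₂ : {p : X × X | p.1 = p.2}.ncard = Fintype.card X := by
    simp only [Set.ncard_eq_toFinset_card', Set.toFinset_ofPred, Finset.card_filter,
      Fintype.sum_prod_type]
    simp
  rw [← h₁, ← h₂, samePairs, ← Set.ncard_union_eq _ (Set.toFinite _) (Set.toFinite _)]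
  · congr 1
    ext ⟨x, y⟩
    by_cases h : x = y
    · subst h; simp
    · simp [h]
  · rw [Set.disjoint_left]
    rintro ⟨x, y⟩ h h'
    exact h.1 h'

/-- Pairs inside clusters are edges or count in `negLoss`; edges lie inside clusters or count in
`posLoss`. Up to the number of edges, the loss is therefore `2 * negLoss - samePairs`, and perfect
partitions are best possible for both terms. -/
theorem loss_add_samePairs (G : SimpleGraph X) (C : Setoid X) :
    loss G C + samePairs C = {p : X × X | G.Adj p.1 p.2}.ncard + 2 * negLoss G C := by
  have h₁ : samePairs C =
      {p : X × X | C p.1 p.2 ∧ G.Adj p.1 p.2}.ncard + negLoss G C := by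
    rw [samePairs, negLoss, ← Set.ncard_union_eq _ (Set.toFinite _) (Set.toFinite _)]
    · congr 1
      ext ⟨x, y⟩
      simp only [Set.mem_ofPred_eq, Set.mem_union, edgeDist_eq_one]
      have := G.ne_of_adj (a := x) (b := y)
      tauto
    · rw [Set.disjoint_left]
      rintro ⟨x, y⟩ h h'
      exact (edgeDist_eq_one _ _).1 h'.2.2 h.2
  have h₂ : {p : X × X | G.Adj p.1 p.2}.ncard =
      {p : X × X | C p.1 p.2 ∧ G.Adj p.1 p.2}.ncard + posLoss G C := by
    rw [posLoss, ← Set.ncard_union_eq _ (Set.toFinite _) (Set.toFinite _)]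
    · congr 1
      ext ⟨x, y⟩
      simp only [Set.mem_ofPred_eq, Set.mem_union, edgeDist_eq_zero]
      have := G.ne_of_adj (a := x) (b := y)
      tauto
    · rw [Set.disjoint_left]
      rintro ⟨x, y⟩ h h'
      exact h'.2.1 h.1
  rw [loss]
  omega

theorem IsPerfect.negLoss_eq (h : IsPerfect M G C) : negLoss G C = 0 := by
  rw [negLoss, Set.ncard_eq_zero (Set.toFinite _), Set.eq_empty_iff_forall_notMem]
  rintro ⟨x, y⟩ ⟨h₁, h₂, h₃⟩
  exact (edgeDist_eq_one _ _).1 h₃ (h.2 x y h₂ h₁)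

theorem IsPerfect.samePairs_eq (h : IsPerfect M G C) :
    samePairs C + Fintype.card X = Fintype.card X * M := by
  rw [samePairs_add_card, Finset.sum_congr rfl fun x _ => h.1 x]
  simp

theorem ClustersAtMost.samePairs_le (h : ClustersAtMost M C) :
    samePairs C + Fintype.card X ≤ Fintype.card X * M := by
  rw [samePairs_add_card]
  refine (Finset.sum_le_sum fun x _ => h x).trans ?_
  simp

theorem IsPerfect.isOptimal (h : IsPerfect M G C) : IsOptimal M G C := by
  refine ⟨fun x => (h.1 x).le, fun C' hC' => ?_⟩
  have h₁ := loss_add_samePairs G C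
  have h₂ := loss_add_samePairs G C'
  have h₃ := h.negLoss_eq
  have h₄ := h.samePairs_eq
  have h₅ := hC'.samePairs_le
  omega

/-- An optimal clustering has to attain equality in both estimates: all its clusters have `M`
points, and no pair inside a cluster is a non-edge. -/
theorem IsPerfect.of_isOptimal (h : IsPerfect M G C) (h' : IsOptimal M G C') :
    IsPerfect M G C' := by
  have h₁ := loss_add_samePairs G C
  have h₂ := loss_add_samePairs G C'
  have h₃ := h.negLoss_eq
  have h₄ := h.samePairs_eq
  have h₅ := h'.1.samePairs_le
  have h₆ := h'.2 C h.isOptimal.1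
  have h₇ : negLoss G C' = 0 := by omega
  have h₈ : samePairs C' + Fintype.card X = Fintype.card X * M := by omega
  refine ⟨fun x => ?_, fun x y hxy hne => ?_⟩
  · rw [samePairs_add_card] at h₈
    have : ∑ x : X, {y | C' x y}.ncard = ∑ x : X, M := by rw [h₈]; simp
    exact (Finset.sum_eq_sum_iff_of_le fun x _ => h'.1 x).1 this x (Finset.mem_univ x)
  · rw [negLoss, Set.ncard_eq_zero (Set.toFinite _), Set.eq_empty_iff_forall_notMem] at h₇
    by_contra hadj
    exact h₇ (x, y) ⟨hne, hxy, (edgeDist_eq_one _ _).2 hadj⟩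

theorem IsPerfect.isInformative (h : IsPerfect M G C)
    (hG : {p : X × X | G.Adj p.1 p.2}.ncard + 2 * Fintype.card X ≤ 2 * (Fintype.card X * M)) :
    IsInformative (edgeDist G) C 0 0 (1 / 2) := by
  constructor
  · have : {p : X × X | p.1 ≠ p.2 ∧ C p.1 p.2 ∧ 0 < edgeDist G p.1 p.2} = ∅ := by
      rw [Set.eq_empty_iff_forall_notMem]
      rintro ⟨x, y⟩ ⟨h₁, h₂, h₃⟩
      exact (edgeDist_pos _ _).1 h₃ (h.2 x y h₂ h₁)
    simp [this]
  · have h₁ : {p : X × X | p.1 ≠ p.2 ∧ edgeDist G p.1 p.2 ≤ 0} =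
        {p : X × X | G.Adj p.1 p.2} := by
      ext ⟨x, y⟩
      simp only [Set.mem_ofPred_eq, edgeDist_nonpos]
      exact ⟨fun h => h.2, fun h => ⟨h.ne, h⟩⟩
    have h₂ : {p : X × X | p.1 ≠ p.2 ∧ C p.1 p.2 ∧ edgeDist G p.1 p.2 ≤ 0} =
        {p : X × X | p.1 ≠ p.2 ∧ C p.1 p.2} := by
      ext ⟨x, y⟩
      simp only [Set.mem_ofPred_eq, edgeDist_nonpos]
      exact ⟨fun h => ⟨h.1, h.2.1⟩, fun h' => ⟨h'.1, h'.2, h.2 x y h'.2 h'.1⟩⟩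
    rw [h₁, h₂]
    have h₃ : {p : X × X | G.Adj p.1 p.2}.ncard ≤ 2 * samePairs C := by
      have := h.samePairs_eq
      omega
    have h₄ : ({p : X × X | G.Adj p.1 p.2}.ncard : ℝ) ≤ 2 * (samePairs C : ℝ) := by
      exact_mod_cast h₃
    rw [samePairs] at h₄
    linarith

end Perfect

end

section

/-! ### Occurrences of literals -/

theorem num_occs (φ : Formula) : (occs (clauses φ)).num = 3 * φ.length := by
  simp only [Occs.num, occs, clauses]
  induction φ with
  | nil => rfl
  | cons c φ ih =>
    simp only [List.map_cons, List.flatMap_cons, List.length_append, List.length_cons,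
      List.length_nil, List.map_nil]
    omega

theorem occs_lit (φ : Formula) (c : ℕ) (hc : c < φ.length) :
    (((occs (clauses φ)).var (3 * c), (occs (clauses φ)).sgn (3 * c)) = φ[c].1 ∧
    ((occs (clauses φ)).var (3 * c + 1), (occs (clauses φ)).sgn (3 * c + 1)) = φ[c].2.1 ∧
    ((occs (clauses φ)).var (3 * c + 2), (occs (clauses φ)).sgn (3 * c + 2)) = φ[c].2.2) := by
  induction φ generalizing c with
  | nil => simp at hc
  | cons d φ ih =>
    cases c with
    | zero => exact ⟨rfl, rfl, rfl⟩
    | succ c => exact ih c (by simpa using hc)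

/-- A formula is satisfied if every clause has an occurrence that is true. -/
theorem forall_clause_iff (φ : Formula) (v : ℕ → Bool) :
    (∀ c ∈ φ, v c.1.1 = c.1.2 ∨ v c.2.1.1 = c.2.1.2 ∨ v c.2.2.1 = c.2.2.2) ↔
      ∀ c < φ.length, ∃ p < 3, v ((occs (clauses φ)).var (3 * c + p)) =
        (occs (clauses φ)).sgn (3 * c + p) := by
  rw [List.forall_mem_iff_getElem]
  refine forall₂_congr fun c hc => ?_
  obtain ⟨h₁, h₂, h₃⟩ := occs_lit φ c hc
  rw [← h₁, ← h₂, ← h₃]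
  constructor
  · rintro (h | h | h)
    exacts [⟨0, by omega, h⟩, ⟨1, by omega, h⟩, ⟨2, by omega, h⟩]
  · rintro ⟨p, hp, h⟩
    interval_cases p
    exacts [.inl h, .inr (.inl h), .inr (.inr h)]

namespace Occs

variable {I : Occs} {k : ℕ}

/-- Either no occurrence of the variable is skipped, or `k` is the last one and `next k` the first.
-/
theorem next_spec (hk : k < I.num) : I.next k < I.num ∧ I.var (I.next k) = I.var k ∧
    ((k < I.next k ∧ ∀ j, k < j → j < I.next k → I.var j ≠ I.var k) ∨
      ((∀ j, k < j → j < I.num → I.var j ≠ I.var k) ∧ ∀ j < I.next k, I.var j ≠ I.var k)) := by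
  rw [next, List.headD_eq_head?_getD, List.head?_append, List.head?_filter, List.head?_filter]
  rcases h₁ : (List.range I.num).find? (fun j => decide (k < j) && decide (I.var j = I.var k))
    with _ | j
  · rcases h₂ : (List.range I.num).find? (fun j => decide (I.var j = I.var k)) with _ | j
    · rw [List.find?_range_eq_none] at h₂
      simpa using h₂ k hk
    · rw [List.find?_range_eq_none] at h₁
      rw [List.find?_range_eq_some] at h₂
      obtain ⟨a, b, c⟩ := h₂
      refine ⟨by simpa using b, by simpa using a, .inr ⟨fun i hi hi' => ?_, fun i hi => ?_⟩⟩
      · have := h₁ i hi'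
        simpa [hi] using this
      · have := c i (by simpa using hi)
        simpa using this
  · rw [List.find?_range_eq_some] at h₁
    obtain ⟨a, b, c⟩ := h₁
    simp only [Bool.and_eq_true, decide_eq_true_eq] at a
    refine ⟨by simpa using b, by simpa using a.2, .inl ⟨by simpa using a.1, fun i hi hi' => ?_⟩⟩
    have := c i (by simpa using hi')
    simpa [hi] using this

theorem next_inj {i j : ℕ} (hi : i < I.num) (hj : j < I.num) (h : I.next i = I.next j) :
    i = j := by
  wlog hij : i < j generalizing i j
  · rcases Nat.lt_or_ge j i with h' | h'
    · exact (this hj hi h.symm h').symm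
    · omega
  obtain ⟨a₁, a₂, a₃⟩ := next_spec hi
  obtain ⟨b₁, b₂, b₃⟩ := next_spec hj
  have hv : I.var j = I.var i := by rw [← b₂, ← h, a₂]
  rcases a₃ with ⟨c, d⟩ | ⟨c, d⟩
  · have hle : I.next i ≤ j := by
      by_contra hlt
      exact d j hij (by omega) hv
    rcases b₃ with ⟨e, f⟩ | ⟨e, f⟩
    · omega
    · exact absurd hv.symm (f i (by omega))
  · exact absurd hv (c j hij hj)

theorem next_induction {P : ℕ → Prop} (h : ∀ k < I.num, P (I.next k) → P k) {k' : ℕ}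
    (hk : k < I.num) (hk' : k' < I.num) (hv : I.var k = I.var k') (hP : P k') : P k := by
  -- Indices up to `k'` reach `k'` by going upwards. Any other index goes up to the last occurrence
  -- and then to the first one, which is not beyond `k'`; this is `h₂`.
  have h₁ : ∀ d k, k < I.num → k + d = k' → I.var k = I.var k' → P k := by
    intro d
    induction d using Nat.strong_induction_on with
    | _ d ih =>
    intro k hk hd hv
    rcases Nat.eq_zero_or_pos d with rfl | hd0
    · rwa [show k = k' by omega]
    · obtain ⟨a₁, a₂, a₃⟩ := next_spec hk
      rcases a₃ with ⟨c, e⟩ | ⟨c, e⟩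
      · have hle : I.next k ≤ k' := by
          by_contra hlt
          exact e k' (by omega) (by omega) hv.symm
        exact h k hk (ih (k' - I.next k) (by omega) _ a₁ (by omega) (a₂.trans hv))
      · exact absurd hv.symm (c k' (by omega) hk')
  have h₂ : ∀ d k, k < I.num → k + d = I.num → I.var k = I.var k' → P k := by
    intro d
    induction d using Nat.strong_induction_on with
    | _ d ih =>
    intro k hk hd hv
    obtain ⟨a₁, a₂, a₃⟩ := next_spec hk
    rcases a₃ with ⟨c, e⟩ | ⟨c, e⟩
    · exact h k hk (ih (I.num - I.next k) (by omega) _ a₁ (by omega) (a₂.trans hv))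
    · have hle : I.next k ≤ k' := by
        by_contra hlt
        exact e k' (by omega) hv.symm
      exact h k hk (h₁ (k' - I.next k) _ a₁ (by omega) (a₂.trans hv))
  exact h₂ (I.num - k) k hk (by omega) hv

theorem exists_prev (I : Occs) : ∃ prev : ℕ → ℕ, ∀ k < I.num, prev k < I.num ∧
    I.next (prev k) = k := by
  have h : ∀ k : Fin I.num, ∃ j : Fin I.num, I.next j = k := by
    have hinj : Function.Injective fun j : Fin I.num => (⟨I.next j, (next_spec j.2).1⟩ : Fin I.num) :=
      fun i j hij => Fin.ext (next_inj i.2 j.2 (by simpa using hij))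
    intro k
    obtain ⟨j, hj⟩ := Finite.surjective_of_injective hinj k
    exact ⟨j, congrArg Fin.val hj⟩
  choose f hf using h
  exact ⟨fun k => if hk : k < I.num then f ⟨k, hk⟩ else 0, fun k hk => by
    simp only [hk, dif_pos]
    exact ⟨(f _).2, hf _⟩⟩

/-! ### Coordinates -/

/-- The range of the coordinates. -/
def Valid (M : ℕ) (I : Occs) (a : ℕ × ℕ × ℕ) : Prop := a.1 < M ∧ a.2.1 < 70 ∧ a.2.2 < I.num

theorem valid_coord {M i : ℕ} (hi : i < M * (70 * I.num)) : Valid M I (I.coord i) := by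
  have hN : 0 < I.num := by
    rcases Nat.eq_zero_or_pos I.num with h | h
    · simp [h] at hi
    · exact h
  refine ⟨Nat.div_lt_of_lt_mul (by rwa [Nat.mul_comm]), Nat.div_lt_of_lt_mul ?_, Nat.mod_lt _ hN⟩
  rw [Nat.mul_comm I.num]
  exact Nat.mod_lt _ (by omega)

theorem coord_injective {i j : ℕ} (h : I.coord i = I.coord j) : i = j := by
  simp only [coord, Prod.mk.injEq] at h
  obtain ⟨h₁, h₂, h₃⟩ := h
  have h₄ : i % (70 * I.num) = j % (70 * I.num) := by
    rw [← Nat.div_add_mod (i % (70 * I.num)) I.num, h₂, h₃, Nat.div_add_mod]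
  rw [← Nat.div_add_mod i (70 * I.num), h₁, h₄, Nat.div_add_mod]

theorem coord_mk {r t k : ℕ} (ht : t < 70) (hk : k < I.num) :
    I.coord (r * (70 * I.num) + (t * I.num + k)) = (r, t, k) := by
  have h : t * I.num + k < 70 * I.num := by nlinarith
  have h₁ : (r * (70 * I.num) + (t * I.num + k)) % (70 * I.num) = t * I.num + k := by
    rw [Nat.mul_comm r, Nat.mul_add_mod, Nat.mod_eq_of_lt h]
  have h₂ : (r * (70 * I.num) + (t * I.num + k)) / (70 * I.num) = r := by
    rw [Nat.mul_comm r, Nat.mul_add_div (by omega), Nat.div_eq_of_lt h, Nat.add_zero]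
  rw [coord, h₁, h₂, Nat.mul_comm t, Nat.mul_add_div (by omega), Nat.mul_add_mod,
    Nat.div_eq_of_lt hk, Nat.mod_eq_of_lt hk, Nat.add_zero]

theorem mk_lt {M r t k : ℕ} (hr : r < M) (ht : t < 70) (hk : k < I.num) :
    r * (70 * I.num) + (t * I.num + k) < M * (70 * I.num) := by
  have h : t * I.num + k < 70 * I.num := by nlinarith
  have : (r + 1) * (70 * I.num) ≤ M * (70 * I.num) := Nat.mul_le_mul_right _ hr
  nlinarith

end Occs

end

section

/-! ### Partitions into cliques yield satisfying assignments -/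

namespace Occs

variable {I : Occs} {M : ℕ}

/-- Being in the same cluster, in terms of coordinates. -/
def Same (C : Setoid (Fin (M * (70 * I.num)))) (a b : ℕ × ℕ × ℕ) : Prop :=
  ∃ u v : Fin (M * (70 * I.num)), I.coord u = a ∧ I.coord v = b ∧ C u v

section Same

variable {C : Setoid (Fin (M * (70 * I.num)))} {a b c : ℕ × ℕ × ℕ}

theorem Same.symm (h : I.Same C a b) : I.Same C b a := by
  obtain ⟨u, v, hu, hv, h⟩ := h
  exact ⟨v, u, hv, hu, C.symm' h⟩

theorem Same.trans (h : I.Same C a b) (h' : I.Same C b c) : I.Same C a c := by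
  obtain ⟨u, v, hu, hv, h⟩ := h
  obtain ⟨v', w, hv', hw, h'⟩ := h'
  obtain rfl := Fin.ext (coord_injective (hv.trans hv'.symm))
  exact ⟨u, w, hu, hw, C.trans' h h'⟩

theorem Same.adj (hC : IsPerfect M (I.graph M) C) (h : I.Same C a b) (hab : a ≠ b) :
    I.adj a b = true := by
  obtain ⟨u, v, rfl, rfl, h⟩ := h
  exact hC.2 u v h fun e => hab (by rw [e])

theorem Same.link (hC : IsPerfect M (I.graph M) C) (h : I.Same C a b) (hab : a.1 < b.1) :
    I.link a b = true := by
  have := h.adj hC fun e => by rw [e] at hab; omega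
  simpa [Occs.adj, hab, Nat.lt_asymm hab] using this

theorem Same.eq (hC : IsPerfect M (I.graph M) C) (h : I.Same C a b) (hab : a.1 = b.1) :
    a = b := by
  by_contra hne
  have := h.adj hC hne
  simp [Occs.adj, hab] at this

theorem valid_mk {r t k : ℕ} (hr : r < M) (ht : t < 70) (hk : k < I.num) :
    Valid M I (r, t, k) := ⟨hr, ht, hk⟩

/-- A cluster has `M` points, and their ranks are distinct since points of equal rank are not
adjacent; hence all `M` ranks occur. -/
theorem exists_same (hC : IsPerfect M (I.graph M) C) (ha : Valid M I a) {r : ℕ} (hr : r < M) :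
    ∃ t k, t < 70 ∧ k < I.num ∧ I.Same C a (r, t, k) := by
  obtain ⟨r₀, t₀, k₀⟩ := a
  obtain ⟨h₁, h₂, h₃⟩ := ha
  let u : Fin (M * (70 * I.num)) := ⟨_, mk_lt h₁ h₂ h₃⟩
  have hu : I.coord u = (r₀, t₀, k₀) := coord_mk h₂ h₃
  have hinj : Set.InjOn (fun v : Fin (M * (70 * I.num)) => (I.coord v).1) {v | C u v} := by
    intro v hv w hw hvw
    exact Fin.ext (coord_injective (Same.eq hC ⟨v, w, rfl, rfl, C.trans' (C.symm' hv) hw⟩ hvw))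
  have himg : (fun v : Fin (M * (70 * I.num)) => (I.coord v).1) '' {v | C u v} = Set.Iio M := by
    refine Set.eq_of_subset_of_ncard_le ?_ ?_ (Set.finite_Iio M)
    · rintro _ ⟨v, -, rfl⟩
      exact (valid_coord v.2).1
    · rw [hinj.ncard_image, hC.1 u, Set.ncard_eq_toFinset_card']
      simp
  have hr' : r ∈ Set.Iio M := hr
  rw [← himg] at hr'
  obtain ⟨v, hv, rfl⟩ := hr'
  exact ⟨_, _, (valid_coord v.2).2.1, (valid_coord v.2).2.2, u, v, hu, rfl, hv⟩

/-- The tip and the partner in the cluster of a variable group are adjacent to the group and to each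
other, and the tip determines the partner. -/
theorem group_cases (hM : 3 ≤ M) (hC : IsPerfect M (I.graph M) C) {k : ℕ} (hk : k < I.num) :
    (I.Same C (2, 0, k) (0, 0, k) ∧ I.Same C (2, 0, k) (1, 0, k)) ∨
      (I.Same C (2, 0, k) (0, 1, k) ∧ I.Same C (2, 0, k) (1, 0, I.next k)) := by
  obtain ⟨t, k₁, ht, hk₁, h₁⟩ := exists_same hC (a := (2, 0, k)) (valid_mk (by omega) (by omega) hk)
    (r := 0) (by omega)
  obtain ⟨t', k₂, ht', hk₂, h₂⟩ := exists_same hC (a := (2, 0, k)) (valid_mk (by omega) (by omega) hk)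
    (r := 1) (by omega)
  have e₁ := h₁.symm.link hC (by simp)
  have e₂ := h₂.symm.link hC (by simp)
  have e₃ := (h₁.symm.trans h₂).link hC (by simp)
  simp [Occs.link, tipGroup] at e₁
  simp [Occs.link, partnerGroup] at e₂
  simp [Occs.link, tipPartner] at e₃
  obtain rfl : t' = 0 := by
    rcases e₂ with e₂ | e₂
    · exact e₂.1.symm
    · exact e₂.1
  rcases e₁ with ⟨e₁, rfl⟩ | ⟨e₁, rfl, rfl⟩
  · obtain rfl | rfl : t = 0 ∨ t = 1 := by omega
    · simp only [true_and, zero_ne_one, and_true, false_and, or_false, and_false] at e₃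
      have e₄ : k₂ = k := by simpa using e₃
      rw [e₄] at h₂
      exact .inl ⟨h₁, h₂⟩
    · have e₄ : k₂ = I.next k := by simpa using e₃
      rw [e₄] at h₂
      exact .inr ⟨h₁, h₂⟩
  · omega

theorem same_next (hM : 3 ≤ M) (hC : IsPerfect M (I.graph M) C) {k : ℕ} (hk : k < I.num)
    (h : I.Same C (2, 0, I.next k) (0, 0, I.next k)) : I.Same C (2, 0, k) (0, 0, k) := by
  have hk' := (next_spec hk).1
  rcases group_cases hM hC hk with ⟨h₁, h₂⟩ | ⟨h₁, h₂⟩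
  · exact h₁
  · rcases group_cases hM hC hk' with ⟨h₃, h₄⟩ | ⟨h₃, h₄⟩
    -- Both groups claim the partner of `next k`, so they coincide. This happens only if the
    -- variable occurs once, and then `h` is the claim itself.
    · have := (h₂.trans h₄.symm).eq hC rfl
      simp only [Prod.mk.injEq, true_and] at this
      rwa [← this] at h
    · have := (h.symm.trans h₃).eq hC rfl
      simp at this

theorem same_iff_of_var_eq (hM : 3 ≤ M) (hC : IsPerfect M (I.graph M) C) {k k' : ℕ}
    (hk : k < I.num) (hk' : k' < I.num) (hv : I.var k = I.var k') :
    I.Same C (2, 0, k) (0, 0, k) ↔ I.Same C (2, 0, k') (0, 0, k') :=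
  ⟨fun h => next_induction (P := fun k => I.Same C (2, 0, k) (0, 0, k))
    (fun _ hk h => same_next hM hC hk h) hk' hk hv.symm h,
   fun h => next_induction (P := fun k => I.Same C (2, 0, k) (0, 0, k))
    (fun _ hk h => same_next hM hC hk h) hk hk' hv h⟩

/-- The first clause group takes a tip whose index matches the sign of its occurrence; the variable
group of this occurrence is left with the other tip, which makes the literal true. -/
theorem exists_true_occurrence (hM : 3 ≤ M) (hC : IsPerfect M (I.graph M) C) {c : ℕ}
    (hc : 3 * c < I.num) : ∃ k < I.num, k / 3 = c ∧
      (I.Same C (2, 0, k) (0, 0, k) ↔ I.sgn k = true) := by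
  obtain ⟨t, k, ht, hk, h₁⟩ := exists_same hC (a := (2, 1, 3 * c)) (valid_mk (by omega) (by omega) hc)
    (r := 0) (by omega)
  have e₁ := h₁.symm.link hC (by simp)
  simp [Occs.link, tipGroup, eligible] at e₁
  rcases e₁ with ⟨e₁, e₂, e₃⟩ | ⟨e₁, rfl, rfl⟩
  · refine ⟨k, hk, e₂.symm, ?_⟩
    rw [← e₃]
    have hne : ∀ t', ¬ (I.Same C (2, 0, k) (0, t', k) ∧ I.Same C (2, 1, 3 * c) (0, t', k)) := by
      rintro t' ⟨a, b⟩
      have := (a.trans b.symm).eq hC rfl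
      simp at this
    rcases group_cases hM hC hk with ⟨h₃, h₄⟩ | ⟨h₃, h₄⟩
    · interval_cases t
      · exact absurd ⟨h₃, h₁⟩ (hne 0)
      · simpa using h₃
    · interval_cases t
      · simp only [zero_ne_one, decide_false, Bool.false_eq_true, iff_false]
        exact fun h => absurd ⟨h, h₁⟩ (hne 0)
      · exact absurd ⟨h₃, h₁⟩ (hne 1)
  · omega

open Classical in
theorem truth_encodeRel (hM : 3 ≤ M) (C : Setoid (Fin (M * (70 * I.num)))) {k : ℕ}
    (hk : k < I.num) : truth I ⟨encodeRel fun x y => C x y⟩ k =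
      decide (I.Same C (2, 0, k) (0, 0, k)) := by
  -- A rank has `70 * I.num` vertices, so `140 * I.num + k` is the vertex `(2, 0, k)`, and `k` is
  -- `(0, 0, k)`.
  have e₁ : 140 * I.num + k = 2 * (70 * I.num) + (0 * I.num + k) := by ring
  have e₂ : k = 0 * (70 * I.num) + (0 * I.num + k) := by ring
  have h₁ : 140 * I.num + k < M * (70 * I.num) := by
    rw [e₁]; exact mk_lt (by omega) (by omega) hk
  have h₂ : k < M * (70 * I.num) := by
    conv_lhs => rw [e₂]
    exact mk_lt (by omega) (by omega) hk
  have c₁ : I.coord (140 * I.num + k) = (2, 0, k) := by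
    rw [e₁]; exact coord_mk (by omega) hk
  have c₂ : I.coord k = (0, 0, k) := by
    conv_lhs => rw [e₂]
    exact coord_mk (by omega) hk
  have h := entry_encodeRel (n := M * (70 * I.num)) (fun x y => C x y) ⟨_, h₁⟩ ⟨_, h₂⟩
  simp only at h
  rw [truth, h]
  have hs : I.Same C (2, 0, k) (0, 0, k) ↔ C ⟨_, h₁⟩ ⟨_, h₂⟩ := by
    constructor
    · rintro ⟨u, v, hu, hv, huv⟩
      obtain rfl : u = ⟨_, h₁⟩ := Fin.ext (coord_injective (hu.trans c₁.symm))
      obtain rfl : v = ⟨_, h₂⟩ := Fin.ext (coord_injective (hv.trans c₂.symm))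
      exact huv
    · exact fun h => ⟨_, _, c₁, c₂, h⟩
  by_cases hc : C ⟨_, h₁⟩ ⟨_, h₂⟩
  · simp [hs, hc, Data.ofBool, Data.isNil]
  · simp [hs, hc, Data.ofBool, Data.isNil]

end Same

end Occs

open Occs in
theorem accepts_of_isPerfect {M : ℕ} (hM : 3 ≤ M) (φ : Formula)
    {C : Setoid (Fin (M * (70 * (occs (clauses φ)).num)))}
    (hC : IsPerfect M ((occs (clauses φ)).graph M) C) :
    accepts (clauses φ) ⟨encodeRel fun x y => C x y⟩ = true := by
  classical
  have hnum := num_occs φ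
  have h₀ : ∀ k < (occs (clauses φ)).num,
      assignment (occs (clauses φ)) ⟨encodeRel fun x y => C x y⟩ ((occs (clauses φ)).var k) =
        decide ((occs (clauses φ)).Same C (2, 0, k) (0, 0, k)) := by
    intro k hk
    rw [Bool.eq_iff_iff, assignment, List.any_eq_true, decide_eq_true_iff]
    constructor
    · rintro ⟨k', h₁, h₂⟩
      rw [Bool.and_eq_true, decide_eq_true_iff, truth_encodeRel hM C (List.mem_range.1 h₁),
        decide_eq_true_iff] at h₂
      exact (same_iff_of_var_eq hM hC (List.mem_range.1 h₁) hk h₂.1).1 h₂.2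
    · intro h
      refine ⟨k, List.mem_range.2 hk, ?_⟩
      rw [truth_encodeRel hM C hk]
      simpa using h
  have h₁ := (forall_clause_iff φ
    (assignment (occs (clauses φ)) ⟨encodeRel fun x y => C x y⟩)).2 fun c hc => by
      obtain ⟨k, hk, hkc, h⟩ := exists_true_occurrence hM hC (c := c) (by omega)
      refine ⟨k % 3, Nat.mod_lt _ (by omega), ?_⟩
      rw [← hkc, Nat.div_add_mod, h₀ k hk, Bool.eq_iff_iff, decide_eq_true_iff, h]
  simp only [accepts, List.all_eq_true]
  intro c hc
  obtain ⟨d, hd, rfl⟩ := List.mem_map.1 hc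
  simpa using h₁ d hd

end

section

/-! ### Satisfying assignments yield partitions into cliques -/

namespace Occs

variable {I : Occs} {M : ℕ}

/-- The choices of the groups under an assignment: `tr k` is the truth value of the variable of the
occurrence `k`, `prev` is inverse to `next`, and `p c` is the position of a true literal in the
clause `c`. -/
structure Choice (I : Occs) where
  tr : ℕ → Bool
  prev : ℕ → ℕ
  p : ℕ → ℕ
  tr_next : ∀ k < I.num, tr (I.next k) = tr k
  prev_lt : ∀ k < I.num, prev k < I.num
  next_prev : ∀ k < I.num, I.next (prev k) = k
  p_lt : ∀ c, p c < 3
  tr_p : ∀ k < I.num, k % 3 = p (k / 3) → tr k = I.sgn k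
  num_mod : I.num % 3 = 0

namespace Choice

variable (ch : Choice I)

/-- The clause group that chooses the free tip of an occurrence. -/
def slot (k : ℕ) : ℕ :=
  3 * (k / 3) + if k % 3 = ch.p (k / 3) then 0 else if k % 3 = 0 then ch.p (k / 3) else k % 3

/-- The group whose cluster contains a point. -/
def group (a : ℕ × ℕ × ℕ) : ℕ × ℕ :=
  if 2 ≤ a.2.1 ∨ 2 ≤ a.1 then a.2
  else if a.1 = 1 then
    if a.2.1 = 0 then (0, if ch.tr a.2.2 then a.2.2 else ch.prev a.2.2) else a.2
  else if decide (a.2.1 = 1) ≠ ch.tr a.2.2 then (0, a.2.2) else (1, ch.slot a.2.2)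

theorem slot_div (k : ℕ) : ch.slot k / 3 = k / 3 := by
  have := ch.p_lt (k / 3)
  unfold slot
  split_ifs <;> omega

theorem slot_mod (k : ℕ) : ch.slot k % 3 =
    if k % 3 = ch.p (k / 3) then 0 else if k % 3 = 0 then ch.p (k / 3) else k % 3 := by
  have := ch.p_lt (k / 3)
  unfold slot
  split_ifs <;> omega

theorem slot_lt {k : ℕ} (hk : k < I.num) : ch.slot k < I.num := by
  have h₁ := ch.slot_div k
  have h₂ := ch.num_mod
  omega

/-- Within a clause `slot` transposes the positions 0 and `p`, which sends the chosen true literal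
to the first clause group. -/
theorem slot_inj {k k' : ℕ} (h : ch.slot k = ch.slot k') : k = k' := by
  have h₁ : k / 3 = k' / 3 := by rw [← ch.slot_div k, h, ch.slot_div]
  have h₂ := ch.slot_mod k
  have h₃ := ch.slot_mod k'
  rw [h, h₃, h₁] at h₂
  have h₄ : k % 3 = k' % 3 := by
    split_ifs at h₂ <;> omega
  omega

theorem mod_of_slot_mod {k : ℕ} (h : ch.slot k % 3 = 0) : k % 3 = ch.p (k / 3) := by
  rw [slot_mod] at h
  split_ifs at h with h₁ h₂
  · exact h₁
  · omega
  · omega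

theorem tr_prev {k : ℕ} (hk : k < I.num) : ch.tr (ch.prev k) = ch.tr k := by
  rw [← ch.tr_next _ (ch.prev_lt k hk), ch.next_prev k hk]

theorem group_mem {a : ℕ × ℕ × ℕ} (ha : Valid M I a) :
    (ch.group a).1 < 70 ∧ (ch.group a).2 < I.num := by
  obtain ⟨r, t, k⟩ := a
  obtain ⟨h₁, h₂, h₃⟩ := ha
  have := ch.slot_lt h₃
  have := ch.prev_lt k h₃
  simp only [group] at h₁ h₂ h₃ ⊢
  split_ifs <;> simp <;> omega

/-- One tip of an occurrence goes to its variable group, the other one to a clause group. The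
partners of a true variable stay in place and those of a false one move back by `prev`; these do not
collide, because `prev` preserves truth values. -/
theorem group_inj {a b : ℕ × ℕ × ℕ} (ha : Valid M I a) (hb : Valid M I b)
    (hab : a.1 = b.1) (h : ch.group a = ch.group b) : a = b := by
  obtain ⟨r, t, k⟩ := a
  obtain ⟨r', t', k'⟩ := b
  obtain ⟨-, h₂, h₃⟩ := ha
  obtain ⟨-, h₅, h₆⟩ := hb
  obtain rfl : r = r' := hab
  simp only at h₂ h₃ h₅ h₆
  have s := @slot_inj _ ch k k'
  have p₁ := ch.next_prev k h₃
  have p₂ := ch.next_prev k' h₆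
  have p₃ := ch.tr_prev h₃
  have p₄ := ch.tr_prev h₆
  simp only [group, ne_eq] at h
  have hb : ∀ {t t' : ℕ} {x : Bool}, t < 2 → t' < 2 → (decide (t = 1) = x ↔ decide (t' = 1) = x) →
      t = t' := by
    intro t t' x ht ht' h
    interval_cases t <;> interval_cases t' <;> cases x <;> simp_all
  split_ifs at h <;> simp only [Prod.mk.injEq] at h ⊢ <;> grind

/-- The delicate case is a free tip at the first group of its clause: its occurrence is then the
chosen true one, so the index of the tip, which encodes the truth value, matches the sign. -/
theorem link_of_group_eq {a b : ℕ × ℕ × ℕ} (ha : Valid M I a) (hb : Valid M I b)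
    (hab : a.1 < b.1) (h : ch.group a = ch.group b) : I.link a b = true := by
  obtain ⟨r, t, k⟩ := a
  obtain ⟨r', t', k'⟩ := b
  obtain ⟨-, h₂, h₃⟩ := ha
  obtain ⟨-, h₅, h₆⟩ := hb
  simp only at h₂ h₃ h₅ h₆ hab
  have p₁ := ch.next_prev k h₃
  have p₂ := ch.next_prev k' h₆
  have p₃ := ch.tr_prev h₃
  have p₄ := ch.tr_prev h₆
  have q₁ := ch.slot_div k
  have q₂ := @mod_of_slot_mod _ ch k
  have q₃ := ch.tr_p k h₃
  simp only [group, ne_eq] at h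
  have hb : ∀ {t : ℕ} {x : Bool}, t < 2 → decide (t = 1) = x → t = 0 ∧ x = false ∨ t = 1 ∧ x = true := by
    intro t x ht h
    interval_cases t <;> simp_all
  simp only [link, tipPartner, tipGroup, partnerGroup, eligible]
  split_ifs at h <;> simp only [Prod.mk.injEq] at h <;> grind

end Choice

/-- The partition into cliques given by the choices. -/
def Choice.clustering (ch : Choice I) (M : ℕ) : Setoid (Fin (M * (70 * I.num))) :=
  Setoid.ker fun u => ch.group (I.coord u)

theorem Choice.isPerfect (ch : Choice I) (M : ℕ) : IsPerfect M (I.graph M) (ch.clustering M) := by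
  constructor
  · intro u
    have hinj : Function.Injective fun v : Fin (M * (70 * I.num)) =>
        (((⟨(ch.group (I.coord v)).1, (ch.group_mem (valid_coord v.2)).1⟩,
          ⟨(ch.group (I.coord v)).2, (ch.group_mem (valid_coord v.2)).2⟩),
          ⟨(I.coord v).1, (valid_coord v.2).1⟩) : (Fin 70 × Fin I.num) × Fin M) := by
      intro v w h
      simp only [Prod.mk.injEq, Fin.mk.injEq] at h
      exact Fin.ext (coord_injective (ch.group_inj (valid_coord v.2) (valid_coord w.2) h.2
        (Prod.ext h.1.1 h.1.2)))
    -- There are as many vertices as pairs of a group and a rank, so every group receives a point of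
    -- every rank.
    have hsurj := (Fintype.bijective_iff_injective_and_card _).2 ⟨hinj, by simp [Nat.mul_comm]⟩
    have hinj' : Set.InjOn (fun v : Fin (M * (70 * I.num)) => (I.coord v).1)
        {v | ch.clustering M u v} := by
      intro v hv w hw h
      exact Fin.ext (coord_injective (ch.group_inj (valid_coord v.2) (valid_coord w.2) h
        (Eq.trans (Eq.symm hv) hw)))
    have himg : (fun v : Fin (M * (70 * I.num)) => (I.coord v).1) '' {v | ch.clustering M u v} =
        Set.Iio M := by
      refine Set.Subset.antisymm ?_ fun r hr => ?_
      · rintro _ ⟨v, -, rfl⟩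
        exact (valid_coord v.2).1
      · obtain ⟨v, hv⟩ := hsurj.2 ((⟨(ch.group (I.coord u)).1, (ch.group_mem (valid_coord u.2)).1⟩,
          ⟨(ch.group (I.coord u)).2, (ch.group_mem (valid_coord u.2)).2⟩), ⟨r, hr⟩)
        simp only [Prod.mk.injEq, Fin.mk.injEq] at hv
        exact ⟨v, Prod.ext hv.1.1.symm hv.1.2.symm, congrArg Fin.val hv.2⟩
    rw [← hinj'.ncard_image, himg, Set.ncard_eq_toFinset_card']
    simp
  · intro u v huv hne
    change I.adj (I.coord u) (I.coord v) = true
    rcases lt_trichotomy (I.coord u).1 (I.coord v).1 with h | h | h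
    · simp [Occs.adj, h, ch.link_of_group_eq (valid_coord u.2) (valid_coord v.2) h huv]
    · exact absurd (Fin.ext (coord_injective
        (ch.group_inj (valid_coord u.2) (valid_coord v.2) h huv))) hne
    · simp [Occs.adj, h, ch.link_of_group_eq (valid_coord v.2) (valid_coord u.2) h
        (Eq.symm huv)]

end Occs

theorem exists_isPerfect (φ : Formula) (M : ℕ) (hφ : φ.Satisfiable) :
    ∃ C, IsPerfect M ((occs (clauses φ)).graph M) C := by
  obtain ⟨v, hv⟩ := hφ
  have hnum := num_occs φ
  have h := (forall_clause_iff φ v).1 hv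
  obtain ⟨prev, hprev⟩ := (occs (clauses φ)).exists_prev
  have h' : ∀ c, ∃ p < 3, c < φ.length → v ((occs (clauses φ)).var (3 * c + p)) =
      (occs (clauses φ)).sgn (3 * c + p) := fun c => by
    by_cases hc : c < φ.length
    · obtain ⟨p, hp, e⟩ := h c hc
      exact ⟨p, hp, fun _ => e⟩
    · exact ⟨0, by omega, fun h => absurd h hc⟩
  choose p hp hpv using h'
  let ch : Occs.Choice (occs (clauses φ)) :=
    { tr := fun k => v ((occs (clauses φ)).var k)
      prev := prev
      p := p
      tr_next := fun k hk => by rw [(Occs.next_spec hk).2.1]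
      prev_lt := fun k hk => (hprev k hk).1
      next_prev := fun k hk => (hprev k hk).2
      p_lt := hp
      tr_p := fun k hk hkp => by
        have := hpv (k / 3) (by omega)
        rwa [← hkp, Nat.div_add_mod] at this
      num_mod := by omega }
  exact ⟨_, ch.isPerfect M⟩

end

section

/-! ### The number of edges -/

namespace Occs

variable {I : Occs} {M : ℕ}

theorem near_of_link {a b : ℕ × ℕ × ℕ} (h : I.link a b = true) :
    (a.2.1 < 2 ∧ b.2.1 < 2 ∧ (b.2.2 = a.2.2 ∨ b.2.2 = I.next a.2.2 ∨ a.2.2 = I.next b.2.2 ∨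
      b.2.2 / 3 = a.2.2 / 3)) ∨ (2 ≤ a.2.1 ∧ b.2 = a.2) := by
  obtain ⟨r, t, k⟩ := a
  obtain ⟨r', t', k'⟩ := b
  simp only [link, tipPartner, tipGroup, partnerGroup, eligible, Prod.mk.injEq, Bool.cond_eq_ite, decide_eq_true_eq] at h ⊢
  split_ifs at h <;> simp only [Bool.or_eq_true, Bool.and_eq_true, decide_eq_true_eq] at h <;> grind

/-- In each rank a point with index below 2 has at most 12 neighbours: two indices, and for the
occurrence `k` itself, its successor, its predecessor or one of the three in its clause. A padding
point has at most one. With `N` occurrences this gives at most `(2 * 12 + 68) * M² * N` adjacent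
ordered pairs, and `92 * M² + 140 * M ≤ 140 * M²` for `M ≥ 3`; the number 70 is chosen for this. -/
theorem ncard_edges (I : Occs) {M : ℕ} (hM : 3 ≤ M) :
    {p : Fin (M * (70 * I.num)) × Fin (M * (70 * I.num)) |
      (I.graph M).Adj p.1 p.2}.ncard + 2 * (M * (70 * I.num)) ≤
    2 * (M * (70 * I.num) * M) := by
  obtain ⟨prev, hprev⟩ := I.exists_prev
  set K : ℕ → ℕ → ℕ := fun k i => if i = 0 then k else if i = 1 then I.next k else
    if i = 2 then prev k else 3 * (k / 3) + (i - 3) with hK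
  set R := Finset.range M
  set N := Finset.range I.num
  let P := Finset.range 2
  let D₁ := (R ×ˢ P ×ˢ N) ×ˢ (R ×ˢ P ×ˢ Finset.range 6)
  let D₂ := (R ×ˢ Finset.Ico 2 70 ×ˢ N) ×ˢ R
  let E := D₁.image (fun x => (x.1, (x.2.1, x.2.2.1, K x.1.2.2 x.2.2.2))) ∪
    D₂.image (fun x => (x.1, (x.2, x.1.2)))
  have hE : E.card ≤ 92 * (M * M * I.num) := by
    refine (Finset.card_union_le _ _).trans ((add_le_add Finset.card_image_le
      Finset.card_image_le).trans (le_of_eq ?_))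
    simp only [D₁, D₂, R, N, P, Finset.card_product, Finset.card_range, Nat.card_Ico]
    ring
  have hS : {p : Fin (M * (70 * I.num)) × Fin (M * (70 * I.num)) |
      (I.graph M).Adj p.1 p.2}.ncard ≤ E.card := by
    rw [← Set.ncard_coe_finset]
    refine Set.ncard_le_ncard_of_injOn (fun p => (I.coord p.1, I.coord p.2)) ?_ ?_
      E.finite_toSet
    · rintro ⟨u, v⟩ h
      have hu := valid_coord (I := I) u.2
      have hv := valid_coord (I := I) v.2
      have h' : I.link (I.coord u) (I.coord v) = true ∨ I.link (I.coord v) (I.coord u) = true := by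
        change I.adj (I.coord u) (I.coord v) = true at h
        simp only [adj, Bool.or_eq_true, Bool.and_eq_true] at h
        exact h.imp And.right And.right
      simp only
      generalize I.coord u = a at *
      generalize I.coord v = b at *
      have h'' : (a.2.1 < 2 ∧ b.2.1 < 2 ∧ (b.2.2 = a.2.2 ∨ b.2.2 = I.next a.2.2 ∨
          a.2.2 = I.next b.2.2 ∨ b.2.2 / 3 = a.2.2 / 3)) ∨ (2 ≤ a.2.1 ∧ b.2 = a.2) := by
        rcases h' with h' | h' <;> have := near_of_link h'
        · exact this
        · grind
      obtain ⟨hu₁, hu₂, hu₃⟩ := hu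
      obtain ⟨hv₁, hv₂, hv₃⟩ := hv
      obtain ⟨r, t, k⟩ := a
      obtain ⟨r', t', k'⟩ := b
      simp only at hu₁ hu₂ hu₃ hv₁ hv₂ hv₃ h''
      refine Finset.mem_coe.2 (Finset.mem_union.2 ?_)
      rcases h'' with ⟨h₁, h₂, h₃⟩ | ⟨h₁, h₂⟩
      · left
        have : ∃ i < 6, K k i = k' := by
          rcases h₃ with h₃ | h₃ | h₃ | h₃
          · exact ⟨0, by omega, by simp [hK, h₃]⟩
          · exact ⟨1, by omega, by simp [hK, h₃]⟩
          · refine ⟨2, by omega, ?_⟩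
            simp only [hK]
            exact next_inj (hprev k hu₃).1 hv₃ ((hprev k hu₃).2.trans h₃)
          · refine ⟨k' % 3 + 3, by omega, ?_⟩
            simp only [hK]
            rw [if_neg (by omega), if_neg (by omega), if_neg (by omega), Nat.add_sub_cancel, ← h₃,
              Nat.div_add_mod]
        obtain ⟨i, hi, e⟩ := this
        exact Finset.mem_image.2 ⟨((r, t, k), (r', t', i)), by
          simp [D₁, R, P, N]; omega, by simp [e]⟩
      · right
        simp only [Prod.mk.injEq] at h₂
        exact Finset.mem_image.2 ⟨((r, t, k), r'), by simp [D₂, R, N]; omega, by simp [h₂]⟩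
    · rintro ⟨u, v⟩ - ⟨u', v'⟩ - h
      simp only [Prod.mk.injEq] at h ⊢
      exact ⟨Fin.ext (coord_injective h.1), Fin.ext (coord_injective h.2)⟩
  have : 3 * (M * I.num) ≤ M * M * I.num := by
    rw [← mul_assoc]
    exact Nat.mul_le_mul_right _ (Nat.mul_le_mul_right _ hM)
  have e : 2 * (M * (70 * I.num) * M) = 140 * (M * M * I.num) := by ring
  have e' : 2 * (M * (70 * I.num)) = 140 * (M * I.num) := by ring
  omega

end Occs

/-- A satisfiable formula is reduced to a graph with a clustering that satisfies the promise. -/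
theorem exists_promiseInputs {M : ℕ} (hM : 3 ≤ M) {φ : Formula} (hφ : φ.Satisfiable) :
    ∃ C, IsPerfect M ((occs (clauses φ)).graph M) C ∧
      promiseInputs M 0 (1 / 2) _ ((occs (clauses φ)).graph M) C := by
  obtain ⟨C, hC⟩ := exists_isPerfect φ M hφ
  exact ⟨C, hC, hC.isOptimal, hC.isInformative (by simpa using Occs.ncard_edges _ hM)⟩

end

section

/-! ### Exhaustive search for the answers of the oracle -/

theorem RunsTo.iterate {σ : Type} [Enc σ] {f : Bool × σ → Bool × σ} {c : Cmd}
    {T : Bool × σ → ℕ}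
    (hc : ∀ a s, s 0 = enc a → RunsTo c s (fun s' => s' 0 = enc (f a)) (T a))
    (st : ℕ → Bool × σ) (hst : ∀ i, f (st i) = st (i + 1)) (J : ℕ)
    (h : ∀ i < J, (st i).1 = true) (hJ : (st J).1 = false) (B : ℕ)
    (hB : ∀ i < J, T (st i) + 1 ≤ B) (r : Store) (hr : r 0 = enc (st 0)) :
    RunsTo (.loop (.hd (.var 0)) c) r (fun r' => r' 0 = enc (st J)) (J * B + 1) := by
  have key : ∀ d i, i + d = J → ∀ r : Store, r 0 = enc (st i) →
      RunsTo (.loop (.hd (.var 0)) c) r (fun r' => r' 0 = enc (st J)) (d * B + 1) := by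
    intro d
    induction d with
    | zero =>
      intro i hi r hr
      obtain rfl : i = J := hi
      exact (RunsTo.loop_done (by simp [Expr.eval, hr, enc_pair, Data.hd, hJ, enc_bool,
        Data.ofBool]) hr).mono (fun _ h => h) (by omega)
    | succ d ih =>
      intro i hi r hr
      have := hB i (by omega)
      refine (RunsTo.loop_step (by simp [Expr.eval, hr, enc_pair, Data.hd, h i (by omega),
        enc_bool, Data.ofBool]) (hc (st i) r hr) fun s' hs' =>
          ih (i + 1) (by omega) s' (by rw [hs', hst])).mono (fun _ h => h) ?_
      rw [Nat.succ_mul]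
      omega
  exact key J 0 (by omega) r hr

/-- The strings of `i` bits. -/
def strings : ℕ → List (List Bool)
  | 0 => [[]]
  | i + 1 => (strings i).flatMap fun g => [false :: g, true :: g]

theorem mem_strings (i : ℕ) (g : List Bool) : g ∈ strings i ↔ g.length = i := by
  induction i generalizing g with
  | zero => simp [strings]
  | succ i ih =>
    simp only [strings, List.mem_flatMap, ih]
    constructor
    · rintro ⟨g', rfl, h⟩
      simp only [List.mem_cons, List.not_mem_nil, or_false] at h
      rcases h with rfl | rfl <;> rfl
    · intro h
      obtain ⟨b, g', rfl⟩ := List.exists_cons_of_length_eq_add_one h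
      exact ⟨g', by simpa using h, by cases b <;> simp⟩

theorem length_strings (i : ℕ) : (strings i).length = 2 ^ i := by
  induction i with
  | zero => rfl
  | succ i ih => simp [strings, List.length_flatMap, ih, pow_succ]

theorem sz_strings_le (i : ℕ) : sz (strings i) ≤ 4 ^ i := by
  have h₁ : ∀ g ∈ strings i, sz g ≤ i := fun g hg => by
    have := sz_list_le g 0 fun x _ => le_rfl
    rw [(mem_strings i g).1 hg] at this
    simpa using this
  refine (sz_list_le _ _ h₁).trans ?_
  rw [length_strings, show 4 = 2 * 2 from rfl, mul_pow]
  exact Nat.mul_le_mul_left _ Nat.lt_two_pow_self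

/-- The formula, the adjacency matrix and the time allowed for a run. -/
abbrev Env := List (List Literal) × List (List Bool) × ℕ

variable (F : List (List Bool) × ℕ × List Bool → Opaque × Bool × History) (M : ℕ)

/-- Whether more answers than those in `g` may be needed. -/
def more (e : Env) (g : List Bool) : Bool :=
  (F (e.2.1, e.2.2, g)).2.1 && consistent M e.2.1.length (F (e.2.1, e.2.2, g)).2.2

/-- Whether the answers in `g` lead to a satisfying assignment. -/
def good (e : Env) (g : List Bool) : Bool := accepts e.1 (F (e.2.1, e.2.2, g)).1

/-- A round of the search. -/
def round (w : Env × ℕ × List (List Bool) × Bool) : Bool × Env × ℕ × List (List Bool) × Bool :=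
  (w.2.2.1.any (more F M w.1) && decide (0 < w.2.1 - 1), w.1, w.2.1 - 1,
    w.2.2.1.flatMap (fun g => [false :: g, true :: g]), w.2.2.2 || w.2.2.1.any (good F w.1))

variable {F} in
theorem PT.round (hF : PT F) : PT (round F M) := by
  have h₁ : PT (fun p : Env × List Bool => more F M p.1 p.2) := by
    have h : PT (fun p : Env × List Bool => F (p.1.2.1, p.1.2.2, p.2)) := by fun_prop
    have := (PT.consistent M).comp (f := fun p : Env × List Bool =>
      (p.1.2.1.length, (F (p.1.2.1, p.1.2.2, p.2)).2.2)) (by fun_prop)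
    unfold more
    fun_prop
  have h₂ : PT (fun p : Env × List Bool => good F p.1 p.2) :=
    PT.accepts.comp (f := fun p : Env × List Bool => (p.1.1, (F (p.1.2.1, p.1.2.2, p.2)).1))
      (by fun_prop)
  have h₃ : PT (fun p : (Env × ℕ × List (List Bool) × Bool) × List Bool => more F M p.1.1 p.2) :=
    h₁.comp (f := fun p : (Env × ℕ × List (List Bool) × Bool) × List Bool => (p.1.1, p.2))
      (by fun_prop)
  have h₄ : PT (fun p : (Env × ℕ × List (List Bool) × Bool) × List Bool => good F p.1.1 p.2) :=
    h₂.comp (f := fun p : (Env × ℕ × List (List Bool) × Bool) × List Bool => (p.1.1, p.2))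
      (by fun_prop)
  unfold PCC.round
  fun_prop

/-- The state of the search after `i` rounds. -/
def state (e : Env) (c i : ℕ) : Bool × Env × ℕ × List (List Bool) × Bool :=
  (decide (i = 0) || ((strings (i - 1)).any (more F M e) && decide (0 < c - i)), e, c - i, strings i,
    (List.range i).any fun j => (strings j).any (good F e))

theorem round_state (e : Env) (c i : ℕ) :
    round F M (state F M e c i).2 = state F M e c (i + 1) := by
  simp only [round, state, strings, List.range_succ, List.any_append, Nat.sub_sub]
  simp

theorem sz_state_le (e : Env) (c i : ℕ) :
    sz (state F M e c i) ≤ sz (state F M e c 0) + 4 ^ i := by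
  have := sz_strings_le i
  simp only [state, sz_pair, sz_bool, sz_nat]
  omega

/-- The number of rounds of the search. -/
theorem exists_rounds (e : Env) (c : ℕ) : ∃ J, 0 < J ∧ (∀ i < J, (state F M e c i).1 = true) ∧
    (state F M e c J).1 = false := by
  classical
  -- The counter is 0 after `c` rounds already, but the flag of round 0 is raised even for `c = 0`.
  have h : ∃ i, (state F M e c i).1 = false := ⟨c + 1, by simp [state]⟩
  refine ⟨Nat.find h, ?_, fun i hi => by simpa using Nat.find_min h hi, Nat.find_spec h⟩
  rw [Nat.pos_iff_ne_zero, ne_eq, Nat.find_eq_zero]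
  simp [state]

/-- Indices are written in unary; the numbering keeps them below `3 * φ.length`, so polynomial time
in the size is polynomial in the number of clauses. -/
theorem sz_clauses_le {φ : Formula} (hφ : φ.Numbered) : sz (clauses φ) ≤ (φ.length + 2) ^ 6 := by
  have h : ∀ c ∈ clauses φ, sz c ≤ 9 * φ.length + 6 := by
    intro c hc
    obtain ⟨c, hc', rfl⟩ := List.mem_map.1 hc
    have := hφ c hc'
    simp only [sz_cons, sz_nil, sz_pair, sz_nat, sz_bool]
    omega
  refine (sz_list_le _ _ h).trans ?_
  rw [clauses, List.length_map]
  have h₁ : 2 ^ 4 ≤ (φ.length + 2) ^ 4 := Nat.pow_le_pow_left (by omega) 4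
  rw [show (φ.length + 2) ^ 6 = (φ.length + 2) ^ 2 * (φ.length + 2) ^ 4 by ring]
  nlinarith [Nat.mul_le_mul_left ((φ.length + 2) ^ 2) h₁]

variable {F} in
/-- The search program. -/
theorem exists_search (hF : PT F) : ∃ K, ∀ c κ : ℕ → ℕ, PT c → PT κ → ∃ P K',
    ∀ φ : Formula, φ.Numbered → ∀ e : Env,
      e = (clauses φ, (occs (clauses φ)).matrix M, κ φ.length) → ∃ b t J, 0 < J ∧
      (∀ i, i + 1 < J → i + 1 < c φ.length ∧ ∃ g, g.length = i ∧ more F M e g = true) ∧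
      (J < c φ.length → ∀ g, g.length + 1 = J → more F M e g = false) ∧
      Runs noOracle P φ.encode b t 0 ∧
      (b ≠ .nil ↔ ∃ g, g.length < J ∧ good F e g = true) ∧
      t ≤ (φ.length + 2) ^ K' * 2 ^ (K * J) := by
  obtain ⟨cs, Ts, hs, ⟨k, hk⟩, -⟩ := (PT.round M hF).comp
    (f := fun p : Bool × Env × ℕ × List (List Bool) × Bool => p.2) (by fun_prop)
  -- A round takes time polynomial, with exponent `k`, in a state of size at most `S + 4 ^ J`, which
  -- contributes `2 ^ (2 * k * J)`; the number `J` of rounds contributes another `2 ^ J`. The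
  -- constant does not depend on `c` or `κ`, so that `c` may later be chosen in terms of it.
  refine ⟨2 * k + 1, fun c κ hc hκ => ?_⟩
  let st₀ : List (List Literal) → Bool × Env × ℕ × List (List Bool) × Bool := fun φ =>
    (true, (φ, (occs φ).matrix M, κ φ.length), c φ.length, [[]], false)
  have hp : PT st₀ := by
    have h₁ := (PT.matrix M).comp PT.occs
    fun_prop
  obtain ⟨cp, Tp, hcp, hTp, hSp⟩ := hp
  have hbd : PolyBd (sz (α := List (List Literal))) fun φ =>
      Tp φ + (sz (st₀ φ) + 4) ^ k + 4 := (hTp.add ((hSp.add (.const 4)).pow k)).add (.const 4)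
  obtain ⟨k', hk'⟩ := hbd
  refine ⟨.seq cp (.seq (.loop (.hd (.var 0)) cs)
    (.assign 0 (.tl (.tl (.tl (.tl (.var 0))))))), 6 * k' + k' , fun φ hφ e he => ?_⟩
  obtain ⟨J, hJ, h₁, h₂⟩ := exists_rounds F M e (c φ.length)
  have hst : st₀ (clauses φ) = state F M e (c φ.length) 0 := by
    simp [st₀, state, he, strings, clauses]
  set S := sz (st₀ (clauses φ)) with hS
  have htime : ∀ i < J, Ts (state F M e (c φ.length) i) + 1 ≤ (S + 4) ^ k * 2 ^ (2 * k * J) + 1 := by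
    intro i hi
    refine Nat.add_le_add_right ((hk _).trans ?_) 1
    rw [Nat.mul_assoc 2 k J, Nat.mul_comm k J, ← Nat.mul_assoc, pow_mul 2 (2 * J) k, ← mul_pow,
      pow_mul]
    refine Nat.pow_le_pow_left ?_ k
    have h₃ := sz_state_le F M e (c φ.length) i
    rw [← hst, ← hS] at h₃
    have h₄ : 4 ^ i ≤ (2 ^ 2) ^ J := Nat.pow_le_pow_right (by omega) hi.le
    nlinarith [Nat.one_le_pow J (2 ^ 2) (by omega)]
  have hrun : RunsTo (.seq cp (.seq (.loop (.hd (.var 0)) cs)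
      (.assign 0 (.tl (.tl (.tl (.tl (.var 0)))))))) (Function.update (fun _ => .nil) 0 φ.encode)
      (fun s' => s' 0 = Data.ofBool ((List.range J).any fun j => (strings j).any (good F e)))
      (Tp (clauses φ) + (J * ((S + 4) ^ k * 2 ^ (2 * k * J) + 1) + 1 + 1)) := by
    refine (hcp (clauses φ) _ (by simp [encode_eq])).seq fun s₁ e₁ => ?_
    refine (RunsTo.iterate hs _ (round_state F M e (c φ.length)) J h₁ h₂ _ htime s₁
      (by rw [e₁, hst])).seq fun s₂ e₂ => .assign ?_
    simp [Expr.eval, e₂, enc_pair, state, Data.tl, enc_bool]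
  obtain ⟨s', t, h, hb, ht⟩ := hrun
  refine ⟨_, t, J, hJ, fun i hi => ?_, fun hJc g hg => ?_, ⟨s', h, rfl⟩, ?_, ht.trans ?_⟩
  · have := h₁ (i + 1) hi
    simp only [state, Nat.add_sub_cancel, Bool.or_eq_true, decide_eq_true_eq, Bool.and_eq_true,
      List.any_eq_true, mem_strings] at this
    obtain h | ⟨h, h'⟩ := this
    · omega
    · exact ⟨by omega, h⟩
  · simp only [state, Bool.or_eq_false_iff, Bool.and_eq_false_iff, decide_eq_false_iff_not,
      List.any_eq_false, mem_strings] at h₂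
    rcases h₂.2 with h | h
    · simpa using h g (by omega)
    · omega
  · rw [hb, ofBool_ne_nil]
    simp only [List.any_eq_true, mem_strings, List.mem_range]
    exact ⟨fun ⟨j, hj, g, hg, h⟩ => ⟨g, hg ▸ hj, h⟩, fun ⟨g, hg, h⟩ => ⟨_, hg, g, rfl, h⟩⟩
  · have h₃ := hk' (clauses φ)
    have h₄ : (sz (clauses φ) + 2) ^ k' ≤ (φ.length + 2) ^ (6 * k' + k') := by
      rw [← Nat.succ_mul, pow_mul]
      refine Nat.pow_le_pow_left ?_ k'
      have := sz_clauses_le hφ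
      have h₅ : 2 ^ 6 ≤ (φ.length + 2) ^ 6 := Nat.pow_le_pow_left (by omega) 6
      rw [pow_succ (φ.length + 2) 6]
      nlinarith [Nat.zero_le ((φ.length + 2) ^ 6 * φ.length)]
    refine le_trans ?_ (Nat.mul_le_mul_right _ (h₃.trans h₄))
    have h₅ : J + 1 ≤ 2 ^ J := Nat.lt_two_pow_self
    rw [Nat.succ_mul (2 * k), pow_add]
    dsimp only
    set X := (S + 4) ^ k
    set Y := 2 ^ (2 * k * J)
    have hY : 1 ≤ Y := Nat.one_le_two_pow
    set Z := 2 ^ J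
    have hZ : 1 ≤ Z := by omega
    have e₁ : Tp (clauses φ) ≤ Tp (clauses φ) * (Y * Z) := Nat.le_mul_of_pos_right _ (by positivity)
    have e₂ : J * (X * Y) ≤ X * (Y * Z) := by
      calc J * (X * Y) ≤ Z * (X * Y) := Nat.mul_le_mul_right _ (by omega)
        _ = _ := by ring
    have e₃ : J + 1 ≤ Y * Z := by nlinarith
    nlinarith

end

/-! ### The decision procedure for 3-SAT -/

theorem RunsOn.det {A : Cmd} {n : ℕ} {G : SimpleGraph (Fin n)} {C : Setoid (Fin n)} {b b' : Data}
    {t t' q q' : ℕ} (h : RunsOn A G C b t q) (h' : RunsOn A G C b' t' q') :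
    b = b' ∧ t = t' ∧ q = q' := by
  obtain ⟨s, h, rfl⟩ := h
  obtain ⟨s', h', rfl⟩ := h'
  obtain ⟨rfl, rfl, rfl⟩ := h.det h'
  simp

theorem RunsOn.queries_le {A : Cmd} {n : ℕ} {G : SimpleGraph (Fin n)} {C : Setoid (Fin n)}
    {b : Data} {t q : ℕ} (h : RunsOn A G C b t q) : q ≤ t := by
  obtain ⟨s, h, -⟩ := h
  exact h.queries_le

/-- From an algorithm for promise correlation clustering, a program for 3-SAT: `c` bounds the number
of queries and `κ` the time for which the algorithm is run. The number `J` of rounds governs the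
time. -/
theorem exists_decider {M : ℕ} (hM : 3 ≤ M) {A : Cmd} (hA : SolvesPCC A M 0 (1 / 2)) :
    ∃ K, ∀ c κ : ℕ → ℕ, PT c → PT κ → ∃ P K', ∀ φ : Formula, φ.Numbered →
      (∀ C, promiseInputs M 0 (1 / 2) _ ((occs (clauses φ)).graph M) C →
        ∃ b t q, RunsOn A ((occs (clauses φ)).graph M) C b t q ∧ t ≤ κ φ.length ∧
          q < c φ.length) →
      ∃ b t J, Runs noOracle P φ.encode b t 0 ∧ (b ≠ .nil ↔ φ.Satisfiable) ∧
        t ≤ (φ.length + 2) ^ K' * 2 ^ (K * J) ∧ J ≤ c φ.length + 1 ∧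
        ((∀ C, ClustersAtMost M C →
          ∃ b t q, RunsOn A ((occs (clauses φ)).graph M) C b t q ∧ t ≤ κ φ.length) →
          J ≤ 1 ∨ ∃ C, ClustersAtMost M C ∧
            ∃ b t q, RunsOn A ((occs (clauses φ)).graph M) C b t q ∧ J ≤ q + 1) := by
  obtain ⟨F, hF, hsim⟩ := exists_simulation (List (List Bool)) A
  obtain ⟨K, hK⟩ := exists_search M hF
  refine ⟨K, fun c κ hc hκ => ?_⟩
  obtain ⟨P, K', hP⟩ := hK c κ hc hκ
  refine ⟨P, K', fun φ hφ hrun => ?_⟩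
  obtain ⟨b, t, J, hJ, hmore, hdone, hb, hgood, ht⟩ := hP φ hφ _ rfl
  have hlen : ((occs (clauses φ)).matrix M).length = M * (70 * (occs (clauses φ)).num) := by
    simp [Occs.matrix]
  simp only [more, good, hlen, Bool.and_eq_true] at hmore hdone hgood
  set I := occs (clauses φ)
  refine ⟨b, t, J, hb, hgood.trans ⟨fun ⟨g, _, hg⟩ => satisfiable_of_accepts hg, fun hsat => ?_⟩,
    ht, ?_, fun hall => ?_⟩
  · obtain ⟨C, hC, hpr⟩ := exists_promiseInputs hM hsat
    obtain ⟨b', t', q, hr, ht', hq⟩ := hrun C hpr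
    obtain ⟨C', t'', q', hopt, hr'⟩ := hA _ _ _ hpr
    obtain ⟨rfl, -, -⟩ := hr.det hr'
    have hacc := accepts_of_isPerfect hM φ (hC.of_isOptimal hopt)
    rw [RunsOn, encodeRel_graph] at hr
    obtain ⟨l, rfl, hl⟩ := hsim _ _ _ _ _ _ hr ht'
    have hagr : ∀ i, Agrees (sameClusterOracle C) (F (I.matrix M, κ φ.length, l.take i)).2.2 :=
      fun i => (hl _).2 ⟨l.drop i, [], by simp⟩
    -- The search cannot stop before the round of the true answers `l`: a shorter initial part of
    -- `l` runs out, while its history is consistent with `C`, so the search would have gone on.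
    have hJl : l.length < J := by
      by_contra hlt
      obtain ⟨j, rfl⟩ : ∃ j, J = j + 1 := ⟨J - 1, by omega⟩
      have hj : (l.take j).length = j := by rw [List.length_take]; omega
      have h₁ := hdone (by omega) (l.take j) (by omega)
      rw [Bool.and_eq_false_iff] at h₁
      rcases (hl (l.take j)).1 (hagr j) with h₂ | h₂
      · omega
      · rcases h₁ with h₁ | h₁
        · exact absurd h₂.1 (by simp [h₁])
        · exact absurd (h₁.symm.trans ((consistent_iff _ _ _).2 ⟨C, hpr.1.1, hagr j⟩)) (by simp)
    refine ⟨l, hJl, ?_⟩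
    have h₁ := (hl l).1 (by simpa using hagr l.length)
    rcases h₁ with ⟨-, h₁, -⟩ | h₁
    · rw [← hacc, ← h₁]
    · omega
  · rcases Nat.lt_or_ge 1 J with h | h
    · have := (hmore (J - 2) (by omega)).1
      omega
    · omega
  · rcases Nat.lt_or_ge 1 J with h | h
    · right
      -- Round `J - 2` was not the last. Some string of that length ran out with a consistent
      -- history, so an actual clustering makes `A` ask more than `J - 2` queries.
      obtain ⟨-, g, hg, h₁, h₂⟩ := hmore (J - 2) (by omega)
      obtain ⟨C, hC, hagr⟩ := (consistent_iff _ _ _).1 h₂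
      obtain ⟨b', t', q, hr, ht'⟩ := hall C hC
      refine ⟨C, hC, b', t', q, hr, ?_⟩
      rw [RunsOn, encodeRel_graph] at hr
      obtain ⟨l, rfl, hl⟩ := hsim _ _ _ _ _ _ hr ht'
      rcases (hl g).1 hagr with h₃ | h₃
      · simp [h₁] at h₃
      · omega
    · exact Or.inl h

/-! ### Running times -/

theorem exists_eval_le (p : Polynomial ℕ) : ∃ k, ∀ n, p.eval n ≤ (n + 2) ^ k := by
  have h : PolyBd (fun n : ℕ => n) fun n => p.eval n := by
    induction p using Polynomial.induction_on' with
    | add p q hp hq => simpa using hp.add hq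
    | monomial i a => simpa using (PolyBd.const a).mul (PolyBd.self.pow i)
  exact h

theorem clock_pt (M k : ℕ) : PT fun m : ℕ => (M * (70 * (3 * m)) + 2) ^ k := by fun_prop

theorem isLittleO_logb : (fun m : ℕ => Real.logb 2 (m + 2)) =o[atTop] fun m : ℕ => (m : ℝ) := by
  have h₁ : (fun m : ℕ => Real.log ((m + 2 : ℕ) : ℝ)) =o[atTop] fun m : ℕ => ((m + 2 : ℕ) : ℝ) :=
    Real.isLittleO_log_id_atTop.comp_tendsto
      (tendsto_natCast_atTop_atTop.comp (tendsto_add_atTop_nat 2))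
  have h₂ : (fun m : ℕ => ((m + 2 : ℕ) : ℝ)) =O[atTop] fun m : ℕ => (m : ℝ) := by
    refine IsBigO.of_bound 3 ((eventually_ge_atTop 1).mono fun m hm => ?_)
    rw [Real.norm_natCast, Real.norm_natCast]
    norm_cast
    omega
  have h₃ := (h₁.trans_isBigO h₂).const_mul_left (Real.log 2)⁻¹
  refine h₃.congr_left fun m => ?_
  rw [Real.logb, div_eq_inv_mul]
  push_cast
  rfl

/-! ### Worst-case numbers of queries and the two lower bounds -/

/-- The largest number of queries. -/
noncomputable def maxQueries (A : Cmd) (S : InputClass) (n : ℕ) : ℕ :=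
  sSup {q | ∃ (G : SimpleGraph (Fin n)) (C : Setoid (Fin n)), S n G C ∧
    ∃ (b : Data) (t : ℕ), RunsOn A G C b t q}

theorem bddAbove_queries {A : Cmd} {S : InputClass} (h : RunsInPolyTime A S) (n : ℕ) :
    BddAbove {q | ∃ (G : SimpleGraph (Fin n)) (C : Setoid (Fin n)), S n G C ∧
      ∃ (b : Data) (t : ℕ), RunsOn A G C b t q} := by
  obtain ⟨p, hp⟩ := h
  refine ⟨p.eval n, ?_⟩
  rintro q ⟨G, C, hS, b, t, hr⟩
  obtain ⟨b', t', q', hr', ht⟩ := hp n G C hS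
  obtain ⟨-, rfl, rfl⟩ := hr.det hr'
  exact hr.queries_le.trans ht

/-- Polynomial time bounds the numbers of queries for each `n`, so their supremum is attained by an
actual input. -/
theorem eventually_maxQueries_le {A : Cmd} {S : InputClass} (h : RunsInPolyTime A S)
    (hl : ¬ MakesLinearlyManyQueries A S) {c : ℝ} (hc : 0 < c) :
    ∀ᶠ n : ℕ in atTop, (maxQueries A S n : ℝ) ≤ c * n := by
  have h₁ : ¬ ∃ᶠ n : ℕ in atTop, ∃ (G : SimpleGraph (Fin n)) (C : Setoid (Fin n)), S n G C ∧
      ∃ (b : Data) (t q : ℕ), RunsOn A G C b t q ∧ c * (n : ℝ) ≤ (q : ℝ) := fun h => hl ⟨c, hc, h⟩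
  refine (not_frequently.1 h₁).mono fun n hn => ?_
  rcases Set.eq_empty_or_nonempty {q | ∃ (G : SimpleGraph (Fin n)) (C : Setoid (Fin n)),
      S n G C ∧ ∃ (b : Data) (t : ℕ), RunsOn A G C b t q} with he | he
  · rw [maxQueries, he]
    simp only [csSup_empty, Nat.bot_eq_zero, Nat.cast_zero]
    positivity
  · obtain ⟨G, C, hS, b, t, hr⟩ := Nat.sSup_mem he (bddAbove_queries h n)
    by_contra hlt
    exact hn ⟨G, C, hS, b, t, _, hr, (not_le.1 hlt).le⟩

theorem le_maxQueries {A : Cmd} {S : InputClass} (h : RunsInPolyTime A S) {n : ℕ}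
    {G : SimpleGraph (Fin n)} {C : Setoid (Fin n)} (hS : S n G C) {b : Data} {t q : ℕ}
    (hr : RunsOn A G C b t q) : q ≤ maxQueries A S n :=
  le_csSup (bddAbove_queries h n) ⟨G, C, hS, b, t, hr⟩

theorem tendsto_size {M : ℕ} (hM : 3 ≤ M) :
    Tendsto (fun m : ℕ => M * (70 * (3 * m))) atTop atTop :=
  tendsto_atTop_mono (fun m => by
    have := Nat.mul_le_mul_right (70 * (3 * m)) hM
    dsimp only [id]
    omega) tendsto_id

theorem size_eq (M : ℕ) (φ : Formula) :
    M * (70 * (occs (clauses φ)).num) = M * (70 * (3 * φ.length)) := by rw [num_occs]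

/-- The cutoff `c` is merely the polynomial bound on the running time. The number of rounds is
controlled by the true number of queries, which enters the analysis only and need not be computable.
-/
theorem linear_of_eth {M : ℕ} (hM : 3 ≤ M) {A : Cmd} (hA : SolvesPCC A M 0 (1 / 2)) (hE : ETH)
    (hT : RunsInPolyTime A (allInputs M)) : MakesLinearlyManyQueries A (allInputs M) := by
  by_contra hl
  obtain ⟨p, hp⟩ := id hT
  obtain ⟨k, hk⟩ := exists_eval_le p
  obtain ⟨K, hK⟩ := exists_decider hM hA
  obtain ⟨P, K', hP⟩ := hK (fun m => (M * (70 * (3 * m)) + 2) ^ k + 1)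
    (fun m => (M * (70 * (3 * m)) + 2) ^ k) (by fun_prop) (clock_pt M k)
  let Q : ℕ → ℕ := fun m => maxQueries A (allInputs M) (M * (70 * (3 * m)))
  refine hE ⟨P, fun m => K' * Real.logb 2 (m + 2) + K * ((Q m : ℝ) + 1), ?_, fun φ hφ => ?_⟩
  · have hQ : (fun m => (Q m : ℝ)) =o[atTop] fun m : ℕ => (m : ℝ) := by
      refine isLittleO_iff.2 fun ε hε => ?_
      have hM' : (0 : ℝ) < M * 210 := by positivity
      refine ((tendsto_size hM).eventually (eventually_maxQueries_le hT hl
        (div_pos hε hM'))).mono fun m hm => ?_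
      rw [Real.norm_natCast, Real.norm_natCast]
      refine hm.trans (le_of_eq ?_)
      push_cast
      field_simp
      ring
    have h₁ : (fun _ : ℕ => (1 : ℝ)) =o[atTop] fun m : ℕ => (m : ℝ) :=
      isLittleO_const_left.2 (Or.inr (tendsto_norm_atTop_atTop.comp tendsto_natCast_atTop_atTop))
    exact (isLittleO_logb.const_mul_left _).add ((hQ.add h₁).const_mul_left _)
  · have hall : ∀ C, ClustersAtMost M C → ∃ b t q,
        RunsOn A ((occs (clauses φ)).graph M) C b t q ∧
          t ≤ (M * (70 * (3 * φ.length)) + 2) ^ k := fun C hC => by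
      obtain ⟨b, t, q, hr, ht⟩ := hp _ ((occs (clauses φ)).graph M) C hC
      exact ⟨b, t, q, hr, ht.trans ((hk _).trans (by rw [size_eq]))⟩
    obtain ⟨b, t, J, hr, hb, ht, -, hJ⟩ := hP φ hφ fun C hC => by
      obtain ⟨b, t, q, hr, ht⟩ := hall C hC.1.1
      exact ⟨b, t, q, hr, ht, Nat.lt_succ_of_le (hr.queries_le.trans ht)⟩
    refine ⟨b, t, hr, hb, ?_⟩
    have hJQ : J ≤ Q φ.length + 1 := by
      rcases hJ hall with h | ⟨C, hC, b', t', q, hr', h⟩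
      · omega
      · have := le_maxQueries hT (S := allInputs M) hC hr'
        rw [size_eq] at this
        simp only [Q]
        omega
    have ht' : (t : ℝ) ≤ ((φ.length : ℝ) + 2) ^ K' * 2 ^ (K * (Q φ.length + 1)) := by
      have := ht.trans (Nat.mul_le_mul_left _
        (Nat.pow_le_pow_right (n := 2) (by omega) (Nat.mul_le_mul_left K hJQ)))
      exact_mod_cast this
    refine ht'.trans (le_of_eq ?_)
    dsimp only
    rw [Real.rpow_add two_pos, mul_comm (K' : ℝ), Real.rpow_mul two_pos.le,
      Real.rpow_logb two_pos (by norm_num) (by positivity), Real.rpow_natCast]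
    congr 1
    rw [← Real.rpow_natCast]
    push_cast
    rfl

theorem linear_of_ethWithRate {M : ℕ} (hM : 3 ≤ M) {A : Cmd} (hA : SolvesPCC A M 0 (1 / 2))
    (hE : ETHWithRate) (hT : RunsInPolyTime A (promiseInputs M 0 (1 / 2))) :
    MakesLinearlyManyQueries A (promiseInputs M 0 (1 / 2)) := by
  by_contra hl
  obtain ⟨δ, hδ, hE⟩ := hE
  obtain ⟨p, hp⟩ := id hT
  obtain ⟨k, hk⟩ := exists_eval_le p
  obtain ⟨K, hK⟩ := exists_decider hM hA
  -- With at most `m / d` queries the search costs `2 ^ (K * m / d)`, at most `2 ^ (δ / 2 * m)`; the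
  -- other half of the exponent absorbs the polynomial factor.
  obtain ⟨d, hd⟩ := exists_nat_gt ((K : ℝ) / (δ / 2))
  have hd₀ : (0 : ℝ) < d := lt_of_le_of_lt (by positivity) hd
  have hM' : (0 : ℝ) < M * 210 * d := by positivity
  obtain ⟨n₀, hn₀⟩ := eventually_atTop.1 (eventually_maxQueries_le hT hl (one_div_pos.2 hM'))
  -- The graph has `210 * M * m` vertices, so the bound beyond `n₀` reads `m / d`; below `n₀` the
  -- constant, a bound on the running time, suffices.
  obtain ⟨P, K', hP⟩ := hK (fun m => m / d + ((n₀ + 2) ^ k + 1))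
    (fun m => (M * (70 * (3 * m)) + 2) ^ k) (by fun_prop) (clock_pt M k)
  have hr₁ : 1 < (2 : ℝ) ^ (δ / 2) := Real.one_lt_rpow (by norm_num) (by positivity)
  obtain ⟨B, hB₀, hB⟩ := bound_of_isBigO_nat_atTop
    (isLittleO_pow_const_const_pow_of_one_lt (R := ℝ) K' hr₁).isBigO
  refine hE ⟨P, B * (2 ^ (δ / 2)) ^ 2 * 2 ^ (K * ((n₀ + 2) ^ k + 2)), fun φ hφ => ?_⟩
  obtain ⟨b, t, J, hr, hb, ht, hJ, -⟩ := hP φ hφ fun C hC => by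
    obtain ⟨b, t, q, hr, ht⟩ := hp _ _ C hC
    have ht' := ht.trans (hk _)
    refine ⟨b, t, q, hr, ht'.trans (by rw [size_eq]), ?_⟩
    rcases Nat.lt_or_ge (M * (70 * (occs (clauses φ)).num)) n₀ with h | h
    · have h₁ := Nat.pow_le_pow_left (show M * (70 * (occs (clauses φ)).num) + 2 ≤ n₀ + 2 by omega) k
      have := hr.queries_le
      have := Nat.zero_le (φ.length / d)
      omega
    · have h₁ := (Nat.cast_le.2 (le_maxQueries hT hC hr)).trans (hn₀ _ h)
      rw [size_eq] at h₁
      have h₂ : (q : ℝ) * d ≤ φ.length := by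
        refine (mul_le_mul_of_nonneg_right h₁ hd₀.le).trans (le_of_eq ?_)
        push_cast
        field_simp
        ring
      have h₃ : q ≤ φ.length / d :=
        (Nat.le_div_iff_mul_le (by exact_mod_cast hd₀)).2 (by exact_mod_cast h₂)
      omega
  refine ⟨b, t, hr, hb, ?_⟩
  set m := φ.length
  have h₁ : (t : ℝ) ≤ ((m : ℝ) + 2) ^ K' *
      (2 ^ (K * (m / d)) * 2 ^ (K * ((n₀ + 2) ^ k + 2))) := by
    have h : K * J ≤ K * (m / d) + K * ((n₀ + 2) ^ k + 2) := by
      rw [← Nat.mul_add]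
      exact Nat.mul_le_mul_left K (by omega)
    have := ht.trans (Nat.mul_le_mul_left _ (Nat.pow_le_pow_right (n := 2) (by omega) h))
    rw [pow_add] at this
    exact_mod_cast this
  have h₂ : ((m : ℝ) + 2) ^ K' ≤ B * ((2 ^ (δ / 2)) ^ 2 * 2 ^ (δ / 2 * m)) := by
    have := @hB (m + 2) (by positivity)
    rw [Real.norm_of_nonneg (by positivity), Real.norm_of_nonneg (by positivity), pow_add,
      mul_comm (((2 : ℝ) ^ (δ / 2)) ^ m)] at this
    rw [Real.rpow_mul two_pos.le, Real.rpow_natCast]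
    exact_mod_cast this
  have h₃ : (2 : ℝ) ^ (K * (m / d)) ≤ 2 ^ (δ / 2 * m) := by
    rw [← Real.rpow_natCast]
    refine Real.rpow_le_rpow_of_exponent_le (by norm_num) ?_
    have h₄ : ((m / d : ℕ) : ℝ) ≤ m / d := Nat.cast_div_le
    rw [div_lt_iff₀ (by positivity)] at hd
    have h₅ : (K : ℝ) * (m / d) ≤ δ / 2 * m := by
      rw [← mul_div_assoc, div_le_iff₀ hd₀]
      nlinarith [Nat.cast_nonneg (α := ℝ) m]
    push_cast
    exact (mul_le_mul_of_nonneg_left h₄ (Nat.cast_nonneg K)).trans h₅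
  calc (t : ℝ) ≤ _ := h₁
    _ ≤ B * ((2 ^ (δ / 2)) ^ 2 * 2 ^ (δ / 2 * m)) *
        (2 ^ (δ / 2 * m) * 2 ^ (K * ((n₀ + 2) ^ k + 2))) := by gcongr
    _ = B * (2 ^ (δ / 2)) ^ 2 * 2 ^ (K * ((n₀ + 2) ^ k + 2)) *
        (2 ^ (δ / 2 * m) * 2 ^ (δ / 2 * m)) := by ring
    _ = _ := by rw [← Real.rpow_add two_pos, ← add_mul, add_halves]

end PCC

theorem mainTheorem2 (M : ℕ) (hM : 3 ≤ M) (A : PCC.Cmd) (hA : PCC.SolvesPCC A M 0 (1 / 2)) :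
    (PCC.ETH → PCC.RunsInPolyTime A (PCC.allInputs M) →
      PCC.MakesLinearlyManyQueries A (PCC.allInputs M)) ∧
    (PCC.ETHWithRate → PCC.RunsInPolyTime A (PCC.promiseInputs M 0 (1 / 2)) →
      PCC.MakesLinearlyManyQueries A (PCC.promiseInputs M 0 (1 / 2))) :=
  ⟨PCC.linear_of_eth hM hA, PCC.linear_of_ethWithRate hM hA⟩
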